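/- **Geometry.** Let $D\subset\mathbb R^2$ be a bounded connected open set with $\partial D\in C^2$. Let $\Omega_1,\Omega_2,\Omega_3$ be pairwise disjoint connected open sets with $D=\operatorname{Int}(\overline{\Omega_1}\cup\overline{\Omega_2}\cup\overline{\Omega_3})$, and put $\Omega=\Omega_1\cup\Omega_2\cup\Omega_3$. Suppose $\partial\Omega_2=\partial\Omega_2^+\cup\partial\Omega_2^-$, where $\partial\Omega_2^\pm\subset D$ are disjoint $C^2$ Jordan curves, $D\cap\partial\Omega_3=\partial\Omega_2^+$ and $D\cap\partial\Omega_1=\partial\Omega_2^-$. The outer curve $\partial\Omega_2^+$ is parametrized by arc length, clockwise, by an $L$-periodic $\Gamma\in C^2(\mathbb R;D)$, injective on $[0,L)$. Put $\mathbb A=\begin{pmatrix}0&-1\\1&0\end{pmatrix}$, $\tau=\partial_\xi\Gamma$, $n=\mathbb A\tau$. The inner curve $\partial\Omega_2^-$ has the regular $L$-periodic $C^2$ parametrization $\Gamma_\varepsilon=\Gamma-\varepsilon h n$, injective on $[0,L)$, where $\varepsilon>0$ and $h\in C^2(\mathbb R)$ is positive and $L$-periodic; put $\tau_\varepsilon=\partial_\xi\Gamma_\varepsilon/|\partial_\xi\Gamma_\varepsilon|$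 and $n_\varepsilon=-\mathbb A\tau_\varepsilon$. Here $n$ and $n_\varepsilon$ are the outer normals of $\Omega_2$ on $\partial\Omega_2^+$ and $\partial\Omega_2^-$. The curvatures $\kappa,\kappa_\varepsilon$ are defined by $\partial_s\tau=\kappa n$ and $\partial_s\tau_\varepsilon=-\kappa_\varepsilon n_\varepsilon$, where $\partial_s$ is the derivative with respect to arc length ($\partial_s=\partial_\xi$ on $\Gamma$, $\partial_s=|\partial_\xi\Gamma_\varepsilon|^{-1}\partial_\xi$ on $\Gamma_\varepsilon$). **Functions.** Let $\mu,\mu_2>0$, and let $\mu(x)=\mu_2$ in $\Omega_2$ and $\mu(x)=\mu$ in $\Omega_1\cup\Omega_3$. Let $X^k(\Omega)$ be the set of $f\in C^k(\Omega)$ whose restriction to each $\Omega_j$, together with its derivatives of order at most $k$, extends continuously to $\overline{\Omega_j}$. Let $u\in C^2(\Omega;\mathbb R^2)\cap C(\overline D;\mathbb R^2)\cap X^1(\Omega;\mathbb R^2)$ with $u=U$ on $\partial D$ for a given $U:\partial D\to\mathbb R^2$, and let $p\in C^1(\Omega)\cap X^0(\Omega)$. Write $u^k,p^k$ for the restrictions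 to $\Omega_k$ (extended to $\overline{\Omega_k}$), and $\Sigma^k=-p^kI+\mu_k(\nabla u^k+(\nabla u^k)^T)$ with $\mu_1=\mu_3=\mu$. **Boundary value problem (P).** $$\mu(x)\Delta u=\nabla p,\quad \nabla\cdot u=0\ \text{ in }\Omega_1,\Omega_2,\Omega_3,\qquad u=U\ \text{ on }\partial D,$$ $$u^3\cdot n=u^2\cdot n,\quad u^3\cdot\tau=u^2\cdot\tau,\quad (\Sigma^3-\Sigma^2)n=-\kappa n\quad\text{on }\partial\Omega_2^+,$$ $$u^1\cdot n_\varepsilon=u^2\cdot n_\varepsilon,\quad u^1\cdot\tau_\varepsilon=u^2\cdot\tau_\varepsilon,\quad (\Sigma^2-\Sigma^1)n_\varepsilon=-\kappa_\varepsilon n_\varepsilon\quad\text{on }\partial\Omega_2^-.$$ **Distributions.** For $\varphi\in C_c^\infty(D;\mathbb R^2)$ put $$\langle\mathcal S_\varepsilon(u,p),\varphi\rangle=\int_D\big[\mu(x)\,u\cdot(\Delta\varphi+\nabla\cdot(\nabla\varphi)^T)+p\,\nabla\cdot\varphi\big]dV+(\mu-\mu_2)\int_{\partial\Omega_2^+}u\cdot[(\nabla\varphi+\nabla\varphi^T)n]\,ds+(\mu-\mu_2)\int_{\partial\Omega_2^-}u\cdot[(\nabla\varphi+\nabla\varphi^T)n_\varepsilon]\,ds,$$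 $\langle\kappa_\varepsilon n_\varepsilon\delta_{\partial\Omega_2^-},\varphi\rangle=\int_{\partial\Omega_2^-}\kappa_\varepsilon n_\varepsilon\cdot\varphi\,ds$, $\langle\kappa n\delta_{\partial\Omega_2^+},\varphi\rangle=\int_{\partial\Omega_2^+}\kappa n\cdot\varphi\,ds$, and for $\psi\in C_c^\infty(D)$ put $\langle\nabla\cdot u,\psi\rangle=-\int_D u\cdot\nabla\psi\,dV$. **Claim.** These functionals are distributions on $D$, and $(u,p)$ solves (P) if and only if $$\mathcal S_\varepsilon(u,p)=\kappa_\varepsilon n_\varepsilon\delta_{\partial\Omega_2^-}-\kappa n\delta_{\partial\Omega_2^+}\ \text{ in }\mathcal D'(D;\mathbb R^2)\qquad\text{and}\qquad\nabla\cdot u=0\ \text{ in }\mathcal D'(D).$$ -/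

import Mathlib

open scoped Topology Distributions

noncomputable section

namespace ThinLayer

/-! ### Planar calculus -/

/-- The Euclidean plane. -/
abbrev Plane : Type := EuclideanSpace ℝ (Fin 2)

/-- The matrix field `∇ f`, with entries `(∇ f)ᵢⱼ = ∂ⱼ fᵢ`. -/
def grad (f : Plane → Plane) (x : Plane) : Matrix (Fin 2) (Fin 2) ℝ :=
  Matrix.of fun i j => fderiv ℝ f x (EuclideanSpace.single j 1) i

/-- `∇ f + (∇ f)ᵀ`. -/
def symGrad (f : Plane → Plane) (x : Plane) : Matrix (Fin 2) (Fin 2) ℝ :=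
  grad f x + (grad f x).transpose

/-- The divergence of a vector field. -/
def div (f : Plane → Plane) (x : Plane) : ℝ := (grad f x).trace

/-- The divergence of a matrix field, `(∇ · M)ᵢ = ∑ⱼ ∂ⱼ Mᵢⱼ`. -/
def matDiv (M : Plane → Matrix (Fin 2) (Fin 2) ℝ) (x : Plane) : Plane :=
  WithLp.toLp 2 fun i => ∑ j, fderiv ℝ (fun y => M y i j) x (EuclideanSpace.single j 1)

/-- A matrix acting on a vector of the plane. -/
def act (M : Matrix (Fin 2) (Fin 2) ℝ) (v : Plane) : Plane := WithLp.toLp 2 (M.mulVec v.ofLp)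

/-! ### Function classes -/

/-- `f|_O ∈ C^k(closure O)` for an open set `O`: `f` is `C^k` in `O`, and its derivatives of order
at most `k` have continuous extensions to `closure O`. -/
def IsCkUpToBoundary {F : Type*} [NormedAddCommGroup F] [NormedSpace ℝ F]
    (k : ℕ) (O : Set Plane) (f : Plane → F) : Prop :=
  ContDiffOn ℝ k f O ∧
    ∀ m ≤ k, ∃ g : Plane → ContinuousMultilinearMap ℝ (fun _ : Fin m => Plane) F,
      ContinuousOn g (closure O) ∧ Set.EqOn (iteratedFDeriv ℝ m f) g O

/-- The class `X^k(⋃ⱼ Oⱼ)`: functions of class `C^k` in the union whose restriction to each piece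
`Oⱼ` is of class `C^k` up to the boundary of that piece. -/
def MemX {F : Type*} [NormedAddCommGroup F] [NormedSpace ℝ F]
    (k : ℕ) {N : ℕ} (O : Fin N → Set Plane) (f : Plane → F) : Prop :=
  ContDiffOn ℝ k f (⋃ j, O j) ∧ ∀ j, IsCkUpToBoundary k (O j) f

/-! ### Curves -/

/-- The matrix `𝔸 = (0 -1; 1 0)`, the rotation by a quarter turn counterclockwise. -/
def rot (v : Plane) : Plane := act !![0, -1; 1, 0] v

/-- The unit tangent `∂γ / |∂γ|` of a parametrized curve. -/
def tangent (γ : ℝ → Plane) (ξ : ℝ) : Plane := ‖deriv γ ξ‖⁻¹ • deriv γ ξ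

/-- The unit normal `𝔸 τ` of a parametrized curve. -/
def leftNormal (γ : ℝ → Plane) (ξ : ℝ) : Plane := rot (tangent γ ξ)

/-- The signed curvature of a parametrized curve: the number `κ` for which the derivative of the
tangent `τ` with respect to arc length is `κ 𝔸 τ`. -/
def curvature (γ : ℝ → Plane) (ξ : ℝ) : ℝ :=
  inner ℝ (‖deriv γ ξ‖⁻¹ • deriv (tangent γ) ξ) (leftNormal γ ξ)

/-- The integral with respect to arc length, over one period `[0, L]` of the curve `γ`, of a
function given in terms of the parameter. -/
def arcIntegral (γ : ℝ → Plane) (L : ℝ) (f : ℝ → ℝ) : ℝ := ∫ ξ in (0 : ℝ)..L, f ξ * ‖deriv γ ξ‖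

/-- `γ` is a regular `L`-periodic parametrization of class `C²` of a Jordan curve. -/
structure IsC2JordanParam (γ : ℝ → Plane) (L : ℝ) : Prop where
  contDiff : ContDiff ℝ 2 γ
  periodic : Function.Periodic γ L
  injOn : Set.InjOn γ (Set.Ico 0 L)
  regular : ∀ ξ, deriv γ ξ ≠ 0

/-- The closed curve `γ` of period `L` is run through clockwise: its signed area
`½ ∫ (γ₁ dγ₂ - γ₂ dγ₁)` is negative. -/
def IsClockwise (γ : ℝ → Plane) (L : ℝ) : Prop :=
  (1 / 2 : ℝ) * ∫ ξ in (0 : ℝ)..L, (γ ξ 0 * deriv γ ξ 1 - γ ξ 1 * deriv γ ξ 0) < 0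

/-- The inner curve `Γ_ε = Γ - ε h n`, where `n = 𝔸 τ` is the normal of `Γ`. -/
def innerCurve (Γ : ℝ → Plane) (h : ℝ → ℝ) (ε : ℝ) (ξ : ℝ) : Plane :=
  Γ ξ - (ε * h ξ) • leftNormal Γ ξ

/-! ### The geometry -/

/-- The boundary of the open set `D` is of class `C²`: near each of its boundary points, `D` is a
sublevel set of a `C²` function without critical points. -/
def HasC2Boundary (D : Set Plane) : Prop :=
  ∀ x ∈ frontier D, ∃ V : Set Plane, IsOpen V ∧ x ∈ V ∧ ∃ g : Plane → ℝ,
    ContDiffOn ℝ 2 g V ∧ (∀ y ∈ V, fderiv ℝ g y ≠ 0) ∧ D ∩ V = {y ∈ V | g y < 0}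

/-- The direction `ν` points out of `O` at the boundary point `x`. -/
def PointsOutOf (O : Set Plane) (x ν : Plane) : Prop :=
  ∀ᶠ s : ℝ in 𝓝[>] 0, x - s • ν ∈ O ∧ x + s • ν ∉ closure O

/-- The standing geometric assumptions. The container `D` is a bounded domain with `C²` boundary.
It is filled by the disjoint domains `Ω₁`, `Ω₂`, `Ω₃`, where the layer `Ω₂` is bounded by the
disjoint `C²` Jordan curves `Γ` (external, parametrized clockwise by arc length, separating `Ω₂`
from `Ω₃`) and `Γ_ε = Γ - ε h n` (internal, separating `Ω₂` from `Ω₁`) in `D`. The outer normals of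
`Ω₂` are `𝔸 τ` on `Γ` and `-𝔸 τ_ε` on `Γ_ε`. -/
structure IsThinLayer (D Ω₁ Ω₂ Ω₃ : Set Plane) (Γ : ℝ → Plane) (h : ℝ → ℝ) (L ε : ℝ) : Prop where
  isConnected_D : IsConnected D
  isCompact_closure_D : IsCompact (closure D)
  boundary_D : HasC2Boundary D
  isOpen₁ : IsOpen Ω₁
  isOpen₂ : IsOpen Ω₂
  isOpen₃ : IsOpen Ω₃
  isConnected₁ : IsConnected Ω₁
  isConnected₂ : IsConnected Ω₂
  isConnected₃ : IsConnected Ω₃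
  disjoint₁₂ : Disjoint Ω₁ Ω₂
  disjoint₁₃ : Disjoint Ω₁ Ω₃
  disjoint₂₃ : Disjoint Ω₂ Ω₃
  fills : D = interior (closure Ω₁ ∪ closure Ω₂ ∪ closure Ω₃)
  L_pos : 0 < L
  ε_pos : 0 < ε
  outer_param : IsC2JordanParam Γ L
  outer_arclength : ∀ ξ, ‖deriv Γ ξ‖ = 1
  outer_clockwise : IsClockwise Γ L
  outer_mem : ∀ ξ, Γ ξ ∈ D
  h_contDiff : ContDiff ℝ 2 h
  h_periodic : Function.Periodic h L
  h_pos : ∀ ξ, 0 < h ξ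
  inner_param : IsC2JordanParam (innerCurve Γ h ε) L
  inner_mem : ∀ ξ, innerCurve Γ h ε ξ ∈ D
  curves_disjoint : Disjoint (Set.range Γ) (Set.range (innerCurve Γ h ε))
  frontier₂ : frontier Ω₂ = Set.range Γ ∪ Set.range (innerCurve Γ h ε)
  frontier₁ : D ∩ frontier Ω₁ = Set.range (innerCurve Γ h ε)
  frontier₃ : D ∩ frontier Ω₃ = Set.range Γ
  outer_normal : ∀ ξ, PointsOutOf Ω₂ (Γ ξ) (leftNormal Γ ξ)
  inner_normal : ∀ ξ, PointsOutOf Ω₂ (innerCurve Γ h ε ξ) (-leftNormal (innerCurve Γ h ε) ξ)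

/-! ### The boundary value problem -/

open Classical in
/-- The viscosity: `μ₂` in `Ω₂` and `μ` elsewhere. -/
def viscosity (Ω₂ : Set Plane) (μ μ₂ : ℝ) (x : Plane) : ℝ := if x ∈ Ω₂ then μ₂ else μ

/-- The stress tensor `-p I + m (∇ u + (∇ u)ᵀ)` of a fluid of viscosity `m`. -/
def stress (m : ℝ) (u : Plane → Plane) (p : Plane → ℝ) (x : Plane) : Matrix (Fin 2) (Fin 2) ℝ :=
  -(p x) • (1 : Matrix (Fin 2) (Fin 2) ℝ) + m • symGrad u x

/-- The traces of `u` at `x` from `A` and from `B` exist, and their normal and tangential components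
coincide. -/
def VelocityMatch (A B : Set Plane) (u : Plane → Plane) (x n τ : Plane) : Prop :=
  ∃ a b : Plane, Filter.Tendsto u (𝓝[A] x) (𝓝 a) ∧ Filter.Tendsto u (𝓝[B] x) (𝓝 b) ∧
    inner ℝ a n = inner ℝ b n ∧ inner ℝ a τ = inner ℝ b τ

/-- The trace `Σ_A` at `x` from `A` of the stress with viscosity `mA`, and the trace `Σ_B` at `x`
from `B` of the stress with viscosity `mB`, exist and satisfy `(Σ_A - Σ_B) n = -κ n`. -/
def StressJump (A B : Set Plane) (mA mB : ℝ) (u : Plane → Plane) (p : Plane → ℝ)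
    (x n : Plane) (κ : ℝ) : Prop :=
  ∃ S T : Matrix (Fin 2) (Fin 2) ℝ,
    Filter.Tendsto (stress mA u p) (𝓝[A] x) (𝓝 S) ∧
    Filter.Tendsto (stress mB u p) (𝓝[B] x) (𝓝 T) ∧
    act (S - T) n = -(κ • n)

open Laplacian Gradient in
/-- The two-fluid Stokes problem, with `Γ` the curve between `Ω₂` and `Ω₃`, `γ` the curve between
`Ω₁` and `Ω₂`, viscosity `μ` in `Ω₁ ∪ Ω₃` and `μ₂` in `Ω₂`, and boundary data `U` on `∂D`. The
normal is the outer normal of `Ω₂` on both curves. -/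
structure SolvesStokes (D Ω₁ Ω₂ Ω₃ : Set Plane) (Γ γ : ℝ → Plane) (μ μ₂ : ℝ)
    (U u : Plane → Plane) (p : Plane → ℝ) : Prop where
  momentum : ∀ x ∈ Ω₁ ∪ Ω₂ ∪ Ω₃, viscosity Ω₂ μ μ₂ x • (Δ u) x = ∇ p x
  incompressible : ∀ x ∈ Ω₁ ∪ Ω₂ ∪ Ω₃, div u x = 0
  boundary : ∀ x ∈ frontier D, u x = U x
  velocity_outer : ∀ ξ, VelocityMatch Ω₃ Ω₂ u (Γ ξ) (leftNormal Γ ξ) (tangent Γ ξ)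
  velocity_inner : ∀ ξ, VelocityMatch Ω₁ Ω₂ u (γ ξ) (-leftNormal γ ξ) (tangent γ ξ)
  stress_outer : ∀ ξ, StressJump Ω₃ Ω₂ μ μ₂ u p (Γ ξ) (leftNormal Γ ξ) (curvature Γ ξ)
  stress_inner : ∀ ξ, StressJump Ω₂ Ω₁ μ₂ μ u p (γ ξ) (-leftNormal γ ξ) (curvature γ ξ)

/-! ### The distributional formulation -/

/-- Vector-valued distributions `𝒟'(D; ℝ²)`: continuous linear functionals on `C_c^∞(D; ℝ²)`. -/
abbrev VectorDistribution (D : TopologicalSpace.Opens Plane) : Type := 𝓓(D, Plane) →L[ℝ] ℝ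

/-- The distribution `T ∈ 𝒟'(D; ℝ²)` is `c ν δ_γ`, that is, `⟨T, φ⟩ = ∫_γ c ν · φ ds`. -/
def IsCurveDelta {D : TopologicalSpace.Opens Plane} (γ : ℝ → Plane) (L : ℝ) (c : ℝ → ℝ)
    (ν : ℝ → Plane) (T : VectorDistribution D) : Prop :=
  ∀ φ : 𝓓(D, Plane), T φ = arcIntegral γ L fun ξ => c ξ * inner ℝ (ν ξ) (φ (γ ξ))

/-- The distribution `T ∈ 𝒟'(D)` is `∇ · u`, that is, `⟨T, ψ⟩ = -∫_D u · ∇ψ`. -/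
def IsDistribDiv {D : TopologicalSpace.Opens Plane} (u : Plane → Plane) (T : 𝓓'(D, ℝ)) : Prop :=
  ∀ ψ : 𝓓(D, ℝ), T ψ = -∫ x in (D : Set Plane), inner ℝ (u x) (gradient ψ x)

open Laplacian in
/-- The functional `⟨S_ε(u, p), φ⟩`, with `Γ` and `γ` the outer and the inner boundary curve
of `Ω₂`. -/
def stokesFunctional (D Ω₂ : Set Plane) (Γ γ : ℝ → Plane) (L μ μ₂ : ℝ)
    (u : Plane → Plane) (p : Plane → ℝ) (φ : Plane → Plane) : ℝ :=
  (∫ x in D, (viscosity Ω₂ μ μ₂ x *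
      inner ℝ (u x) ((Δ φ) x + matDiv (fun y => (grad φ y).transpose) x) + p x * div φ x))
  + (μ - μ₂) * arcIntegral Γ L
      (fun ξ => inner ℝ (u (Γ ξ)) (act (symGrad φ (Γ ξ)) (leftNormal Γ ξ)))
  + (μ - μ₂) * arcIntegral γ L
      (fun ξ => inner ℝ (u (γ ξ)) (act (symGrad φ (γ ξ)) (-leftNormal γ ξ)))

end ThinLayer

end

noncomputable section

namespace ThinLayer

open MeasureTheory Set Filter

/-! ### Coordinates of the plane -/

/-! The core is Green's formula for the Stokes operator. In a domain with viscosity `m` and stress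
`Σ`, the field `m (∇φ + ∇φᵀ) u - Σ φ` has divergence `m u · (Δφ + ∇·(∇φ)ᵀ) + p ∇·φ - (∇·Σ) · φ`
(`div_stokesField`). The products of first derivatives cancel because `(∇φ + ∇φᵀ) : ∇u` is symmetric
in `u` and `φ`. Integrated over the three domains, this leaves only fluxes through the two curves,
since `φ` vanishes near `∂D`. As `u` is continuous, the strain parts of these fluxes add up to `μ₂ -
μ` times the strain integrals with the outer normal of `Ω₂`, which the curve terms of the Stokes
functional cancel. What remains is `∫ (∇·Σ) · φ` over the domains plus the integrals of the stress
jumps over the curves (`stokesFunctional_eq`). The same argument for `ψ u` shows that the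
distributional divergence has no singular part (`integral_inner_gradient`).

With the curvature terms included, the distributional equation says that the bulk densities `∇·Σ`
and the curve densities `surfaceForce` annihilate all test fields, and localization makes each of
them vanish (`distribution_eq_iff`). The order matters. Second derivatives of `u` may fail to be
integrable up to the boundary, so Green's formula is used only when `(∇·Σ) · φ` is integrable. This
is so for `φ` compactly supported in one domain, which yields `∇·Σ = 0`, and from then on for every
`φ`. Finally `∇·u = 0` turns `∇·Σ = 0` into `m Δu = ∇p`, and the velocity conditions on the curves
hold by continuity (`solvesStokes_iff`).

The divergence theorem has to cover domains bounded by `C²` curves and fields that are only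
continuous up to the boundary. It is localized by bump functions (`integral_div_eq_of_local`) and
proved near a curve in slab charts `(ξ, t) ↦ c(ξ) + t e` with a constant direction `e`
(`integral_div_slab`, `exists_isInterfaceChart`). These maps are as smooth as the curve, and their
Jacobian does not depend on `t`. -/

/-- The standard basis vectors of the plane. -/
abbrev basisVec (i : Fin 2) : Plane := EuclideanSpace.single i 1

/-- The coordinate functionals of the plane. -/
abbrev coord (i : Fin 2) : Plane →L[ℝ] ℝ := EuclideanSpace.proj i

/-- The oriented area `a₀ b₁ - a₁ b₀`. -/
def cross (a b : Plane) : ℝ := a 0 * b 1 - a 1 * b 0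

lemma eq_sum_basisVec (v : Plane) : v = v 0 • basisVec 0 + v 1 • basisVec 1 := by
  ext i; fin_cases i <;> simp

lemma map_eq_sum_basisVec {F : Type*} [NormedAddCommGroup F] [NormedSpace ℝ F]
    (A : Plane →L[ℝ] F) (v : Plane) : A v = v 0 • A (basisVec 0) + v 1 • A (basisVec 1) := by
  conv_lhs => rw [eq_sum_basisVec v]
  simp only [map_add, map_smul]

lemma inner_plane (a b : Plane) : inner ℝ a b = a 0 * b 0 + a 1 * b 1 := by
  simp [PiLp.inner_apply, Fin.sum_univ_two, mul_comm]

lemma div_eq (f : Plane → Plane) (x : Plane) :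
    div f x = fderiv ℝ f x (basisVec 0) 0 + fderiv ℝ f x (basisVec 1) 1 := by
  simp [div, grad, Matrix.trace, Fin.sum_univ_two]

@[simp] lemma rot_zero_apply (v : Plane) : rot v 0 = -v 1 := by
  simp [rot, act, dotProduct, Fin.sum_univ_two]

@[simp] lemma rot_one_apply (v : Plane) : rot v 1 = v 0 := by
  simp [rot, act, dotProduct, Fin.sum_univ_two]

lemma act_apply (M : Matrix (Fin 2) (Fin 2) ℝ) (v : Plane) (i : Fin 2) :
    act M v i = M i 0 * v 0 + M i 1 * v 1 := by
  fin_cases i <;> simp [act]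

lemma inner_rot_right (a b : Plane) : inner ℝ a (rot b) = cross b a := by
  simp [inner_plane, cross]; ring

lemma cross_rot_right (a b : Plane) : cross a (rot b) = inner ℝ a b := by
  simp [inner_plane, cross]

lemma rot_smul (t : ℝ) (v : Plane) : rot (t • v) = t • rot v := by
  ext i; fin_cases i <;> simp

lemma continuous_cross : Continuous fun q : Plane × Plane => cross q.1 q.2 := by
  unfold cross; fun_prop

/-- The area preserving identification of `ℝ × ℝ` with the plane. -/
def toPlane : (ℝ × ℝ) ≃L[ℝ] Plane :=
  (ContinuousLinearEquiv.finTwoArrow ℝ ℝ).symm.trans (EuclideanSpace.equiv (Fin 2) ℝ).symm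

@[simp] lemma toPlane_zero (q : ℝ × ℝ) : toPlane q 0 = q.1 := rfl

@[simp] lemma toPlane_one (q : ℝ × ℝ) : toPlane q 1 = q.2 := rfl

lemma toPlane_symm_apply (v : Plane) : toPlane.symm v = (v 0, v 1) := by
  rw [ContinuousLinearEquiv.symm_apply_eq]
  ext i; fin_cases i <;> simp

lemma measurePreserving_toPlane : MeasurePreserving toPlane := by
  have h1 := ((volume_preserving_finTwoArrow ℝ).symm MeasurableEquiv.finTwoArrow)
  have h2 := (EuclideanSpace.volume_preserving_symm_measurableEquiv_toLp (Fin 2)).symm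
  exact h2.comp h1

lemma measurableEmbedding_toPlane : MeasurableEmbedding toPlane :=
  toPlane.toHomeomorph.measurableEmbedding

lemma det_eq_cross (A : Plane →L[ℝ] Plane) :
    A.det = cross (A (basisVec 0)) (A (basisVec 1)) := by
  have h := LinearMap.det_toMatrix (EuclideanSpace.basisFun (Fin 2) ℝ).toBasis
    (A : Plane →ₗ[ℝ] Plane)
  rw [Matrix.det_fin_two] at h
  rw [ContinuousLinearMap.det, ← h]
  simp [LinearMap.toMatrix_apply, cross]
  ring

/-- The trace is the derivative of the determinant at the identity. With `a = c'` and `b = e` it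
converts the two directional derivatives of the pulled back field into the divergence times the
Jacobian. -/
lemma trace_mul_cross (A : Plane →L[ℝ] Plane) (a b : Plane) :
    cross (A a) b + cross a (A b)
      = (A (basisVec 0) 0 + A (basisVec 1) 1) * cross a b := by
  rw [map_eq_sum_basisVec A a, map_eq_sum_basisVec A b]
  simp [cross]; ring

/-! ### The divergence theorem on a slab along a curve -/

/-- The map `(ξ, t) ↦ c(ξ) + t e`. -/
def slab (c : ℝ → Plane) (e : Plane) (q : ℝ × ℝ) : Plane := c q.1 + q.2 • e

/-- The derivative of `slab c e` where `c` has velocity `v`. -/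
def slabDeriv (v e : Plane) : ℝ × ℝ →L[ℝ] Plane :=
  (ContinuousLinearMap.fst ℝ ℝ ℝ).smulRight v + (ContinuousLinearMap.snd ℝ ℝ ℝ).smulRight e

@[simp] lemma slabDeriv_apply (v e : Plane) (q : ℝ × ℝ) :
    slabDeriv v e q = q.1 • v + q.2 • e := rfl

lemma hasFDerivAt_slab {c : ℝ → Plane} (hc : Differentiable ℝ c) (e : Plane) (q : ℝ × ℝ) :
    HasFDerivAt (slab c e) (slabDeriv (deriv c q.1) e) q := by
  have h1 : HasFDerivAt (fun q : ℝ × ℝ => c q.1)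
      ((ContinuousLinearMap.fst ℝ ℝ ℝ).smulRight (deriv c q.1)) q := by
    refine ((hc q.1).hasDerivAt.hasFDerivAt.comp q hasFDerivAt_fst).congr_fderiv ?_
    ext <;> simp
  have h2 : HasFDerivAt (fun q : ℝ × ℝ => q.2 • e)
      ((ContinuousLinearMap.snd ℝ ℝ ℝ).smulRight e) q :=
    ((ContinuousLinearMap.snd ℝ ℝ ℝ).smulRight e).hasFDerivAt
  exact h1.add h2

lemma continuous_slab {c : ℝ → Plane} (hc : Continuous c) (e : Plane) :
    Continuous (slab c e) := by
  unfold slab; fun_prop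

lemma slab_image_eq (c : ℝ → Plane) (e : Plane) (s : Set (ℝ × ℝ)) :
    slab c e '' s = (slab c e ∘ toPlane.symm) '' (toPlane '' s) := by
  rw [← image_comp]
  simp [Function.comp_def]

lemma hasFDerivAt_slab_toPlane {c : ℝ → Plane} (hc : Differentiable ℝ c) (e : Plane)
    (x : Plane) : HasFDerivAt (slab c e ∘ toPlane.symm)
      ((slabDeriv (deriv c (toPlane.symm x).1) e).comp
        (toPlane.symm : Plane →L[ℝ] ℝ × ℝ)) x :=
  (hasFDerivAt_slab hc e _).comp x toPlane.symm.hasFDerivAt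

lemma det_slabDeriv (v e : Plane) :
    ((slabDeriv v e).comp (toPlane.symm : Plane →L[ℝ] ℝ × ℝ)).det = cross v e := by
  rw [det_eq_cross]
  simp [toPlane_symm_apply]

lemma injOn_slab_toPlane {c : ℝ → Plane} {e : Plane} {s : Set (ℝ × ℝ)}
    (hinj : InjOn (slab c e) s) : InjOn (slab c e ∘ toPlane.symm) (toPlane '' s) := by
  rintro _ ⟨q, hq, rfl⟩ _ ⟨q', hq', rfl⟩ h
  simp only [Function.comp, ContinuousLinearEquiv.symm_apply_apply] at h
  rw [hinj hq hq' h]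

/-- The Jacobian of the slab is `cross c' e`. The change of variables formula concerns maps of a
space into itself, so `ℝ × ℝ` is first identified with the plane by the measure preserving
`toPlane`. -/
lemma setIntegral_slab_image {c : ℝ → Plane} (hc : Differentiable ℝ c) {e : Plane}
    {s : Set (ℝ × ℝ)} (hs : MeasurableSet s) (hinj : InjOn (slab c e) s) (g : Plane → ℝ) :
    ∫ x in slab c e '' s, g x = ∫ q in s, |cross (deriv c q.1) e| * g (slab c e q) := by
  rw [slab_image_eq, integral_image_eq_integral_abs_det_fderiv_smul volume
    (measurableEmbedding_toPlane.measurableSet_image.2 hs)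
    (fun x _ => (hasFDerivAt_slab_toPlane hc e x).hasFDerivWithinAt) (injOn_slab_toPlane hinj),
    measurePreserving_toPlane.setIntegral_image_emb measurableEmbedding_toPlane]
  simp only [det_slabDeriv, Function.comp, ContinuousLinearEquiv.symm_apply_apply, smul_eq_mul]

lemma integrableOn_slab_image {c : ℝ → Plane} (hc : Differentiable ℝ c) {e : Plane}
    {s : Set (ℝ × ℝ)} (hs : MeasurableSet s) (hinj : InjOn (slab c e) s) (g : Plane → ℝ) :
    IntegrableOn g (slab c e '' s) ↔
      IntegrableOn (fun q => |cross (deriv c q.1) e| * g (slab c e q)) s := by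
  rw [slab_image_eq, integrableOn_image_iff_integrableOn_abs_det_fderiv_smul volume
    (measurableEmbedding_toPlane.measurableSet_image.2 hs)
    (fun x _ => (hasFDerivAt_slab_toPlane hc e x).hasFDerivWithinAt) (injOn_slab_toPlane hinj),
    measurePreserving_toPlane.integrableOn_image measurableEmbedding_toPlane]
  simp only [det_slabDeriv, Function.comp_def, ContinuousLinearEquiv.symm_apply_apply, smul_eq_mul]

/-- The field is differentiable over the open rectangle only, whereas the divergence theorem
integrates over the closed one. -/
lemma rect_ae_eq (a b r s : ℝ) :
    (Ioo a b ×ˢ Ioo r s : Set (ℝ × ℝ)) =ᵐ[volume] Icc (a, r) (b, s) := by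
  rw [← Icc_prod_Icc]
  exact Measure.set_prod_ae_eq Ioo_ae_eq_Icc Ioo_ae_eq_Icc

lemma differentiable_deriv {c : ℝ → Plane} (hc : ContDiff ℝ 2 c) :
    Differentiable ℝ (deriv c) := by
  have : ContDiff ℝ (1 + 1) c := by exact_mod_cast hc
  exact ((contDiff_succ_iff_deriv.1 this).2.2).differentiable (by simp)

lemma continuous_deriv {c : ℝ → Plane} (hc : ContDiff ℝ 2 c) : Continuous (deriv c) :=
  (differentiable_deriv hc).continuous

lemma hasDerivAt_snd_slice {G : ℝ × ℝ → ℝ} {G' : ℝ × ℝ →L[ℝ] ℝ} {q : ℝ × ℝ}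
    (h : HasFDerivAt G G' q) : HasDerivAt (fun t : ℝ => G (q.1, t)) (G' (0, 1)) q.2 := by
  have hl : HasDerivAt (fun t : ℝ => (q.1, t)) ((0 : ℝ), (1 : ℝ)) q.2 :=
    (hasDerivAt_const _ _).prodMk (hasDerivAt_id _)
  have h' : HasFDerivAt G G' ((fun t : ℝ => (q.1, t)) q.2) := h
  exact h'.comp_hasDerivAt q.2 hl

/-- The divergence theorem on the image of a rectangle under `slab c e`. -/
theorem integral_div_slab {c : ℝ → Plane} (hc : ContDiff ℝ 2 c) {e : Plane} {a b r s : ℝ}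
    (hab : a ≤ b) (hrs : r ≤ s) (hinj : InjOn (slab c e) (Ioo a b ×ˢ Ioo r s))
    (hJ : ∀ ξ ∈ Ioo a b, 0 < cross (deriv c ξ) e) {F : Plane → Plane}
    (hF : ContinuousOn F (slab c e '' (Icc a b ×ˢ Icc r s)))
    (hFd : ∀ q ∈ Ioo a b ×ˢ Ioo r s, DifferentiableAt ℝ F (slab c e q))
    (hint : IntegrableOn (div F) (slab c e '' (Ioo a b ×ˢ Ioo r s))) :
    ∫ x in slab c e '' (Ioo a b ×ˢ Ioo r s), div F x =
      (((∫ ξ in a..b, cross (deriv c ξ) (F (slab c e (ξ, s))))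
        - ∫ ξ in a..b, cross (deriv c ξ) (F (slab c e (ξ, r))))
        + ∫ t in r..s, cross (F (slab c e (b, t))) e)
        - ∫ t in r..s, cross (F (slab c e (a, t))) e := by
  have hcd : Differentiable ℝ c := hc.differentiable (by simp)
  have hms : MeasurableSet (Ioo a b ×ˢ Ioo r s : Set (ℝ × ℝ)) :=
    measurableSet_Ioo.prod measurableSet_Ioo
  have hcont : ContinuousOn (fun q => F (slab c e q)) (Icc (a, r) (b, s)) := by
    rw [← Icc_prod_Icc]
    exact hF.comp (continuous_slab hcd.continuous e).continuousOn (mapsTo_image _ _)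
  have hc' := differentiable_deriv hc
  -- The field is pulled back by the Piola transform: its components `cross F e` and `cross c' F`
  -- are the flux densities across the coordinate lines. Both are differentiable because `c` is
  -- `C²`.
  let f' : ℝ × ℝ → ℝ × ℝ →L[ℝ] ℝ := fun q =>
    fderiv ℝ (fun q : ℝ × ℝ => cross (F (slab c e q)) e) q
  let g' : ℝ × ℝ → ℝ × ℝ →L[ℝ] ℝ := fun q =>
    fderiv ℝ (fun q : ℝ × ℝ => cross (deriv c q.1) (F (slab c e q))) q
  have hFq : ∀ q ∈ Ioo a b ×ˢ Ioo r s, HasFDerivAt (fun q => F (slab c e q))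
      ((fderiv ℝ F (slab c e q)).comp (slabDeriv (deriv c q.1) e)) q := fun q hq =>
    (hFd q hq).hasFDerivAt.comp q (hasFDerivAt_slab hcd e q)
  have hFi : ∀ q ∈ Ioo a b ×ˢ Ioo r s, ∀ i : Fin 2, HasFDerivAt (fun q => F (slab c e q) i)
      ((coord i).comp ((fderiv ℝ F (slab c e q)).comp (slabDeriv (deriv c q.1) e))) q :=
    fun q hq i => (coord i).hasFDerivAt.comp q (hFq q hq)
  have hci : ∀ (q : ℝ × ℝ) (i : Fin 2), DifferentiableAt ℝ (fun q : ℝ × ℝ => deriv c q.1 i) q := by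
    intro q i
    have : DifferentiableAt ℝ (fun q : ℝ × ℝ => deriv c q.1) q :=
      (hc' q.1).comp q differentiableAt_fst
    exact (coord i).differentiableAt.comp q this
  have hf : ∀ q ∈ Ioo a b ×ˢ Ioo r s, HasFDerivAt (fun q : ℝ × ℝ => cross (F (slab c e q)) e)
      (f' q) q := by
    intro q hq
    have h0 := (hFi q hq 0).differentiableAt
    have h1 := (hFi q hq 1).differentiableAt
    apply DifferentiableAt.hasFDerivAt
    unfold cross
    fun_prop
  have hg : ∀ q ∈ Ioo a b ×ˢ Ioo r s,
      HasFDerivAt (fun q : ℝ × ℝ => cross (deriv c q.1) (F (slab c e q))) (g' q) q := by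
    intro q hq
    have h0 := (hFi q hq 0).differentiableAt
    have h1 := (hFi q hq 1).differentiableAt
    have h2 := hci q 0
    have h3 := hci q 1
    apply DifferentiableAt.hasFDerivAt
    unfold cross
    fun_prop
  have hkey : ∀ q ∈ Ioo a b ×ˢ Ioo r s,
      |cross (deriv c q.1) e| * div F (slab c e q) = f' q (1, 0) + g' q (0, 1) := by
    intro q hq
    rw [abs_of_pos (hJ q.1 hq.1), div_eq, mul_comm, ← trace_mul_cross]
    have h0 := hFi q hq 0
    have h1 := hFi q hq 1
    congr 1
    · have : HasFDerivAt (fun q : ℝ × ℝ => cross (F (slab c e q)) e) _ q :=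
        (h0.mul_const (e 1)).sub (h1.mul_const (e 0))
      rw [(hf q hq).unique this]
      simp [cross]; ring
    -- On a line of constant `ξ` the factor `c'` is constant, so the derivative in `t` is computed
    -- on that line and no second derivative of `c` enters.
    · have e1 : HasDerivAt (fun t : ℝ => cross (deriv c q.1) (F (slab c e (q.1, t))))
          (g' q (0, 1)) q.2 := hasDerivAt_snd_slice (hg q hq)
      have k0 : HasDerivAt (fun t : ℝ => F (slab c e (q.1, t)) 0) _ q.2 :=
        hasDerivAt_snd_slice h0
      have k1 : HasDerivAt (fun t : ℝ => F (slab c e (q.1, t)) 1) _ q.2 :=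
        hasDerivAt_snd_slice h1
      have e2 : HasDerivAt (fun t : ℝ => cross (deriv c q.1) (F (slab c e (q.1, t))))
          (cross (deriv c q.1) (fderiv ℝ F (slab c e q) e)) q.2 := by
        refine ((k1.const_mul (deriv c q.1 0)).sub (k0.const_mul (deriv c q.1 1))).congr_deriv ?_
        simp [cross]
      exact e2.unique e1
  rw [setIntegral_slab_image hcd hms hinj, setIntegral_congr_fun hms hkey,
    setIntegral_congr_set (rect_ae_eq a b r s)]
  have hint' : IntegrableOn (fun q => f' q (1, 0) + g' q (0, 1)) (Icc (a, r) (b, s)) := by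
    rw [integrableOn_slab_image hcd hms hinj] at hint
    exact (hint.congr_fun hkey hms).congr_set_ae (rect_ae_eq a b r s).symm
  rw [integral_divergence_prod_Icc_of_hasFDerivAt_of_le _ _ f' g' (a, r) (b, s)
    (Prod.mk_le_mk.2 ⟨hab, hrs⟩) ?_ ?_ hf hg hint']
  · have hci : ∀ i : Fin 2, ContinuousOn (fun q => F (slab c e q) i) (Icc (a, r) (b, s)) :=
      fun i => (coord i).continuous.comp_continuousOn hcont
    have h0 := hci 0
    have h1 := hci 1
    unfold cross
    fun_prop
  · exact continuous_cross.comp_continuousOn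
      ((hc'.continuous.comp continuous_fst).continuousOn.prodMk hcont)

/-! ### Fields admissible in the divergence theorem -/

/-- Vector fields to which the divergence theorem in `O` is applied: of class `C¹` in `O`, continuous
up to the boundary, with integrable divergence, and vanishing off `K`. -/
structure IsFluxField (O K : Set Plane) (F : Plane → Plane) : Prop where
  continuousOn : ContinuousOn F (closure O)
  contDiffOn : ContDiffOn ℝ 1 F O
  integrableOn : IntegrableOn (div F) O
  eq_zero : ∀ x ∉ K, F x = 0

lemma div_eq_zero_of_eventuallyEq {F : Plane → Plane} {x : Plane} (h : F =ᶠ[𝓝 x] 0) :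
    div F x = 0 := by
  rw [div_eq, h.fderiv_eq]
  simp

lemma div_eq_zero_off {F : Plane → Plane} {K : Set Plane} (hK : IsClosed K)
    (h : ∀ x ∉ K, F x = 0) {x : Plane} (hx : x ∉ K) : div F x = 0 :=
  div_eq_zero_of_eventuallyEq (by
    filter_upwards [hK.isOpen_compl.mem_nhds hx] with y hy using h y hy)

lemma div_add {F G : Plane → Plane} {x : Plane} (hF : DifferentiableAt ℝ F x)
    (hG : DifferentiableAt ℝ G x) : div (F + G) x = div F x + div G x := by
  simp only [div_eq, fderiv_add hF hG]
  simp
  ring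

lemma div_smul {χ : Plane → ℝ} {F : Plane → Plane} {x : Plane} (hχ : DifferentiableAt ℝ χ x)
    (hF : DifferentiableAt ℝ F x) :
    div (fun y => χ y • F y) x = χ x * div F x + fderiv ℝ χ x (F x) := by
  have h := fderiv_fun_smul hχ hF
  rw [div_eq, div_eq, h, map_eq_sum_basisVec (fderiv ℝ χ x) (F x)]
  simp
  ring

lemma IsFluxField.differentiableAt {O K : Set Plane} {F : Plane → Plane} (hO : IsOpen O)
    (hF : IsFluxField O K F) {x : Plane} (hx : x ∈ O) : DifferentiableAt ℝ F x :=
  (hF.contDiffOn.contDiffAt (hO.mem_nhds hx)).differentiableAt (by simp)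

/-- The product rule adds `∇χ · F` to the divergence; it is integrable because `F` is continuous on
`closure O` and vanishes off the compact set `K`. -/
lemma IsFluxField.smul {O K K' : Set Plane} {F : Plane → Plane} (hO : IsOpen O) (hK : IsCompact K)
    (hF : IsFluxField O K F) {χ : Plane → ℝ} (hχ : ContDiff ℝ 1 χ)
    (hK' : ∀ x ∉ K', x ∈ K → χ x = 0) : IsFluxField O K' (fun x => χ x • F x) where
  continuousOn := hχ.continuous.continuousOn.smul hF.continuousOn
  contDiffOn := hχ.contDiffOn.smul hF.contDiffOn
  integrableOn := by
    have hχ' : Continuous (fderiv ℝ χ) := hχ.continuous_fderiv (by simp)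
    have h1 : IntegrableOn (fun x => χ x * div F x) O := by
      have : IntegrableOn (fun x => χ x * div F x) (O ∩ K) :=
        (hF.integrableOn.mono_set inter_subset_left).continuousOn_mul_of_subset
          hχ.continuous.continuousOn hK (hO.measurableSet.inter hK.measurableSet) inter_subset_right
      refine this.of_forall_sdiff_eq_zero hO.measurableSet fun x hx => ?_
      rw [div_eq_zero_off hK.isClosed hF.eq_zero fun h => hx.2 ⟨hx.1, h⟩, mul_zero]
    have h2 : IntegrableOn (fun x => fderiv ℝ χ x (F x)) O := by
      have : IntegrableOn (fun x => fderiv ℝ χ x (F x)) (closure O ∩ K) :=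
        ((hχ'.continuousOn.clm_apply hF.continuousOn).mono
          inter_subset_left).integrableOn_compact (hK.inter_left isClosed_closure)
      refine (this.mono_set (inter_subset_inter_left K subset_closure)).of_forall_sdiff_eq_zero
        hO.measurableSet fun x hx => ?_
      rw [hF.eq_zero x fun h => hx.2 ⟨hx.1, h⟩, map_zero]
    refine (h1.add h2).congr_fun (fun x hx => ?_) hO.measurableSet
    exact (div_smul (hχ.differentiable (by simp) x) (hF.differentiableAt hO hx)).symm
  eq_zero x hx := by
    by_cases h : x ∈ K
    · rw [hK' x hx h, zero_smul]
    · rw [hF.eq_zero x h, smul_zero]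

/-- A divergence theorem holds for all fields with compact support as soon as it holds for those
with support in a small neighbourhood of each point. -/
theorem integral_div_eq_of_local {O K : Set Plane} (hO : IsOpen O) (hK : IsCompact K)
    {B : (Plane → Plane) → ℝ}
    (hadd : ∀ F G, ContinuousOn F (closure O) → ContinuousOn G (closure O) →
      B (F + G) = B F + B G)
    (hloc : ∀ x ∈ K, ∃ V, IsOpen V ∧ x ∈ V ∧ ∀ K' ⊆ V, IsCompact K' → ∀ F, IsFluxField O K' F →
      ∫ x in O, div F x = B F)
    {F : Plane → Plane} (hF : IsFluxField O K F) : ∫ x in O, div F x = B F := by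
  have hr : ∀ x ∈ K, ∃ r > 0, ∀ K' ⊆ Metric.closedBall x (2 * r), IsCompact K' →
      ∀ F, IsFluxField O K' F → ∫ x in O, div F x = B F := by
    intro x hx
    obtain ⟨V, hV, hxV, h⟩ := hloc x hx
    obtain ⟨ρ, hρ, hρV⟩ := Metric.nhds_basis_closedBall.mem_iff.1 (hV.mem_nhds hxV)
    refine ⟨ρ / 2, by positivity, fun K' hK' => h K' (hK'.trans ?_)⟩
    rwa [mul_div_cancel₀ ρ (two_ne_zero)]
  choose! r hr0 hr using hr
  obtain ⟨t, htK, ht⟩ := hK.elim_nhds_subcover (fun x => Metric.ball x (r x))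
    fun x hx => Metric.ball_mem_nhds x (hr0 x hx)
  -- Induction on the number of covering balls takes the place of a partition of unity. `K` and `F`
  -- stay general, since both change when a bump is split off.
  have key : ∀ t : Finset Plane, (∀ x ∈ t, 0 < r x ∧ ∀ K' ⊆ Metric.closedBall x (2 * r x),
      IsCompact K' → ∀ F, IsFluxField O K' F → ∫ x in O, div F x = B F) →
      ∀ K, IsCompact K → K ⊆ ⋃ x ∈ t, Metric.ball x (r x) → ∀ F, IsFluxField O K F →
      ∫ x in O, div F x = B F := by
    intro t
    induction t using Finset.induction_on with
    | empty =>
      intro _ K _ ht F hF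
      have hF0 : F = 0 := by
        ext1 x
        exact hF.eq_zero x fun hx => by simpa using ht hx
      have hB : B 0 = 0 := by
        have := hadd 0 0 continuousOn_const continuousOn_const
        simpa using this
      subst hF0
      rw [hB]
      refine (setIntegral_congr_fun hO.measurableSet (g := fun _ => 0) fun x _ => ?_).trans
        (by simp)
      exact div_eq_zero_of_eventuallyEq EventuallyEq.rfl
    | insert a t hat ih =>
      intro h K hK ht F hF
      obtain ⟨hra, hla⟩ := h a (Finset.mem_insert_self a t)
      -- The part `χ F` lives in the ball of radius `2 r`, where the local statement applies. The
      -- part `(1 - χ) F` vanishes on the ball of radius `r`, so the remaining balls cover its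
      -- support.
      let χ : ContDiffBump a := ⟨r a, 2 * r a, hra, by linarith⟩
      have hF1 : IsFluxField O (K ∩ Metric.closedBall a (2 * r a)) (fun x => χ x • F x) :=
        hF.smul hO hK χ.contDiff fun x hx hxK => χ.zero_of_le_dist (by
          have : x ∉ Metric.closedBall a (2 * r a) := fun h => hx ⟨hxK, h⟩
          rw [Metric.mem_closedBall, not_le] at this
          exact this.le)
      have hF2 : IsFluxField O (K \ Metric.ball a (r a)) (fun x => (1 - χ x) • F x) :=
        hF.smul hO hK (contDiff_const.sub χ.contDiff) fun x hx hxK => by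
          have : x ∈ Metric.ball a (r a) := by
            by_contra h
            exact hx ⟨hxK, h⟩
          rw [χ.one_of_mem_closedBall (Metric.ball_subset_closedBall this), sub_self]
      have hsum : F = (fun x => χ x • F x) + fun x => (1 - χ x) • F x := by
        ext1 x
        simp only [Pi.add_apply]
        rw [← add_smul]
        simp
      have e1 := hla _ inter_subset_right (hK.inter_right Metric.isClosed_closedBall) _ hF1
      have e2 := ih (fun x hx => h x (Finset.mem_insert_of_mem hx)) _
        (hK.diff Metric.isOpen_ball) (by
          rintro x ⟨hxK, hx⟩
          have := ht hxK
          simp only [Finset.mem_insert, iUnion_iUnion_eq_or_left, mem_union] at this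
          exact this.resolve_left hx) _ hF2
      rw [hsum, hadd _ _ hF1.continuousOn hF2.continuousOn, ← e1, ← e2,
        ← integral_add hF1.integrableOn hF2.integrableOn]
      exact setIntegral_congr_fun hO.measurableSet fun x hx =>
        div_add (hF1.differentiableAt hO hx) (hF2.differentiableAt hO hx)
  exact key t (fun x hx => ⟨hr0 x (htK x hx), hr x (htK x hx)⟩) K hK ht F hF

/-- The divergence of a field with compact support in `O` has integral zero. -/
theorem integral_div_eq_zero {O K : Set Plane} (hO : IsOpen O) (hK : IsCompact K) (hKO : K ⊆ O)
    {F : Plane → Plane} (hF : IsFluxField O K F) : ∫ x in O, div F x = 0 := by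
  have hd : Differentiable ℝ F := by
    intro x
    by_cases hx : x ∈ K
    · exact hF.differentiableAt hO (hKO hx)
    · have : F =ᶠ[𝓝 x] fun _ => 0 := by
        filter_upwards [hK.isClosed.isOpen_compl.mem_nhds hx] with y hy using hF.eq_zero y hy
      exact (differentiableAt_const _).congr_of_eventuallyEq this
  obtain ⟨M, hM, hKM⟩ := hK.isBounded.subset_ball_lt 0 0
  have hlt : ∀ x ∈ K, ∀ i : Fin 2, |x i| < M := fun x hx i =>
    (PiLp.norm_apply_le x i).trans_lt (by simpa using hKM hx)
  -- The slab over one coordinate axis in the direction of the other is the identity in coordinates.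
  -- The open square of half side `M` contains `K`, so all four edge integrals vanish.
  have hc : ContDiff ℝ 2 fun ξ : ℝ => ξ • basisVec 0 := by fun_prop
  have hc' : ∀ ξ : ℝ, deriv (fun ξ : ℝ => ξ • basisVec 0) ξ = basisVec 0 := fun ξ => by
    simpa using ((hasDerivAt_id ξ).smul_const (basisVec 0)).deriv
  set sl := slab (fun ξ : ℝ => ξ • basisVec 0) (basisVec 1) with hsl
  have hsl0 : ∀ q, sl q 0 = q.1 := fun q => by simp [hsl, slab]
  have hsl1 : ∀ q, sl q 1 = q.2 := fun q => by simp [hsl, slab]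
  have hinj : Function.Injective sl := fun q q' h => by
    ext
    · rw [← hsl0, h, hsl0]
    · rw [← hsl1, h, hsl1]
  have hKs : K ⊆ sl '' (Ioo (-M) M ×ˢ Ioo (-M) M) := by
    intro x hx
    refine ⟨(x 0, x 1), ⟨abs_lt.1 (hlt x hx 0), abs_lt.1 (hlt x hx 1)⟩, ?_⟩
    ext i; fin_cases i
    · exact hsl0 _
    · exact hsl1 _
  have hz : ∀ q : ℝ × ℝ, |q.1| = M ∨ |q.2| = M → F (sl q) = 0 := by
    intro q hq
    refine hF.eq_zero _ fun h => ?_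
    have h0 := hlt _ h 0
    have h1 := hlt _ h 1
    rw [hsl0] at h0
    rw [hsl1] at h1
    rcases hq with hq | hq <;> linarith
  have hoff : ∀ x ∉ K, div F x = 0 := fun x => div_eq_zero_off hK.isClosed hF.eq_zero
  have hint : Integrable (div F) := by
    refine (integrableOn_iff_integrable_of_support_subset fun x hx => ?_).1 hF.integrableOn
    by_contra h
    exact hx (hoff x fun hxK => h (hKO hxK))
  have hM' : |M| = M := abs_of_pos hM
  have := integral_div_slab hc (e := basisVec 1) (a := -M) (b := M) (r := -M) (s := M)
    (by linarith) (by linarith) hinj.injOn (fun ξ _ => by rw [hc']; simp [cross])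
    hd.continuous.continuousOn (fun q _ => hd _) hint.integrableOn
  simp only [← hsl, hc'] at this
  simp_rw [hz (_, M) (Or.inr hM'), hz (_, -M) (Or.inr (by rwa [abs_neg])),
    hz (M, _) (Or.inl hM'), hz (-M, _) (Or.inl (by rwa [abs_neg]))] at this
  rw [setIntegral_eq_integral_of_forall_compl_eq_zero fun x hx => hoff x fun h => hx (hKO h),
    ← setIntegral_eq_integral_of_forall_compl_eq_zero fun x hx => hoff x fun h => hx (hKs h), this]
  simp [cross]

/-! ### Slab charts along a Jordan curve -/

lemma IsC2JordanParam.deriv_periodic {c : ℝ → Plane} {L : ℝ} (hc : IsC2JordanParam c L) :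
    Function.Periodic (deriv c) L := by
  intro ξ
  have : (fun x => c (x + L)) = c := funext hc.periodic
  rw [← deriv_comp_add_const, this]

/-- By periodicity and injectivity on `[0, L)`, parameters of the same point differ by an integer
multiple of `L`. In this form the fact applies to a period window centred at any `ξ₀`. -/
lemma IsC2JordanParam.eq_of_abs_sub_lt {c : ℝ → Plane} {L : ℝ} (hc : IsC2JordanParam c L)
    (hL : 0 < L) {ξ ξ' : ℝ} (h : c ξ = c ξ') (hlt : |ξ - ξ'| < L) : ξ = ξ' := by
  have h1 : toIcoMod hL 0 ξ = toIcoMod hL 0 ξ' := by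
    apply hc.injOn
    · simpa using toIcoMod_mem_Ico hL 0 ξ
    · simpa using toIcoMod_mem_Ico hL 0 ξ'
    · rw [toIcoMod, toIcoMod, hc.periodic.sub_zsmul_eq, hc.periodic.sub_zsmul_eq, h]
  simp only [toIcoMod, zsmul_eq_mul] at h1
  have h2 : ξ - ξ' = ((toIcoDiv hL 0 ξ - toIcoDiv hL 0 ξ' : ℤ) : ℝ) * L := by
    push_cast; linarith
  set k : ℤ := toIcoDiv hL 0 ξ - toIcoDiv hL 0 ξ'
  have hk : k = 0 := by
    rw [h2, abs_mul, abs_of_pos hL] at hlt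
    have h3 : |(k : ℝ)| < 1 := by nlinarith
    rw [← Int.abs_lt_one_iff]
    exact_mod_cast h3
  rw [hk] at h2
  simp at h2
  linarith

lemma IsC2JordanParam.continuous {c : ℝ → Plane} {L : ℝ} (hc : IsC2JordanParam c L) :
    Continuous c := hc.contDiff.continuous

lemma IsC2JordanParam.exists_mem_Icc {c : ℝ → Plane} {L : ℝ} (hc : IsC2JordanParam c L)
    (hL : 0 < L) (ξ₀ ξ : ℝ) : ∃ ξ' ∈ Icc (ξ₀ - L / 2) (ξ₀ + L / 2), c ξ' = c ξ := by
  obtain ⟨ξ', hξ', h⟩ := hc.periodic.exists_mem_Ico hL ξ (ξ₀ - L / 2)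
  exact ⟨ξ', ⟨hξ'.1, by linarith [hξ'.2]⟩, h.symm⟩

lemma IsC2JordanParam.isCompact_range {c : ℝ → Plane} {L : ℝ} (hc : IsC2JordanParam c L)
    (hL : 0 < L) : IsCompact (range c) := by
  have : range c = c '' Icc (0 - L / 2) (0 + L / 2) := by
    ext x
    constructor
    · rintro ⟨ξ, rfl⟩
      exact hc.exists_mem_Icc hL 0 ξ
    · rintro ⟨ξ, -, rfl⟩
      exact mem_range_self ξ
  rw [this]
  exact isCompact_Icc.image hc.continuous

/-- The closed square of half side `δ` about `(ξ₀, 0)`. -/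
def square (ξ₀ δ : ℝ) : Set (ℝ × ℝ) := Icc (ξ₀ - δ) (ξ₀ + δ) ×ˢ Icc (-δ) δ

/-- The open square of half side `δ` about `(ξ₀, 0)`. -/
def openSquare (ξ₀ δ : ℝ) : Set (ℝ × ℝ) := Ioo (ξ₀ - δ) (ξ₀ + δ) ×ˢ Ioo (-δ) δ

lemma openSquare_subset_square (ξ₀ δ : ℝ) : openSquare ξ₀ δ ⊆ square ξ₀ δ :=
  prod_mono Ioo_subset_Icc_self Ioo_subset_Icc_self

lemma square_mono {ξ₀ δ δ' : ℝ} (h : δ ≤ δ') : square ξ₀ δ ⊆ square ξ₀ δ' :=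
  prod_mono (Icc_subset_Icc (by linarith) (by linarith)) (Icc_subset_Icc (by linarith) h)

lemma exists_square_subset {ξ₀ : ℝ} {S : Set (ℝ × ℝ)} (hS : S ∈ 𝓝 (ξ₀, (0 : ℝ))) :
    ∃ δ > 0, square ξ₀ δ ⊆ S := by
  obtain ⟨δ, hδ, h⟩ := Metric.nhds_basis_closedBall.mem_iff.1 hS
  refine ⟨δ, hδ, ?_⟩
  rwa [← closedBall_prod_same, Real.closedBall_eq_Icc, Real.closedBall_eq_Icc, zero_sub,
    zero_add] at h

/-- The slab of half width `δ` in the direction `e` along the closed curve `c` of period `L`, about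
the parameter `ξ₀`, is a chart which meets the curve in the segment `t = 0` only. -/
structure IsSlabChart (c : ℝ → Plane) (L : ℝ) (e : Plane) (ξ₀ δ : ℝ) : Prop where
  pos : 0 < δ
  lt : δ < L / 2
  injOn : InjOn (slab c e) (square ξ₀ δ)
  cross_pos : ∀ ξ ∈ Icc (ξ₀ - δ) (ξ₀ + δ), 0 < cross (deriv c ξ) e
  isOpen_image : IsOpen (slab c e '' openSquare ξ₀ δ)
  eq_of_mem : ∀ ξ ∈ Icc (ξ₀ - L / 2) (ξ₀ + L / 2), ∀ q ∈ square ξ₀ δ, c ξ = slab c e q → q = (ξ, 0)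

lemma slab_zero (c : ℝ → Plane) (e : Plane) (ξ : ℝ) : slab c e (ξ, 0) = c ξ := by simp [slab]

/-- The inverse function theorem applies at `(ξ₀, 0)`: the direction `e = 𝔸 c'(ξ₀)` makes the
Jacobian there equal to `‖c'(ξ₀)‖²`. The other properties follow by shrinking the square. -/
theorem exists_isSlabChart {c : ℝ → Plane} {L : ℝ} (hc : IsC2JordanParam c L) (hL : 0 < L)
    (ξ₀ : ℝ) {U : Set Plane} (hU : U ∈ 𝓝 (c ξ₀)) :
    ∃ δ, IsSlabChart c L (rot (deriv c ξ₀)) ξ₀ δ ∧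
      slab c (rot (deriv c ξ₀)) '' square ξ₀ δ ⊆ U := by
  set e := rot (deriv c ξ₀) with he
  have hcd : Differentiable ℝ c := hc.contDiff.differentiable (by simp)
  have hJ0 : 0 < cross (deriv c ξ₀) e := by
    rw [he, cross_rot_right]
    exact real_inner_self_pos.2 (hc.regular ξ₀)
  let A : Plane →L[ℝ] Plane :=
    (slabDeriv (deriv c ξ₀) e).comp (toPlane.symm : Plane →L[ℝ] ℝ × ℝ)
  have hA : A.det ≠ 0 := by
    rw [det_slabDeriv]
    exact hJ0.ne'
  let f' : (ℝ × ℝ) ≃L[ℝ] Plane := toPlane.trans (A.toContinuousLinearEquivOfDetNeZero hA)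
  have hf' : HasFDerivAt (slab c e) (f' : ℝ × ℝ →L[ℝ] Plane) (ξ₀, 0) := by
    refine (hasFDerivAt_slab hcd e (ξ₀, 0)).congr_fderiv ?_
    ext q <;> simp [f', A]
  have hcont : ContDiffAt ℝ 2 (slab c e) (ξ₀, 0) := by
    have : ContDiff ℝ 2 (slab c e) :=
      (hc.contDiff.comp contDiff_fst).add (contDiff_snd.smul contDiff_const)
    exact this.contDiffAt
  let Φ := hcont.toOpenPartialHomeomorph (slab c e) hf' (by simp)
  have hΦ : (Φ : ℝ × ℝ → Plane) = slab c e := hcont.toOpenPartialHomeomorph_coe hf' (by simp)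
  have hsrc : (ξ₀, (0 : ℝ)) ∈ Φ.source := hcont.mem_toOpenPartialHomeomorph_source hf' (by simp)
  have hinj : InjOn (slab c e) Φ.source := hΦ ▸ Φ.injOn
  obtain ⟨δ₁', hδ₁', hQ₁'⟩ := exists_square_subset (Φ.open_source.mem_nhds hsrc)
  -- Any bound below `L / 2` would do; it keeps the chart inside one period window about `ξ₀`.
  set δ₁ := min δ₁' (L / 4) with hδ₁
  have hδ₁0 : 0 < δ₁ := lt_min hδ₁' (by positivity)
  have hδ₁L : δ₁ < L / 2 := (min_le_right _ _).trans_lt (by linarith)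
  have hQ₁ : square ξ₀ δ₁ ⊆ Φ.source := (square_mono (min_le_left _ _)).trans hQ₁'
  -- The arc at parameter distance at least `δ₁` from `ξ₀` is compact and misses `c ξ₀`, so a small
  -- enough chart avoids it. Thus no distant piece of the curve re-enters the chart.
  set C := c '' (Icc (ξ₀ - L / 2) (ξ₀ - δ₁) ∪ Icc (ξ₀ + δ₁) (ξ₀ + L / 2)) with hC
  have hCclosed : IsClosed C :=
    ((isCompact_Icc.union isCompact_Icc).image hc.continuous).isClosed
  have hC0 : c ξ₀ ∉ C := by
    rintro ⟨ξ, hξ, h⟩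
    have hlt : |ξ - ξ₀| < L := by
      rw [abs_lt]
      rcases hξ with hξ | hξ <;> constructor <;> linarith [hξ.1, hξ.2]
    have := hc.eq_of_abs_sub_lt hL h hlt
    rcases hξ with hξ | hξ <;> linarith [hξ.1, hξ.2]
  have hS : Φ.source ∩ (slab c e ⁻¹' (U ∩ Cᶜ) ∩ {q | 0 < cross (deriv c q.1) e}) ∈
      𝓝 (ξ₀, (0 : ℝ)) := by
    refine inter_mem (Φ.open_source.mem_nhds hsrc) (inter_mem ?_ ?_)
    · refine (continuous_slab hc.continuous e).continuousAt.preimage_mem_nhds ?_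
      rw [slab_zero]
      exact inter_mem hU (hCclosed.isOpen_compl.mem_nhds hC0)
    · have : Continuous fun q : ℝ × ℝ => cross (deriv c q.1) e :=
        continuous_cross.comp
          (((continuous_deriv hc.contDiff).comp continuous_fst).prodMk continuous_const)
      exact (isOpen_lt continuous_const this).mem_nhds hJ0
  obtain ⟨δ', hδ', hQ'⟩ := exists_square_subset hS
  set δ := min δ' δ₁
  have hδ0 : 0 < δ := lt_min hδ' hδ₁0
  have hQ := (square_mono (ξ₀ := ξ₀) (min_le_left δ' δ₁)).trans hQ'
  refine ⟨δ, ⟨hδ0, (min_le_right _ _).trans_lt hδ₁L, hinj.mono fun q hq => (hQ hq).1, ?_, ?_, ?_⟩,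
    ?_⟩
  · intro ξ hξ
    exact (hQ (show (ξ, (0 : ℝ)) ∈ square ξ₀ δ from ⟨hξ, by constructor <;> linarith⟩)).2.2
  · rw [← hΦ]
    exact Φ.isOpen_image_of_subset_source (isOpen_Ioo.prod isOpen_Ioo)
      ((openSquare_subset_square ξ₀ δ).trans fun q hq => (hQ hq).1)
  -- A curve point in the chart is off `C`, so its parameter is within `δ₁` of `ξ₀`, where the slab
  -- is already injective.
  · intro ξ hξ q hq h
    have hqC : c ξ ∉ C := h ▸ (hQ hq).2.1.2
    have h1 : ξ ∈ Icc (ξ₀ - δ₁) (ξ₀ + δ₁) := by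
      by_contra hcon
      apply hqC
      refine mem_image_of_mem c ?_
      rcases not_and_or.1 hcon with h' | h'
      · exact Or.inl ⟨hξ.1, by linarith⟩
      · exact Or.inr ⟨by linarith, hξ.2⟩
    refine (hinj (hQ₁ ⟨h1, by constructor <;> linarith⟩) (hQ hq).1 ?_).symm
    rw [slab_zero, h]
  · rintro _ ⟨q, hq, rfl⟩
    exact (hQ hq).2.1.1

lemma IsSlabChart.notMem_range {c : ℝ → Plane} {L : ℝ} {e : Plane} {ξ₀ δ : ℝ}
    (h : IsSlabChart c L e ξ₀ δ) (hc : IsC2JordanParam c L) (hL : 0 < L) {q : ℝ × ℝ}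
    (hq : q ∈ square ξ₀ δ) (hq2 : q.2 ≠ 0) : slab c e q ∉ range c := by
  rintro ⟨ξ, hξ⟩
  obtain ⟨ξ', hξ', hcξ⟩ := hc.exists_mem_Icc hL ξ₀ ξ
  exact hq2 (by rw [h.eq_of_mem ξ' hξ' q hq (hcξ.trans hξ)])

/-! ### The flux through a closed curve -/

/-- The flux of `F` through the closed curve `c` of period `L`, from right to left. -/
def flux (c : ℝ → Plane) (L : ℝ) (F : Plane → Plane) : ℝ :=
  ∫ ξ in (0 : ℝ)..L, cross (deriv c ξ) (F (c ξ))

lemma continuous_cross_comp {c : ℝ → Plane} {L : ℝ} (hc : IsC2JordanParam c L)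
    {G : ℝ → Plane} (hG : Continuous G) : Continuous fun ξ => cross (deriv c ξ) (G ξ) :=
  continuous_cross.comp ((continuous_deriv hc.contDiff).prodMk hG)

lemma continuous_comp_curve {c : ℝ → Plane} {L : ℝ} (hc : IsC2JordanParam c L) {s : Set Plane}
    (hs : range c ⊆ s) {F : Plane → Plane} (hF : ContinuousOn F s) :
    Continuous fun ξ => F (c ξ) :=
  hF.comp_continuous hc.continuous fun ξ => hs (mem_range_self ξ)

lemma flux_add {c : ℝ → Plane} {L : ℝ} (hc : IsC2JordanParam c L) {s : Set Plane}
    (hs : range c ⊆ s) {F G : Plane → Plane} (hF : ContinuousOn F s) (hG : ContinuousOn G s) :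
    flux c L (F + G) = flux c L F + flux c L G := by
  rw [flux, flux, flux, ← intervalIntegral.integral_add]
  · congr 1
    ext1 ξ
    simp [cross]
    ring
  · exact (continuous_cross_comp hc (continuous_comp_curve hc hs hF)).intervalIntegrable _ _
  · exact (continuous_cross_comp hc (continuous_comp_curve hc hs hG)).intervalIntegrable _ _

lemma flux_eq_zero {c : ℝ → Plane} {L : ℝ} {F : Plane → Plane} (h : ∀ ξ, F (c ξ) = 0) :
    flux c L F = 0 := by
  simp [flux, h, cross]

/-- A shift centres the period window at `ξ₀`. By `eq_of_mem` the curve then meets the support only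
at parameters within `δ` of `ξ₀`. -/
lemma IsSlabChart.flux_eq {c : ℝ → Plane} {L : ℝ} {e : Plane} {ξ₀ δ : ℝ}
    (h : IsSlabChart c L e ξ₀ δ) (hc : IsC2JordanParam c L) {F : Plane → Plane}
    (hF : ∀ x ∉ slab c e '' openSquare ξ₀ δ, F x = 0) :
    flux c L F = ∫ ξ in (ξ₀ - δ)..(ξ₀ + δ), cross (deriv c ξ) (F (c ξ)) := by
  have hper : Function.Periodic (fun ξ => cross (deriv c ξ) (F (c ξ))) L := fun ξ => by
    simp only [hc.deriv_periodic ξ, hc.periodic ξ]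
  have h1 := hper.intervalIntegral_add_eq 0 (ξ₀ - L / 2)
  rw [zero_add] at h1
  have hpos := h.pos
  have hlt := h.lt
  rw [flux, h1, intervalIntegral.integral_of_le (by linarith),
    intervalIntegral.integral_of_le (by linarith)]
  refine setIntegral_eq_of_subset_of_forall_sdiff_eq_zero measurableSet_Ioc
    (Ioc_subset_Ioc (by linarith) (by linarith)) fun ξ hξ => ?_
  rw [hF (c ξ), cross]
  · simp
  · rintro ⟨q, hq, hqξ⟩
    have := h.eq_of_mem ξ ⟨hξ.1.1.le, by linarith [hξ.1.2]⟩ q (openSquare_subset_square _ _ hq)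
      hqξ.symm
    rw [this] at hq
    exact hξ.2 ⟨hq.1.1, hq.1.2.le⟩

/-! ### The divergence theorem on one side of a curve -/

/-- The heights `r` and `s` are left free so that both sides of the curve are covered. The support
lies in the image of the open square and the slab is injective on the closed one, so the lateral
edges contribute nothing. -/
theorem IsSlabChart.integral_div {c : ℝ → Plane} {L : ℝ} {e : Plane} {ξ₀ δ : ℝ}
    (h : IsSlabChart c L e ξ₀ δ) (hc : IsC2JordanParam c L) {O K : Set Plane} (hO : IsOpen O)
    {r s : ℝ} (hr : -δ ≤ r) (hrs : r ≤ s) (hs : s ≤ δ)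
    (hin : ∀ q ∈ openSquare ξ₀ δ, slab c e q ∈ O ↔ q.2 ∈ Ioo r s)
    (hcl : slab c e '' (Icc (ξ₀ - δ) (ξ₀ + δ) ×ˢ Icc r s) ⊆ closure O)
    (hK : IsCompact K) (hKV : K ⊆ slab c e '' openSquare ξ₀ δ) {F : Plane → Plane}
    (hF : IsFluxField O K F) :
    ∫ x in O, div F x =
      (∫ ξ in (ξ₀ - δ)..(ξ₀ + δ), cross (deriv c ξ) (F (slab c e (ξ, s))))
        - ∫ ξ in (ξ₀ - δ)..(ξ₀ + δ), cross (deriv c ξ) (F (slab c e (ξ, r))) := by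
  have hpos := h.pos
  set R : Set (ℝ × ℝ) := Ioo (ξ₀ - δ) (ξ₀ + δ) ×ˢ Ioo r s with hR
  have hRQ : R ⊆ openSquare ξ₀ δ := prod_mono_right (Ioo_subset_Ioo hr hs)
  have hRO : slab c e '' R ⊆ O := by
    rintro _ ⟨q, hq, rfl⟩
    exact (hin q (hRQ hq)).2 hq.2
  have hRm : MeasurableSet (slab c e '' R) := by
    have : slab c e '' R = (slab c e '' openSquare ξ₀ δ) ∩ O := by
      ext x
      constructor
      · rintro ⟨q, hq, rfl⟩
        exact ⟨mem_image_of_mem _ (hRQ hq), hRO (mem_image_of_mem _ hq)⟩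
      · rintro ⟨⟨q, hq, rfl⟩, hx⟩
        exact mem_image_of_mem _ ⟨hq.1, (hin q hq).1 hx⟩
    rw [this]
    exact (h.isOpen_image.inter hO).measurableSet
  have hz : ∀ q ∈ square ξ₀ δ, q ∉ openSquare ξ₀ δ → F (slab c e q) = 0 := by
    intro q hq hq'
    refine hF.eq_zero _ fun hqK => ?_
    obtain ⟨q₁, hq₁, h₁⟩ := hKV hqK
    rw [h.injOn (openSquare_subset_square _ _ hq₁) hq h₁] at hq₁
    exact hq' hq₁
  have hcross : ∀ e : Plane, cross 0 e = 0 := fun e => by simp [cross]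
  have h1 : ∫ t in r..s, cross (F (slab c e (ξ₀ + δ, t))) e = 0 := by
    rw [intervalIntegral.integral_congr (g := fun _ => 0)]
    · simp
    · intro t ht
      rw [uIcc_of_le hrs] at ht
      simp only
      rw [hz _ ⟨by constructor <;> simp <;> linarith, hr.trans ht.1, ht.2.trans hs⟩
        fun hq => lt_irrefl _ hq.1.2, hcross]
  have h2 : ∫ t in r..s, cross (F (slab c e (ξ₀ - δ, t))) e = 0 := by
    rw [intervalIntegral.integral_congr (g := fun _ => 0)]
    · simp
    · intro t ht
      rw [uIcc_of_le hrs] at ht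
      simp only
      rw [hz _ ⟨by constructor <;> simp <;> linarith, hr.trans ht.1, ht.2.trans hs⟩
        fun hq => lt_irrefl _ hq.1.1, hcross]
  have hmain := integral_div_slab hc.contDiff (e := e) (a := ξ₀ - δ) (b := ξ₀ + δ) (by linarith) hrs
    (h.injOn.mono (hRQ.trans (openSquare_subset_square _ _)))
    (fun ξ hξ => h.cross_pos ξ (Ioo_subset_Icc_self hξ)) (hF.continuousOn.mono hcl)
    (fun q hq => hF.differentiableAt hO (hRO (mem_image_of_mem _ hq)))
    (hF.integrableOn.mono_set hRO)
  rw [h1, h2, add_zero, sub_zero] at hmain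
  rw [← hmain]
  refine setIntegral_eq_of_subset_of_forall_sdiff_eq_zero hO.measurableSet hRO fun x hx => ?_
  refine div_eq_zero_off hK.isClosed hF.eq_zero fun hxK => ?_
  obtain ⟨q, hq, rfl⟩ := hKV hxK
  exact hx.2 (mem_image_of_mem _ ⟨hq.1, (hin q hq).1 hx.1⟩)

/-- A chart along the curve `c` with `A` on the right hand side and `B` on the left hand side. -/
structure IsInterfaceChart (c : ℝ → Plane) (L : ℝ) (A B : Set Plane) (e : Plane) (ξ₀ δ : ℝ) : Prop
    extends IsSlabChart c L e ξ₀ δ where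
  back : ∀ q ∈ square ξ₀ δ, q.2 < 0 → slab c e q ∈ A
  front : ∀ q ∈ square ξ₀ δ, 0 < q.2 → slab c e q ∈ B

/-- The edge `t = -δ` misses the support, and the curve is the upper edge `t = 0`, which enters with
a plus sign. -/
lemma IsInterfaceChart.integral_div_back {c : ℝ → Plane} {L : ℝ} {e : Plane} {ξ₀ δ : ℝ}
    {A B K : Set Plane} (h : IsInterfaceChart c L A B e ξ₀ δ) (hc : IsC2JordanParam c L)
    (hA : IsOpen A) (hAB : Disjoint A B) (hcA : ∀ ξ, c ξ ∉ A) (hcA' : range c ⊆ closure A)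
    (hK : IsCompact K) (hKV : K ⊆ slab c e '' openSquare ξ₀ δ) {F : Plane → Plane}
    (hF : IsFluxField A K F) : ∫ x in A, div F x = flux c L F := by
  have hpos := h.pos
  rw [h.integral_div hc hA (r := -δ) (s := 0) le_rfl (by linarith) hpos.le ?_ ?_ hK hKV hF,
    h.flux_eq hc fun x hx => hF.eq_zero x fun hxK => hx (hKV hxK)]
  · have : ∫ ξ in (ξ₀ - δ)..(ξ₀ + δ), cross (deriv c ξ) (F (slab c e (ξ, -δ))) = 0 := by
      rw [intervalIntegral.integral_congr (g := fun _ => 0)]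
      · simp
      · intro ξ hξ
        rw [uIcc_of_le (by linarith)] at hξ
        simp only
        rw [hF.eq_zero, cross]
        · simp
        · intro hqK
          obtain ⟨q₁, hq₁, h₁⟩ := hKV hqK
          rw [h.injOn (openSquare_subset_square _ _ hq₁)
            ⟨hξ, by constructor <;> simp <;> linarith⟩ h₁] at hq₁
          exact lt_irrefl _ hq₁.2.1
    rw [this, sub_zero]
    simp only [slab_zero]
  · intro q hq
    have hq' := openSquare_subset_square _ _ hq
    constructor
    · intro hqA
      refine ⟨hq.2.1, ?_⟩
      rcases lt_trichotomy q.2 0 with h0 | h0 | h0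
      · exact h0
      · exfalso
        apply hcA q.1
        rw [← slab_zero c e, ← h0]
        exact hqA
      · exact absurd (h.front q hq' h0) (hAB.notMem_of_mem_left hqA)
    · exact fun h0 => h.back q hq' h0.2
  · rintro _ ⟨q, hq, rfl⟩
    rcases hq.2.2.lt_or_eq with h0 | h0
    · exact subset_closure (h.back q ⟨hq.1, hq.2.1, by linarith⟩ h0)
    · apply hcA'
      refine ⟨q.1, ?_⟩
      rw [← slab_zero c e, ← h0]

/-- On this side the curve is the lower edge of the strip, hence the opposite sign. -/
lemma IsInterfaceChart.integral_div_front {c : ℝ → Plane} {L : ℝ} {e : Plane} {ξ₀ δ : ℝ}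
    {A B K : Set Plane} (h : IsInterfaceChart c L A B e ξ₀ δ) (hc : IsC2JordanParam c L)
    (hB : IsOpen B) (hAB : Disjoint A B) (hcB : ∀ ξ, c ξ ∉ B) (hcB' : range c ⊆ closure B)
    (hK : IsCompact K) (hKV : K ⊆ slab c e '' openSquare ξ₀ δ) {F : Plane → Plane}
    (hF : IsFluxField B K F) : ∫ x in B, div F x = -flux c L F := by
  have hpos := h.pos
  rw [h.integral_div hc hB (r := 0) (s := δ) (by linarith) hpos.le le_rfl ?_ ?_ hK hKV hF,
    h.flux_eq hc fun x hx => hF.eq_zero x fun hxK => hx (hKV hxK)]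
  · have : ∫ ξ in (ξ₀ - δ)..(ξ₀ + δ), cross (deriv c ξ) (F (slab c e (ξ, δ))) = 0 := by
      rw [intervalIntegral.integral_congr (g := fun _ => 0)]
      · simp
      · intro ξ hξ
        rw [uIcc_of_le (by linarith)] at hξ
        simp only
        rw [hF.eq_zero, cross]
        · simp
        · intro hqK
          obtain ⟨q₁, hq₁, h₁⟩ := hKV hqK
          rw [h.injOn (openSquare_subset_square _ _ hq₁)
            ⟨hξ, by constructor <;> simp <;> linarith⟩ h₁] at hq₁
          exact lt_irrefl _ hq₁.2.2
    rw [this, zero_sub]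
    simp only [slab_zero]
  · intro q hq
    have hq' := openSquare_subset_square _ _ hq
    constructor
    · intro hqB
      refine ⟨?_, hq.2.2⟩
      rcases lt_trichotomy q.2 0 with h0 | h0 | h0
      · exact absurd hqB (hAB.notMem_of_mem_left (h.back q hq' h0))
      · exfalso
        apply hcB q.1
        rw [← slab_zero c e, ← h0]
        exact hqB
      · exact h0
    · exact fun h0 => h.front q hq' h0.1
  · rintro _ ⟨q, hq, rfl⟩
    rcases hq.2.1.lt_or_eq with h0 | h0
    · exact subset_closure (h.front q ⟨hq.1, by linarith [hq.2.1], hq.2.2⟩ h0)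
    · apply hcB'
      refine ⟨q.1, ?_⟩
      rw [← slab_zero c e, h0]

/-- The image of either half of the chart is connected and misses the curve, so it lies entirely in
`A` or entirely in `B`. One point of each half decides which, and for this the behaviour of one of
the two domains along the normal is enough. -/
theorem exists_isInterfaceChart {c : ℝ → Plane} {L : ℝ} (hc : IsC2JordanParam c L) (hL : 0 < L)
    {A B U : Set Plane} (hA : IsOpen A) (hB : IsOpen B) (hAB : Disjoint A B) (ξ₀ : ℝ)
    (hU : U ∈ 𝓝 (c ξ₀)) (hUAB : ∀ x ∈ U, x ∉ range c → x ∈ A ∪ B)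
    (hN : (∀ᶠ s : ℝ in 𝓝[>] 0, c ξ₀ - s • leftNormal c ξ₀ ∈ A ∧ c ξ₀ + s • leftNormal c ξ₀ ∉ A) ∨
      ∀ᶠ s : ℝ in 𝓝[>] 0, c ξ₀ - s • leftNormal c ξ₀ ∉ B ∧ c ξ₀ + s • leftNormal c ξ₀ ∈ B) :
    ∃ e δ, IsInterfaceChart c L A B e ξ₀ δ ∧ slab c e '' square ξ₀ δ ⊆ U := by
  obtain ⟨δ, hδ, hδU⟩ := exists_isSlabChart hc hL ξ₀ hU
  set e := rot (deriv c ξ₀)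
  have hpos := hδ.pos
  have hdpos : 0 < ‖deriv c ξ₀‖ := norm_pos_iff.2 (hc.regular ξ₀)
  have hnormal : ∀ s : ℝ, s • leftNormal c ξ₀ = (s * ‖deriv c ξ₀‖⁻¹) • e := fun s => by
    rw [leftNormal, tangent, rot_smul, smul_smul]
  -- `e` is the unit normal times `‖c'(ξ₀)‖`, so the distance `s` along the normal corresponds to
  -- the height `s / ‖c'(ξ₀)‖` in the chart.
  have hev : ∀ P : Plane → Plane → Prop,
      (∀ᶠ s : ℝ in 𝓝[>] 0, P (c ξ₀ - s • leftNormal c ξ₀) (c ξ₀ + s • leftNormal c ξ₀)) →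
      ∃ t ∈ Ioo 0 δ, P (slab c e (ξ₀, -t)) (slab c e (ξ₀, t)) := by
    intro P hP
    obtain ⟨s, hs, hsδ⟩ := (hP.and (Ioo_mem_nhdsGT (mul_pos hpos hdpos))).exists
    refine ⟨s * ‖deriv c ξ₀‖⁻¹, ⟨mul_pos hsδ.1 (inv_pos.2 hdpos), ?_⟩, ?_⟩
    · rw [← div_eq_mul_inv, div_lt_iff₀ hdpos]
      exact hsδ.2
    · simpa [slab, hnormal, sub_eq_add_neg] using hs
  set Sb : Set (ℝ × ℝ) := Icc (ξ₀ - δ) (ξ₀ + δ) ×ˢ Ico (-δ) 0 with hSb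
  set Sf : Set (ℝ × ℝ) := Icc (ξ₀ - δ) (ξ₀ + δ) ×ˢ Ioc 0 δ with hSf
  have hconn : ∀ S : Set (ℝ × ℝ), Convex ℝ S → IsPreconnected (slab c e '' S) := fun S hS =>
    hS.isPreconnected.image _ (continuous_slab hc.continuous e).continuousOn
  have hSbc := hconn Sb ((convex_Icc _ _).prod (convex_Ico _ _))
  have hSfc := hconn Sf ((convex_Icc _ _).prod (convex_Ioc _ _))
  have hSbU : slab c e '' Sb ⊆ A ∪ B := by
    rintro _ ⟨q, hq, rfl⟩
    have hq' : q ∈ square ξ₀ δ := ⟨hq.1, hq.2.1, by linarith [hq.2.2]⟩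
    exact hUAB _ (hδU (mem_image_of_mem _ hq')) (hδ.notMem_range hc hL hq' hq.2.2.ne)
  have hSfU : slab c e '' Sf ⊆ A ∪ B := by
    rintro _ ⟨q, hq, rfl⟩
    have hq' : q ∈ square ξ₀ δ := ⟨hq.1, by linarith [hq.2.1], hq.2.2⟩
    exact hUAB _ (hδU (mem_image_of_mem _ hq')) (hδ.notMem_range hc hL hq' hq.2.1.ne')
  have hmem : ∃ t ∈ Ioo 0 δ, slab c e (ξ₀, -t) ∈ A ∧ slab c e (ξ₀, t) ∈ B := by
    have hb : ∀ t ∈ Ioo 0 δ, slab c e (ξ₀, -t) ∈ A ∪ B := fun t ht =>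
      hSbU (mem_image_of_mem _ ⟨by constructor <;> simp <;> linarith,
        by constructor <;> simp <;> linarith [ht.1, ht.2]⟩)
    have hf : ∀ t ∈ Ioo 0 δ, slab c e (ξ₀, t) ∈ A ∪ B := fun t ht =>
      hSfU (mem_image_of_mem _ ⟨by constructor <;> simp <;> linarith, ht.1, ht.2.le⟩)
    rcases hN with hN | hN
    · obtain ⟨t, ht, h1, h2⟩ := hev (fun x y => x ∈ A ∧ y ∉ A) hN
      exact ⟨t, ht, h1, (hf t ht).resolve_left h2⟩
    · obtain ⟨t, ht, h1, h2⟩ := hev (fun x y => x ∉ B ∧ y ∈ B) hN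
      exact ⟨t, ht, (hb t ht).resolve_right h1, h2⟩
  obtain ⟨t, ht, htA, htB⟩ := hmem
  have hbA : slab c e '' Sb ⊆ A := hSbc.subset_left_of_subset_union hA hB hAB hSbU
    ⟨_, mem_image_of_mem _ ⟨by constructor <;> simp <;> linarith,
        by constructor <;> simp <;> linarith [ht.1, ht.2]⟩, htA⟩
  have hfB : slab c e '' Sf ⊆ B := hSfc.subset_right_of_subset_union hA hB hAB hSfU
    ⟨_, mem_image_of_mem _ ⟨by constructor <;> simp <;> linarith, ht.1, ht.2.le⟩, htB⟩
  exact ⟨e, δ, { toIsSlabChart := hδ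
                 back := fun q hq h0 => hbA (mem_image_of_mem _ ⟨hq.1, hq.2.1, h0⟩)
                 front := fun q hq h0 => hfB (mem_image_of_mem _ ⟨hq.1, h0, hq.2.2⟩) }, hδU⟩

/-! ### The divergence theorem in the three domains -/

namespace IsThinLayer

variable {D Ω₁ Ω₂ Ω₃ : Set Plane} {Γ : ℝ → Plane} {h : ℝ → ℝ} {L ε : ℝ}

lemma isOpen_D (G : IsThinLayer D Ω₁ Ω₂ Ω₃ Γ h L ε) : IsOpen D := by
  rw [G.fills]
  exact isOpen_interior

lemma subset₁ (G : IsThinLayer D Ω₁ Ω₂ Ω₃ Γ h L ε) : Ω₁ ⊆ D := by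
  rw [G.fills]
  exact interior_maximal (fun x hx => Or.inl (Or.inl (subset_closure hx))) G.isOpen₁

lemma subset₂ (G : IsThinLayer D Ω₁ Ω₂ Ω₃ Γ h L ε) : Ω₂ ⊆ D := by
  rw [G.fills]
  exact interior_maximal (fun x hx => Or.inl (Or.inr (subset_closure hx))) G.isOpen₂

lemma subset₃ (G : IsThinLayer D Ω₁ Ω₂ Ω₃ Γ h L ε) : Ω₃ ⊆ D := by
  rw [G.fills]
  exact interior_maximal (fun x hx => Or.inr (subset_closure hx)) G.isOpen₃

/-- `D` lies in the union of the three closures, and inside `D` the boundaries of the domains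
consist of the two curves. -/
lemma mem_cases (G : IsThinLayer D Ω₁ Ω₂ Ω₃ Γ h L ε) {x : Plane} (hx : x ∈ D) :
    x ∈ Ω₁ ∨ x ∈ Ω₂ ∨ x ∈ Ω₃ ∨ x ∈ range Γ ∨ x ∈ range (innerCurve Γ h ε) := by
  have hcl : x ∈ closure Ω₁ ∪ closure Ω₂ ∪ closure Ω₃ := by
    have := hx
    rw [G.fills] at this
    exact interior_subset this
  by_cases h1 : x ∈ Ω₁
  · exact Or.inl h1
  by_cases h2 : x ∈ Ω₂
  · exact Or.inr (Or.inl h2)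
  by_cases h3 : x ∈ Ω₃
  · exact Or.inr (Or.inr (Or.inl h3))
  refine Or.inr (Or.inr (Or.inr ?_))
  rcases hcl with (hc | hc) | hc
  · right
    rw [← G.frontier₁, G.isOpen₁.frontier_eq]
    exact ⟨hx, hc, h1⟩
  · have : x ∈ frontier Ω₂ := by
      rw [G.isOpen₂.frontier_eq]
      exact ⟨hc, h2⟩
    rwa [G.frontier₂] at this
  · left
    rw [← G.frontier₃, G.isOpen₃.frontier_eq]
    exact ⟨hx, hc, h3⟩

lemma outer_mem_frontier₂ (G : IsThinLayer D Ω₁ Ω₂ Ω₃ Γ h L ε) (ξ : ℝ) : Γ ξ ∈ frontier Ω₂ := by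
  rw [G.frontier₂]
  exact Or.inl (mem_range_self ξ)

lemma inner_mem_frontier₂ (G : IsThinLayer D Ω₁ Ω₂ Ω₃ Γ h L ε) (ξ : ℝ) :
    innerCurve Γ h ε ξ ∈ frontier Ω₂ := by
  rw [G.frontier₂]
  exact Or.inr (mem_range_self ξ)

lemma outer_mem_frontier₃ (G : IsThinLayer D Ω₁ Ω₂ Ω₃ Γ h L ε) (ξ : ℝ) : Γ ξ ∈ frontier Ω₃ := by
  have : Γ ξ ∈ D ∩ frontier Ω₃ := G.frontier₃ ▸ mem_range_self ξ
  exact this.2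

lemma inner_mem_frontier₁ (G : IsThinLayer D Ω₁ Ω₂ Ω₃ Γ h L ε) (ξ : ℝ) :
    innerCurve Γ h ε ξ ∈ frontier Ω₁ := by
  have : innerCurve Γ h ε ξ ∈ D ∩ frontier Ω₁ := G.frontier₁ ▸ mem_range_self ξ
  exact this.2

lemma outer_notMem₂ (G : IsThinLayer D Ω₁ Ω₂ Ω₃ Γ h L ε) (ξ : ℝ) : Γ ξ ∉ Ω₂ := fun hx =>
  (G.isOpen₂.frontier_eq ▸ G.outer_mem_frontier₂ ξ).2 hx

lemma outer_notMem₃ (G : IsThinLayer D Ω₁ Ω₂ Ω₃ Γ h L ε) (ξ : ℝ) : Γ ξ ∉ Ω₃ := fun hx =>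
  (G.isOpen₃.frontier_eq ▸ G.outer_mem_frontier₃ ξ).2 hx

lemma inner_notMem₂ (G : IsThinLayer D Ω₁ Ω₂ Ω₃ Γ h L ε) (ξ : ℝ) : innerCurve Γ h ε ξ ∉ Ω₂ :=
  fun hx => (G.isOpen₂.frontier_eq ▸ G.inner_mem_frontier₂ ξ).2 hx

lemma inner_notMem₁ (G : IsThinLayer D Ω₁ Ω₂ Ω₃ Γ h L ε) (ξ : ℝ) : innerCurve Γ h ε ξ ∉ Ω₁ :=
  fun hx => (G.isOpen₁.frontier_eq ▸ G.inner_mem_frontier₁ ξ).2 hx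

/-- Otherwise the point lies in `Ω₁`, which is open and disjoint from `Ω₂` and so misses `closure
Ω₂`, or in `D ∩ ∂Ω₁`, which is the inner curve. -/
lemma outer_notMem_closure₁ (G : IsThinLayer D Ω₁ Ω₂ Ω₃ Γ h L ε) (ξ : ℝ) : Γ ξ ∉ closure Ω₁ := by
  intro hx
  have h1 : Γ ξ ∉ Ω₁ := fun h1 => (G.disjoint₁₂.closure_right G.isOpen₁).notMem_of_mem_left h1
    (frontier_subset_closure (G.outer_mem_frontier₂ ξ))
  have : Γ ξ ∈ D ∩ frontier Ω₁ := ⟨G.outer_mem ξ, G.isOpen₁.frontier_eq ▸ ⟨hx, h1⟩⟩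
  rw [G.frontier₁] at this
  exact G.curves_disjoint.notMem_of_mem_left (mem_range_self ξ) this

lemma inner_notMem_closure₃ (G : IsThinLayer D Ω₁ Ω₂ Ω₃ Γ h L ε) (ξ : ℝ) :
    innerCurve Γ h ε ξ ∉ closure Ω₃ := by
  intro hx
  have h1 : innerCurve Γ h ε ξ ∉ Ω₃ := fun h1 =>
    (G.disjoint₂₃.symm.closure_right G.isOpen₃).notMem_of_mem_left h1
    (frontier_subset_closure (G.inner_mem_frontier₂ ξ))
  have : innerCurve Γ h ε ξ ∈ D ∩ frontier Ω₃ := ⟨G.inner_mem ξ, G.isOpen₃.frontier_eq ▸ ⟨hx, h1⟩⟩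
  rw [G.frontier₃] at this
  exact G.curves_disjoint.notMem_of_mem_left this (mem_range_self ξ)

lemma range_outer_subset_closure₂ (G : IsThinLayer D Ω₁ Ω₂ Ω₃ Γ h L ε) :
    range Γ ⊆ closure Ω₂ := by
  rintro _ ⟨ξ, rfl⟩
  exact frontier_subset_closure (G.outer_mem_frontier₂ ξ)

lemma range_outer_subset_closure₃ (G : IsThinLayer D Ω₁ Ω₂ Ω₃ Γ h L ε) :
    range Γ ⊆ closure Ω₃ := by
  rintro _ ⟨ξ, rfl⟩
  exact frontier_subset_closure (G.outer_mem_frontier₃ ξ)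

lemma range_inner_subset_closure₂ (G : IsThinLayer D Ω₁ Ω₂ Ω₃ Γ h L ε) :
    range (innerCurve Γ h ε) ⊆ closure Ω₂ := by
  rintro _ ⟨ξ, rfl⟩
  exact frontier_subset_closure (G.inner_mem_frontier₂ ξ)

lemma range_inner_subset_closure₁ (G : IsThinLayer D Ω₁ Ω₂ Ω₃ Γ h L ε) :
    range (innerCurve Γ h ε) ⊆ closure Ω₁ := by
  rintro _ ⟨ξ, rfl⟩
  exact frontier_subset_closure (G.inner_mem_frontier₁ ξ)

/-- The part of `D` away from the inner curve and from `Ω₁`. -/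
lemma outer_region_mem_nhds (G : IsThinLayer D Ω₁ Ω₂ Ω₃ Γ h L ε) (ξ : ℝ) :
    D ∩ ((range (innerCurve Γ h ε))ᶜ ∩ (closure Ω₁)ᶜ) ∈ 𝓝 (Γ ξ) :=
  inter_mem (G.isOpen_D.mem_nhds (G.outer_mem ξ)) (inter_mem
    ((G.inner_param.isCompact_range G.L_pos).isClosed.isOpen_compl.mem_nhds
      (G.curves_disjoint.notMem_of_mem_left (mem_range_self ξ)))
    (isClosed_closure.isOpen_compl.mem_nhds (G.outer_notMem_closure₁ ξ)))

lemma inner_region_mem_nhds (G : IsThinLayer D Ω₁ Ω₂ Ω₃ Γ h L ε) (ξ : ℝ) :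
    D ∩ ((range Γ)ᶜ ∩ (closure Ω₃)ᶜ) ∈ 𝓝 (innerCurve Γ h ε ξ) :=
  inter_mem (G.isOpen_D.mem_nhds (G.inner_mem ξ)) (inter_mem
    ((G.outer_param.isCompact_range G.L_pos).isClosed.isOpen_compl.mem_nhds
      (G.curves_disjoint.notMem_of_mem_right (mem_range_self ξ)))
    (isClosed_closure.isOpen_compl.mem_nhds (G.inner_notMem_closure₃ ξ)))

/-- `𝔸 τ` is the outer normal of `Ω₂` here, so `Ω₂` lies on the right of the curve. -/
theorem exists_outer_chart (G : IsThinLayer D Ω₁ Ω₂ Ω₃ Γ h L ε) (ξ : ℝ) {U : Set Plane}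
    (hU : U ∈ 𝓝 (Γ ξ)) : ∃ e δ, IsInterfaceChart Γ L Ω₂ Ω₃ e ξ δ ∧
      slab Γ e '' square ξ δ ⊆ U ∩ (D ∩ ((range (innerCurve Γ h ε))ᶜ ∩ (closure Ω₁)ᶜ)) := by
  refine exists_isInterfaceChart G.outer_param G.L_pos G.isOpen₂ G.isOpen₃ G.disjoint₂₃ ξ
    (inter_mem hU (G.outer_region_mem_nhds ξ)) ?_ (Or.inl ?_)
  · rintro x ⟨-, hxD, hxγ, hx1⟩ hxΓ
    rcases G.mem_cases hxD with h | h | h | h | h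
    · exact absurd (subset_closure h) hx1
    · exact Or.inl h
    · exact Or.inr h
    · exact absurd h hxΓ
    · exact absurd h hxγ
  · filter_upwards [G.outer_normal ξ] with s hs using ⟨hs.1, fun h => hs.2 (subset_closure h)⟩

/-- The outer normal of `Ω₂` is now `-𝔸 τ_ε`, so `Ω₂` lies on the left and supplies the second
alternative about the normal. -/
theorem exists_inner_chart (G : IsThinLayer D Ω₁ Ω₂ Ω₃ Γ h L ε) (ξ : ℝ) {U : Set Plane}
    (hU : U ∈ 𝓝 (innerCurve Γ h ε ξ)) :
    ∃ e δ, IsInterfaceChart (innerCurve Γ h ε) L Ω₁ Ω₂ e ξ δ ∧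
      slab (innerCurve Γ h ε) e '' square ξ δ ⊆ U ∩ (D ∩ ((range Γ)ᶜ ∩ (closure Ω₃)ᶜ)) := by
  refine exists_isInterfaceChart G.inner_param G.L_pos G.isOpen₁ G.isOpen₂ G.disjoint₁₂ ξ
    (inter_mem hU (G.inner_region_mem_nhds ξ)) ?_ (Or.inr ?_)
  · rintro x ⟨-, hxD, hxΓ, hx3⟩ hxγ
    rcases G.mem_cases hxD with h | h | h | h | h
    · exact Or.inl h
    · exact Or.inr h
    · exact absurd (subset_closure h) hx3
    · exact absurd h hxΓ
    · exact absurd h hxγ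
  · filter_upwards [G.inner_normal ξ] with s hs
    rw [smul_neg, sub_neg_eq_add, ← sub_eq_add_neg] at hs
    exact ⟨fun h => hs.2 (subset_closure h), hs.1⟩

lemma mem_slab_openSquare {c : ℝ → Plane} {L : ℝ} {e : Plane} {ξ δ : ℝ}
    (hch : IsSlabChart c L e ξ δ) : c ξ ∈ slab c e '' openSquare ξ δ :=
  ⟨(ξ, 0), ⟨by constructor <;> simp [hch.pos], by constructor <;> simp [hch.pos]⟩, slab_zero c e ξ⟩

/-- Locally there are three cases: interior points, points of the inner curve, and points off the
closure, where both sides vanish. The condition `K ⊆ D` excludes points of `∂D`. -/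
theorem integral_div₁ (G : IsThinLayer D Ω₁ Ω₂ Ω₃ Γ h L ε) {K : Set Plane} (hK : IsCompact K)
    (hKD : K ⊆ D) {F : Plane → Plane} (hF : IsFluxField Ω₁ K F) :
    ∫ x in Ω₁, div F x = flux (innerCurve Γ h ε) L F := by
  refine integral_div_eq_of_local G.isOpen₁ hK
    (fun F G' hF hG => flux_add G.inner_param G.range_inner_subset_closure₁ hF hG) ?_ hF
  intro x hx
  by_cases hx1 : x ∈ Ω₁
  · refine ⟨Ω₁, G.isOpen₁, hx1, fun K' hK' hK'c F hF => ?_⟩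
    rw [integral_div_eq_zero G.isOpen₁ hK'c hK' hF, flux_eq_zero]
    exact fun ξ => hF.eq_zero _ fun h => G.inner_notMem₁ ξ (hK' h)
  by_cases hx2 : x ∈ closure Ω₁
  · have : x ∈ D ∩ frontier Ω₁ := ⟨hKD hx, G.isOpen₁.frontier_eq ▸ ⟨hx2, hx1⟩⟩
    rw [G.frontier₁] at this
    obtain ⟨ξ, rfl⟩ := this
    obtain ⟨e, δ, hch, -⟩ := G.exists_inner_chart ξ univ_mem
    exact ⟨_, hch.isOpen_image, mem_slab_openSquare hch.toIsSlabChart, fun K' hK' hK'c F hF =>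
      hch.integral_div_back G.inner_param G.isOpen₁ G.disjoint₁₂ G.inner_notMem₁
        G.range_inner_subset_closure₁ hK'c hK' hF⟩
  · refine ⟨(closure Ω₁)ᶜ, isClosed_closure.isOpen_compl, hx2, fun K' hK' hK'c F hF => ?_⟩
    rw [flux_eq_zero fun ξ => hF.eq_zero _ fun h =>
      hK' h (G.range_inner_subset_closure₁ (mem_range_self ξ))]
    exact setIntegral_eq_zero_of_forall_eq_zero fun x hx =>
      div_eq_zero_off hK'c.isClosed hF.eq_zero fun h => hK' h (subset_closure hx)

theorem integral_div₃ (G : IsThinLayer D Ω₁ Ω₂ Ω₃ Γ h L ε) {K : Set Plane} (hK : IsCompact K)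
    (hKD : K ⊆ D) {F : Plane → Plane} (hF : IsFluxField Ω₃ K F) :
    ∫ x in Ω₃, div F x = -flux Γ L F := by
  refine integral_div_eq_of_local G.isOpen₃ hK
    (B := fun F => -flux Γ L F) (fun F G' hF hG => ?_) ?_ hF
  · simp only [flux_add G.outer_param G.range_outer_subset_closure₃ hF hG, neg_add]
  intro x hx
  by_cases hx1 : x ∈ Ω₃
  · refine ⟨Ω₃, G.isOpen₃, hx1, fun K' hK' hK'c F hF => ?_⟩
    rw [integral_div_eq_zero G.isOpen₃ hK'c hK' hF, flux_eq_zero, neg_zero]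
    exact fun ξ => hF.eq_zero _ fun h => G.outer_notMem₃ ξ (hK' h)
  by_cases hx2 : x ∈ closure Ω₃
  · have : x ∈ D ∩ frontier Ω₃ := ⟨hKD hx, G.isOpen₃.frontier_eq ▸ ⟨hx2, hx1⟩⟩
    rw [G.frontier₃] at this
    obtain ⟨ξ, rfl⟩ := this
    obtain ⟨e, δ, hch, -⟩ := G.exists_outer_chart ξ univ_mem
    exact ⟨_, hch.isOpen_image, mem_slab_openSquare hch.toIsSlabChart, fun K' hK' hK'c F hF =>
      hch.integral_div_front G.outer_param G.isOpen₃ G.disjoint₂₃ G.outer_notMem₃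
        G.range_outer_subset_closure₃ hK'c hK' hF⟩
  · refine ⟨(closure Ω₃)ᶜ, isClosed_closure.isOpen_compl, hx2, fun K' hK' hK'c F hF => ?_⟩
    rw [flux_eq_zero fun ξ => hF.eq_zero _ fun h =>
      hK' h (G.range_outer_subset_closure₃ (mem_range_self ξ)), neg_zero]
    exact setIntegral_eq_zero_of_forall_eq_zero fun x hx =>
      div_eq_zero_off hK'c.isClosed hF.eq_zero fun h => hK' h (subset_closure hx)

/-- The whole boundary of `Ω₂` consists of the two curves. The charts along one curve avoid the
other, so each local case sees at most one flux. -/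
theorem integral_div₂ (G : IsThinLayer D Ω₁ Ω₂ Ω₃ Γ h L ε) {K : Set Plane} (hK : IsCompact K)
    {F : Plane → Plane} (hF : IsFluxField Ω₂ K F) :
    ∫ x in Ω₂, div F x = flux Γ L F - flux (innerCurve Γ h ε) L F := by
  refine integral_div_eq_of_local G.isOpen₂ hK
    (B := fun F => flux Γ L F - flux (innerCurve Γ h ε) L F) (fun F G' hF hG => ?_) ?_ hF
  · simp only [flux_add G.outer_param G.range_outer_subset_closure₂ hF hG,
      flux_add G.inner_param G.range_inner_subset_closure₂ hF hG]
    ring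
  intro x hx
  by_cases hx1 : x ∈ Ω₂
  · refine ⟨Ω₂, G.isOpen₂, hx1, fun K' hK' hK'c F hF => ?_⟩
    rw [integral_div_eq_zero G.isOpen₂ hK'c hK' hF, flux_eq_zero, flux_eq_zero, sub_zero]
    · exact fun ξ => hF.eq_zero _ fun h => G.inner_notMem₂ ξ (hK' h)
    · exact fun ξ => hF.eq_zero _ fun h => G.outer_notMem₂ ξ (hK' h)
  by_cases hx2 : x ∈ closure Ω₂
  · have : x ∈ frontier Ω₂ := G.isOpen₂.frontier_eq ▸ ⟨hx2, hx1⟩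
    rw [G.frontier₂] at this
    obtain ⟨ξ, rfl⟩ | ⟨ξ, rfl⟩ := this
    · obtain ⟨e, δ, hch, hsub⟩ := G.exists_outer_chart ξ univ_mem
      refine ⟨_, hch.isOpen_image, mem_slab_openSquare hch.toIsSlabChart,
        fun K' hK' hK'c F hF => ?_⟩
      rw [hch.integral_div_back G.outer_param G.isOpen₂ G.disjoint₂₃ G.outer_notMem₂
        G.range_outer_subset_closure₂ hK'c hK' hF, flux_eq_zero (c := innerCurve Γ h ε), sub_zero]
      refine fun ξ => hF.eq_zero _ fun h => ?_
      exact (hsub (image_mono (openSquare_subset_square _ _) (hK' h))).2.2.1 (mem_range_self ξ)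
    · obtain ⟨e, δ, hch, hsub⟩ := G.exists_inner_chart ξ univ_mem
      refine ⟨_, hch.isOpen_image, mem_slab_openSquare hch.toIsSlabChart,
        fun K' hK' hK'c F hF => ?_⟩
      rw [hch.integral_div_front G.inner_param G.isOpen₂ G.disjoint₁₂ G.inner_notMem₂
        G.range_inner_subset_closure₂ hK'c hK' hF, flux_eq_zero (c := Γ), zero_sub]
      refine fun ξ => hF.eq_zero _ fun h => ?_
      exact (hsub (image_mono (openSquare_subset_square _ _) (hK' h))).2.2.1 (mem_range_self ξ)
  · refine ⟨(closure Ω₂)ᶜ, isClosed_closure.isOpen_compl, hx2, fun K' hK' hK'c F hF => ?_⟩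
    rw [flux_eq_zero fun ξ => hF.eq_zero _ fun h =>
      hK' h (G.range_outer_subset_closure₂ (mem_range_self ξ)),
      flux_eq_zero fun ξ => hF.eq_zero _ fun h =>
      hK' h (G.range_inner_subset_closure₂ (mem_range_self ξ)), sub_zero]
    exact setIntegral_eq_zero_of_forall_eq_zero fun x hx =>
      div_eq_zero_off hK'c.isClosed hF.eq_zero fun h => hK' h (subset_closure hx)

/-! ### Integrals over the container -/

/-- The curve is the image of the plane under the degenerate slab with `e = 0`, whose Jacobian
vanishes identically. -/
lemma volume_range_eq_zero {c : ℝ → Plane} (hc : Differentiable ℝ c) : volume (range c) = 0 := by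
  have h : range c = (slab c 0 ∘ toPlane.symm) '' univ := by
    ext x
    simp only [image_univ, mem_range, Function.comp, slab, smul_zero, add_zero]
    constructor
    · rintro ⟨ξ, rfl⟩
      exact ⟨toPlane (ξ, 0), by simp⟩
    · rintro ⟨y, rfl⟩
      exact ⟨_, rfl⟩
  rw [h]
  refine addHaar_image_eq_zero_of_det_fderivWithin_eq_zero volume
    (fun x _ => (hasFDerivAt_slab_toPlane hc 0 x).hasFDerivWithinAt) fun x _ => ?_
  rw [det_slabDeriv]
  simp [cross]

/-- The container and the union of the three domains differ by a null set. -/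
lemma ae_eq_union (G : IsThinLayer D Ω₁ Ω₂ Ω₃ Γ h L ε) :
    D =ᵐ[volume] (Ω₁ ∪ Ω₂ ∪ Ω₃ : Set Plane) := by
  have h0 : volume (range Γ ∪ range (innerCurve Γ h ε)) = 0 :=
    measure_union_null (volume_range_eq_zero (G.outer_param.contDiff.differentiable (by simp)))
      (volume_range_eq_zero (G.inner_param.contDiff.differentiable (by simp)))
  refine (ae_eq_set.2 ⟨measure_mono_null ?_ h0, ?_⟩)
  · rintro x ⟨hx, hx'⟩
    rcases G.mem_cases hx with h | h | h | h | h
    · exact absurd (Or.inl (Or.inl h)) hx'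
    · exact absurd (Or.inl (Or.inr h)) hx'
    · exact absurd (Or.inr h) hx'
    · exact Or.inl h
    · exact Or.inr h
  · rw [sdiff_eq_empty.2 (union_subset (union_subset G.subset₁ G.subset₂) G.subset₃), measure_empty]

lemma setIntegral_eq_add (G : IsThinLayer D Ω₁ Ω₂ Ω₃ Γ h L ε) {f : Plane → ℝ}
    (h₁ : IntegrableOn f Ω₁) (h₂ : IntegrableOn f Ω₂) (h₃ : IntegrableOn f Ω₃) :
    ∫ x in D, f x = (∫ x in Ω₁, f x) + (∫ x in Ω₂, f x) + ∫ x in Ω₃, f x := by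
  rw [setIntegral_congr_set G.ae_eq_union, setIntegral_union _ G.isOpen₃.measurableSet
    (h₁.union h₂) h₃, setIntegral_union G.disjoint₁₂ G.isOpen₂.measurableSet h₁ h₂]
  exact disjoint_union_left.2 ⟨G.disjoint₁₃, G.disjoint₂₃⟩

end IsThinLayer

/-! ### Functionals given by integrals are distributions -/

section Distributions

variable {D : TopologicalSpace.Opens Plane} {Y : Type*} [MeasurableSpace Y] {ν : Measure Y}
  {m : Y → Plane}

lemma integrable_mul_test (hm : Measurable m) {b : Y → ℝ} (hb : Integrable b ν)
    (f : BoundedContinuousFunction Plane ℝ) : Integrable (fun y => b y * f (m y)) ν :=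
  hb.mul_bdd (c := ‖f‖) (f.continuous.measurable.comp hm).aestronglyMeasurable
    (Eventually.of_forall fun y => f.norm_coe_le_norm (m y))

/-- The functional is bounded by the `L¹` norm of `b` times the supremum norm, and test functions
map continuously to bounded continuous functions. The map `m` is the identity for bulk integrals and
the parametrization for curve integrals. -/
theorem exists_distribution_zero (hm : Measurable m) {b : Y → ℝ} (hb : Integrable b ν) :
    ∃ T : 𝓓(D, ℝ) →L[ℝ] ℝ, ∀ φ : 𝓓(D, ℝ), T φ = ∫ y, b y * φ (m y) ∂ν := by
  let T₀ : BoundedContinuousFunction Plane ℝ →ₗ[ℝ] ℝ :=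
    { toFun := fun f => ∫ y, b y * f (m y) ∂ν
      map_add' := fun f g => by
        rw [← integral_add (integrable_mul_test hm hb f) (integrable_mul_test hm hb g)]
        congr 1
        ext1 y
        rw [← mul_add]
        rfl
      map_smul' := fun a f => by
        rw [RingHom.id_apply, smul_eq_mul, ← integral_const_mul]
        congr 1
        ext1 y
        simp only [BoundedContinuousFunction.coe_smul, smul_eq_mul]
        ring }
  let T₁ : BoundedContinuousFunction Plane ℝ →L[ℝ] ℝ := T₀.mkContinuous (∫ y, ‖b y‖ ∂ν) fun f => by
    rw [← integral_mul_const]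
    refine norm_integral_le_of_norm_le (hb.norm.mul_const _) (Eventually.of_forall fun y => ?_)
    rw [norm_mul]
    exact mul_le_mul_of_nonneg_left (f.norm_coe_le_norm _) (norm_nonneg _)
  exact ⟨T₁.comp (TestFunction.toBoundedContinuousFunctionCLM ℝ), fun φ => rfl⟩

variable {F : Type*} [NormedAddCommGroup F] [NormedSpace ℝ F]

/-- Integrals against integrable coefficients of continuous linear expressions in a test function
are distributions. -/
theorem exists_distribution {ι : Type*} [Fintype ι] (hm : Measurable m)
    (Λ : ι → 𝓓(D, F) →L[ℝ] 𝓓(D, ℝ)) {b : ι → Y → ℝ} (hb : ∀ i, Integrable (b i) ν) :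
    ∃ T : 𝓓(D, F) →L[ℝ] ℝ, ∀ φ : 𝓓(D, F), T φ = ∫ y, ∑ i, b i y * Λ i φ (m y) ∂ν := by
  choose T hT using fun i => exists_distribution_zero (D := D) hm (hb i)
  refine ⟨∑ i, (T i).comp (Λ i), fun φ => ?_⟩
  have hint : ∀ i, Integrable (fun y => b i y * Λ i φ (m y)) ν := fun i =>
    integrable_mul_test hm (hb i) (TestFunction.toBoundedContinuousFunctionCLM ℝ (Λ i φ))
  rw [integral_finsetSum _ fun i _ => hint i]
  simp only [_root_.sum_apply, ContinuousLinearMap.comp_apply, hT]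

/-- The `i`-th component of a vector valued test function. -/
def testCoord (i : Fin 2) : 𝓓(D, Plane) →L[ℝ] 𝓓(D, ℝ) := TestFunction.postcompCLM (coord i)

lemma testCoord_apply (i : Fin 2) (φ : 𝓓(D, Plane)) (x : Plane) : testCoord i φ x = φ x i := rfl

/-- The `j`-th partial derivative of a test function. -/
def testDeriv (j : Fin 2) : 𝓓(D, F) →L[ℝ] 𝓓(D, F) := TestFunction.lineDerivCLM ℝ (basisVec j)

lemma testDeriv_apply (j : Fin 2) (φ : 𝓓(D, F)) (x : Plane) :
    testDeriv j φ x = fderiv ℝ φ x (basisVec j) := by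
  rw [testDeriv, TestFunction.lineDerivCLM_eq_fderivCLM, TestFunction.fderivCLM_apply_of_le]
  simp

end Distributions

/-! ### Partial derivatives -/

/-- The partial derivative of a scalar function. -/
def pd (j : Fin 2) (f : Plane → ℝ) (x : Plane) : ℝ := fderiv ℝ f x (basisVec j)

/-- The components of a vector field. -/
def comp (u : Plane → Plane) (i : Fin 2) (x : Plane) : ℝ := u x i

lemma pd_congr {f g : Plane → ℝ} {x : Plane} (h : f =ᶠ[𝓝 x] g) (j : Fin 2) :
    pd j f x = pd j g x := by
  rw [pd, pd, h.fderiv_eq]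

lemma contDiffAt_pd {f : Plane → ℝ} {x : Plane} (hf : ContDiffAt ℝ 2 f x) (j : Fin 2) :
    ContDiffAt ℝ 1 (pd j f) x :=
  (hf.fderiv_right (m := 1) (by norm_num)).clm_apply contDiffAt_const

lemma contDiffAt_comp {n : WithTop ℕ∞} {u : Plane → Plane} {x : Plane} (hu : ContDiffAt ℝ n u x)
    (i : Fin 2) : ContDiffAt ℝ n (comp u i) x :=
  (coord i).contDiff.contDiffAt.comp x hu

lemma contDiffAt_of_comp {n : WithTop ℕ∞} {u : Plane → Plane} {x : Plane}
    (hu : ∀ i, ContDiffAt ℝ n (comp u i) x) : ContDiffAt ℝ n u x :=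
  contDiffAt_euclidean.2 hu

lemma pd_comp {u : Plane → Plane} {x : Plane} (hu : DifferentiableAt ℝ u x) (i j : Fin 2) :
    pd j (comp u i) x = fderiv ℝ u x (basisVec j) i := by
  have : HasFDerivAt (comp u i) ((coord i).comp (fderiv ℝ u x)) x :=
    (coord i).hasFDerivAt.comp x hu.hasFDerivAt
  rw [pd, this.fderiv]
  rfl

lemma grad_apply {u : Plane → Plane} {x : Plane} (hu : DifferentiableAt ℝ u x) (i j : Fin 2) :
    grad u x i j = pd j (comp u i) x := (pd_comp hu i j).symm

lemma div_eq_pd {u : Plane → Plane} {x : Plane} (hu : DifferentiableAt ℝ u x) :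
    div u x = pd 0 (comp u 0) x + pd 1 (comp u 1) x := by
  rw [div_eq, pd_comp hu, pd_comp hu]

lemma eventually_differentiableAt {u : Plane → Plane} {x : Plane} {n : WithTop ℕ∞}
    (hu : ContDiffAt ℝ n u x) (hn : n ≠ 0) : ∀ᶠ y in 𝓝 x, DifferentiableAt ℝ u y := by
  have h1 : ContDiffAt ℝ 1 u x := hu.of_le (ENat.one_le_iff_ne_zero_withTop.2 hn)
  filter_upwards [h1.eventually (by simp)] with y hy using hy.differentiableAt (by simp)

lemma pd_add {f g : Plane → ℝ} {x : Plane} (hf : DifferentiableAt ℝ f x)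
    (hg : DifferentiableAt ℝ g x) (k : Fin 2) :
    pd k (fun y => f y + g y) x = pd k f x + pd k g x := by
  rw [pd, fderiv_fun_add hf hg]; rfl

lemma pd_comm {f : Plane → ℝ} {x : Plane} (hf : ContDiffAt ℝ 2 f x) (i j : Fin 2) :
    pd i (pd j f) x = pd j (pd i f) x := by
  have hd : DifferentiableAt ℝ (fderiv ℝ f) x :=
    (hf.fderiv_right (m := 1) (by norm_num)).differentiableAt (by simp)
  have h : ∀ a b : Fin 2, pd a (pd b f) x = fderiv ℝ (fderiv ℝ f) x (basisVec a) (basisVec b) := by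
    intro a b
    change fderiv ℝ (fun y => fderiv ℝ f y (basisVec b)) x (basisVec a) = _
    rw [fderiv_clm_apply hd (differentiableAt_const _)]
    simp
  rw [h, h]
  exact (hf.isSymmSndFDerivAt (by simp)).eq _ _

open Laplacian in
lemma laplacian_apply {u : Plane → Plane} {x : Plane} (hu : ContDiffAt ℝ 2 u x) (i : Fin 2) :
    (Δ u) x i = pd 0 (pd 0 (comp u i)) x + pd 1 (pd 1 (comp u i)) x := by
  have hd : DifferentiableAt ℝ (fderiv ℝ u) x :=
    (hu.fderiv_right (m := 1) (by norm_num)).differentiableAt (by simp)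
  have h : ∀ j : Fin 2, pd j (pd j (comp u i)) x
      = fderiv ℝ (fderiv ℝ u) x (basisVec j) (basisVec j) i := by
    intro j
    have h1 : pd j (comp u i) =ᶠ[𝓝 x] comp (fun y => fderiv ℝ u y (basisVec j)) i := by
      filter_upwards [eventually_differentiableAt hu (by simp)] with y hy using pd_comp hy i j
    have h2 : DifferentiableAt ℝ (fun y => fderiv ℝ u y (basisVec j)) x :=
      hd.clm_apply (differentiableAt_const _)
    rw [pd_congr h1, pd_comp h2, fderiv_clm_apply hd (differentiableAt_const _)]
    simp
  rw [InnerProductSpace.laplacian_eq_iteratedFDeriv_orthonormalBasis u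
    (EuclideanSpace.basisFun (Fin 2) ℝ), h, h]
  simp [Fin.sum_univ_two, iteratedFDeriv_two_apply]

lemma inner_gradient (p : Plane → ℝ) (x v : Plane) : inner ℝ v (gradient p x) = fderiv ℝ p x v := by
  rw [gradient, real_inner_comm, InnerProductSpace.toDual_symm_apply]

lemma gradient_apply (p : Plane → ℝ) (x : Plane) (i : Fin 2) : gradient p x i = pd i p x := by
  rw [pd, ← inner_gradient, EuclideanSpace.inner_single_left]
  simp

lemma matDiv_grad_transpose_apply {u : Plane → Plane} {x : Plane} (hu : ContDiffAt ℝ 2 u x)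
    (i : Fin 2) : matDiv (fun y => (grad u y).transpose) x i
      = pd 0 (pd i (comp u 0)) x + pd 1 (pd i (comp u 1)) x := by
  have h : ∀ j, pd j (fun y => (grad u y).transpose i j) x = pd j (pd i (comp u j)) x := fun j =>
    pd_congr (by
      filter_upwards [eventually_differentiableAt hu (by simp)] with y hy using grad_apply hy j i) j
  rw [← h, ← h]
  simp only [matDiv, Fin.sum_univ_two, pd]

/-- Symmetry of second derivatives gives `∇ · (∇u)ᵀ = ∇(∇ · u)`. The divergence must vanish near
`x`, as it is differentiated. -/
lemma matDiv_grad_transpose_eq_zero {u : Plane → Plane} {x : Plane} (hu : ContDiffAt ℝ 2 u x)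
    (hdiv : ∀ᶠ y in 𝓝 x, div u y = 0) : matDiv (fun y => (grad u y).transpose) x = 0 := by
  ext i
  rw [matDiv_grad_transpose_apply hu, pd_comm (contDiffAt_comp hu 0), pd_comm (contDiffAt_comp hu 1),
    ← pd_add ((contDiffAt_pd (contDiffAt_comp hu 0) 0).differentiableAt (by simp))
      ((contDiffAt_pd (contDiffAt_comp hu 1) 1).differentiableAt (by simp))]
  have : (fun y => pd 0 (comp u 0) y + pd 1 (comp u 1) y) =ᶠ[𝓝 x] fun _ => 0 := by
    filter_upwards [eventually_differentiableAt hu (by simp), hdiv] with y hy h0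
    rw [← div_eq_pd hy, h0]
  rw [pd_congr this]
  simp [pd]

/-! ### The field of Green's formula -/

/-- The field whose divergence gives Green's formula for the Stokes operator. -/
def stokesField (m : ℝ) (u : Plane → Plane) (p : Plane → ℝ) (φ : Plane → Plane) (x : Plane) :
    Plane := m • act (symGrad φ x) (u x) - act (stress m u p x) (φ x)

lemma symGrad_apply {u : Plane → Plane} {x : Plane} (hu : DifferentiableAt ℝ u x) (i j : Fin 2) :
    symGrad u x i j = pd j (comp u i) x + pd i (comp u j) x := by
  simp [symGrad, Matrix.add_apply, grad_apply hu]

lemma stokesField_apply {m : ℝ} {u : Plane → Plane} {p : Plane → ℝ} {φ : Plane → Plane} {x : Plane}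
    (hu : DifferentiableAt ℝ u x) (hφ : DifferentiableAt ℝ φ x) (i : Fin 2) :
    comp (stokesField m u p φ) i x =
      m * ((pd 0 (comp φ i) x + pd i (comp φ 0) x) * comp u 0 x
          + (pd 1 (comp φ i) x + pd i (comp φ 1) x) * comp u 1 x)
        + p x * comp φ i x
        - m * ((pd 0 (comp u i) x + pd i (comp u 0) x) * comp φ 0 x
          + (pd 1 (comp u i) x + pd i (comp u 1) x) * comp φ 1 x) := by
  simp only [comp, stokesField, stress, PiLp.sub_apply, PiLp.smul_apply, act_apply,
    Matrix.add_apply, Matrix.smul_apply, symGrad_apply hu, symGrad_apply hφ, smul_eq_mul]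
  fin_cases i <;> simp [Matrix.one_apply] <;> ring

lemma contDiffAt_stokesField {m : ℝ} {u : Plane → Plane} {p : Plane → ℝ} {φ : Plane → Plane}
    {x : Plane} (hu : ContDiffAt ℝ 2 u x) (hp : ContDiffAt ℝ 1 p x) (hφ : ContDiffAt ℝ 2 φ x) :
    ContDiffAt ℝ 1 (stokesField m u p φ) x := by
  refine contDiffAt_of_comp fun i => ?_
  have hu1 : ∀ i, ContDiffAt ℝ 1 (comp u i) x := fun i =>
    contDiffAt_comp (hu.of_le (by norm_num)) i
  have hφ1 : ∀ i, ContDiffAt ℝ 1 (comp φ i) x := fun i =>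
    contDiffAt_comp (hφ.of_le (by norm_num)) i
  have hu2 : ∀ i j, ContDiffAt ℝ 1 (pd j (comp u i)) x := fun i j =>
    contDiffAt_pd (contDiffAt_comp hu i) j
  have hφ2 : ∀ i j, ContDiffAt ℝ 1 (pd j (comp φ i)) x := fun i j =>
    contDiffAt_pd (contDiffAt_comp hφ i) j
  refine ContDiffAt.congr_of_eventuallyEq ?_ (by
    filter_upwards [eventually_differentiableAt hu (by simp),
      eventually_differentiableAt hφ (by simp)] with y h1 h2 using stokesField_apply h1 h2 i)
  exact ((contDiffAt_const.mul ((((hφ2 _ _).add (hφ2 _ _)).mul (hu1 _)).add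
    (((hφ2 _ _).add (hφ2 _ _)).mul (hu1 _)))).add (hp.mul (hφ1 _))).sub
    (contDiffAt_const.mul ((((hu2 _ _).add (hu2 _ _)).mul (hφ1 _)).add
    (((hu2 _ _).add (hu2 _ _)).mul (hφ1 _))))

/-- With abstract factors a single product rule serves both components of `stokesField_apply`. -/
lemma pd_stokes_expression {m : ℝ} {a₀ a₁ b₀ b₁ u₀ u₁ φ₀ φ₁ p f : Plane → ℝ} {x : Plane}
    (ha₀ : DifferentiableAt ℝ a₀ x) (ha₁ : DifferentiableAt ℝ a₁ x) (hb₀ : DifferentiableAt ℝ b₀ x)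
    (hb₁ : DifferentiableAt ℝ b₁ x) (hu₀ : DifferentiableAt ℝ u₀ x) (hu₁ : DifferentiableAt ℝ u₁ x)
    (hφ₀ : DifferentiableAt ℝ φ₀ x) (hφ₁ : DifferentiableAt ℝ φ₁ x) (hp : DifferentiableAt ℝ p x)
    (hf : DifferentiableAt ℝ f x) (k : Fin 2) :
    pd k (fun y => m * (a₀ y * u₀ y + a₁ y * u₁ y) + p y * f y
        - m * (b₀ y * φ₀ y + b₁ y * φ₁ y)) x =
      m * (a₀ x * pd k u₀ x + pd k a₀ x * u₀ x + (a₁ x * pd k u₁ x + pd k a₁ x * u₁ x))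
        + (p x * pd k f x + pd k p x * f x)
        - m * (b₀ x * pd k φ₀ x + pd k b₀ x * φ₀ x + (b₁ x * pd k φ₁ x + pd k b₁ x * φ₁ x)) := by
  have h : HasFDerivAt (fun y => m * (a₀ y * u₀ y + a₁ y * u₁ y) + p y * f y
      - m * (b₀ y * φ₀ y + b₁ y * φ₁ y)) _ x :=
    ((((ha₀.hasFDerivAt.mul hu₀.hasFDerivAt).add (ha₁.hasFDerivAt.mul hu₁.hasFDerivAt)).const_mul
      m).add (hp.hasFDerivAt.mul hf.hasFDerivAt)).sub
    (((hb₀.hasFDerivAt.mul hφ₀.hasFDerivAt).add (hb₁.hasFDerivAt.mul hφ₁.hasFDerivAt)).const_mul m)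
  rw [pd, h.fderiv]
  simp [pd]
  ring

open Laplacian in
/-- The pointwise identity behind Green's formula. -/
theorem div_stokesField {m : ℝ} {u : Plane → Plane} {p : Plane → ℝ} {φ : Plane → Plane}
    {x : Plane} (hu : ContDiffAt ℝ 2 u x) (hp : ContDiffAt ℝ 1 p x) (hφ : ContDiffAt ℝ 2 φ x) :
    div (stokesField m u p φ) x =
      m * inner ℝ (u x) ((Δ φ) x + matDiv (fun y => (grad φ y).transpose) x) + p x * div φ x
        - inner ℝ (m • ((Δ u) x + matDiv (fun y => (grad u y).transpose) x) - gradient p x)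
          (φ x) := by
  have hu1 : ∀ i, DifferentiableAt ℝ (comp u i) x := fun i =>
    (contDiffAt_comp hu i).differentiableAt (by simp)
  have hφ1 : ∀ i, DifferentiableAt ℝ (comp φ i) x := fun i =>
    (contDiffAt_comp hφ i).differentiableAt (by simp)
  have hu2 : ∀ i j, DifferentiableAt ℝ (pd j (comp u i)) x := fun i j =>
    (contDiffAt_pd (contDiffAt_comp hu i) j).differentiableAt (by simp)
  have hφ2 : ∀ i j, DifferentiableAt ℝ (pd j (comp φ i)) x := fun i j =>
    (contDiffAt_pd (contDiffAt_comp hφ i) j).differentiableAt (by simp)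
  have hev := fun i => (eventually_differentiableAt hu (by simp)).mp
    ((eventually_differentiableAt hφ (by simp)).mono fun y h2 h1 =>
      stokesField_apply (m := m) (p := p) h1 h2 i)
  have key := fun k : Fin 2 => (pd_congr (hev k) k).trans (pd_stokes_expression (m := m)
    ((hφ2 k 0).fun_add (hφ2 0 k)) ((hφ2 k 1).fun_add (hφ2 1 k)) ((hu2 k 0).fun_add (hu2 0 k))
    ((hu2 k 1).fun_add (hu2 1 k)) (hu1 0) (hu1 1) (hφ1 0) (hφ1 1) (hp.differentiableAt (by simp))
    (hφ1 k) k)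
  simp only [pd_add (hφ2 _ _) (hφ2 _ _), pd_add (hu2 _ _) (hu2 _ _)] at key
  rw [div_eq_pd ((contDiffAt_stokesField hu hp hφ).differentiableAt (by simp)), key, key,
    div_eq_pd (hφ.differentiableAt (by simp))]
  -- After expansion the products of first derivatives of `u` and `φ` cancel, since `(∇φ + ∇φᵀ) : ∇u
  -- = (∇u + ∇uᵀ) : ∇φ`.
  simp only [inner_plane, PiLp.add_apply, PiLp.sub_apply, PiLp.smul_apply, laplacian_apply hu,
    laplacian_apply hφ, matDiv_grad_transpose_apply hu, matDiv_grad_transpose_apply hφ,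
    gradient_apply, smul_eq_mul, comp]
  ring

/-! ### Regularity of curves -/

lemma IsC2JordanParam.contDiff_deriv {c : ℝ → Plane} {L : ℝ} (hc : IsC2JordanParam c L) :
    ContDiff ℝ 1 (deriv c) := by
  have : ContDiff ℝ (1 + 1) c := by exact_mod_cast hc.contDiff
  exact (contDiff_succ_iff_deriv.1 this).2.2

lemma IsC2JordanParam.contDiff_tangent {c : ℝ → Plane} {L : ℝ} (hc : IsC2JordanParam c L) :
    ContDiff ℝ 1 (tangent c) :=
  ((hc.contDiff_deriv.norm ℝ hc.regular).inv fun ξ => norm_ne_zero_iff.2 (hc.regular ξ)).smul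
    hc.contDiff_deriv

lemma continuous_plane {X : Type*} [TopologicalSpace X] {f : X → Plane}
    (hf : ∀ i, Continuous fun x => f x i) : Continuous f := by
  have := (PiLp.continuous_toLp 2 (fun _ : Fin 2 => ℝ)).comp (continuous_pi hf)
  exact this

lemma continuous_rot : Continuous rot :=
  continuous_plane fun i => by fin_cases i <;> simp <;> fun_prop

lemma IsC2JordanParam.continuous_deriv {c : ℝ → Plane} {L : ℝ} (hc : IsC2JordanParam c L) :
    Continuous (deriv c) := hc.contDiff_deriv.continuous

lemma IsC2JordanParam.continuous_leftNormal {c : ℝ → Plane} {L : ℝ} (hc : IsC2JordanParam c L) :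
    Continuous (leftNormal c) :=
  continuous_rot.comp hc.contDiff_tangent.continuous

lemma IsC2JordanParam.continuous_curvature {c : ℝ → Plane} {L : ℝ} (hc : IsC2JordanParam c L) :
    Continuous (curvature c) := by
  have h1 : Continuous (deriv (tangent c)) := hc.contDiff_tangent.continuous_deriv le_rfl
  have h2 : Continuous fun ξ => ‖deriv c ξ‖⁻¹ :=
    hc.continuous_deriv.norm.inv₀ fun ξ => norm_ne_zero_iff.2 (hc.regular ξ)
  exact (h2.smul h1).inner hc.continuous_leftNormal

/-! ### The distributions of the statement -/

lemma contDiff_two_of_test {D : TopologicalSpace.Opens Plane} {F : Type*} [NormedAddCommGroup F]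
    [NormedSpace ℝ F] (φ : 𝓓(D, F)) : ContDiff ℝ 2 φ :=
  φ.contDiff.of_le (WithTop.coe_le_coe.2 (le_top : (2 : ℕ∞) ≤ ⊤))

lemma comp_test {D : TopologicalSpace.Opens Plane} (φ : 𝓓(D, Plane)) (i : Fin 2) :
    comp φ i = testCoord i φ := rfl

lemma pd_test {D : TopologicalSpace.Opens Plane} (ψ : 𝓓(D, ℝ)) (j : Fin 2) :
    pd j ψ = testDeriv j ψ := by
  ext1 x
  rw [testDeriv_apply, pd]

lemma exists_curve_integral {D : TopologicalSpace.Opens Plane} {F : Type*} [NormedAddCommGroup F]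
    [NormedSpace ℝ F] {ι : Type*} [Fintype ι] {c : ℝ → Plane} {L : ℝ} (hL : 0 < L)
    (hc : IsC2JordanParam c L) (Λ : ι → 𝓓(D, F) →L[ℝ] 𝓓(D, ℝ)) {b : ι → ℝ → ℝ}
    (hb : ∀ i, Continuous (b i)) :
    ∃ T : 𝓓(D, F) →L[ℝ] ℝ, ∀ φ : 𝓓(D, F),
      T φ = arcIntegral c L fun ξ => ∑ i, b i ξ * Λ i φ (c ξ) := by
  obtain ⟨T, hT⟩ := exists_distribution (ν := volume.restrict (Ioc 0 L)) hc.continuous.measurable Λ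
    (b := fun i ξ => b i ξ * ‖deriv c ξ‖)
    fun i => ((hb i).mul hc.continuous_deriv.norm).integrableOn_Ioc
  refine ⟨T, fun φ => ?_⟩
  rw [hT, arcIntegral, intervalIntegral.integral_of_le hL.le]
  congr 1
  ext1 ξ
  rw [Finset.sum_mul]
  exact Finset.sum_congr rfl fun i _ => by ring

lemma exists_isCurveDelta (D : TopologicalSpace.Opens Plane) {c : ℝ → Plane} {L : ℝ} (hL : 0 < L)
    (hc : IsC2JordanParam c L) {k : ℝ → ℝ} (hk : Continuous k) {ν : ℝ → Plane}
    (hν : Continuous ν) : ∃ T : VectorDistribution D, IsCurveDelta c L k ν T := by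
  obtain ⟨T, hT⟩ := exists_curve_integral (D := D) hL hc testCoord
    (b := fun i ξ => k ξ * ν ξ i) fun i => by fun_prop
  refine ⟨T, fun φ => ?_⟩
  rw [hT]
  congr 1
  ext1 ξ
  simp only [Fin.sum_univ_two, testCoord_apply, inner_plane]
  ring

/-- The integrand is the sum of `wᵢ νⱼ (∂ⱼφᵢ + ∂ᵢφⱼ)` over all pairs of indices, with a continuous
coefficient for each pair. -/
lemma exists_curve_strain (D : TopologicalSpace.Opens Plane) {c : ℝ → Plane} {L : ℝ} (hL : 0 < L)
    (hc : IsC2JordanParam c L) {w ν : ℝ → Plane} (hw : Continuous w) (hν : Continuous ν) :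
    ∃ T : VectorDistribution D, ∀ φ : 𝓓(D, Plane),
      T φ = arcIntegral c L fun ξ => inner ℝ (w ξ) (act (symGrad φ (c ξ)) (ν ξ)) := by
  obtain ⟨T, hT⟩ := exists_curve_integral (D := D) hL hc
    (fun q : Fin 2 × Fin 2 => (testDeriv q.2).comp (testCoord q.1)
      + (testDeriv q.1).comp (testCoord q.2))
    (b := fun q ξ => w ξ q.1 * ν ξ q.2) fun i => by fun_prop
  refine ⟨T, fun φ => ?_⟩
  rw [hT]
  congr 1
  ext1 ξ
  have hd := (contDiff_two_of_test φ).differentiable (by simp) (c ξ)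
  simp only [Fintype.sum_prod_type, Fin.sum_univ_two, inner_plane, act_apply, symGrad_apply hd,
    comp_test, pd_test, add_apply, ContinuousLinearMap.comp_apply]
  ring

open Laplacian in
/-- The density of the bulk term of the Stokes functional, where `m` is the viscosity. -/
def stokesDensity (m : ℝ) (u : Plane → Plane) (p : Plane → ℝ) (φ : Plane → Plane) (x : Plane) : ℝ :=
  m * inner ℝ (u x) ((Δ φ) x + matDiv (fun y => (grad φ y).transpose) x) + p x * div φ x

/-- The density is linear in the three integrable coefficients `a u₀`, `a u₁` and `p`, each
multiplied by a differential operator applied to `φ`. -/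
lemma exists_bulk_distribution (D : TopologicalSpace.Opens Plane) {a : Plane → ℝ} {u : Plane → Plane}
    {p : Plane → ℝ} (hu : ∀ i, IntegrableOn (fun x => a x * u x i) D) (hp : IntegrableOn p D) :
    ∃ T : VectorDistribution D, ∀ φ : 𝓓(D, Plane),
      T φ = ∫ x in D, stokesDensity (a x) u p φ x := by
  have hb : ∀ i : Fin 3, Integrable (![fun x => a x * u x 0, fun x => a x * u x 1, p] i)
      (volume.restrict (D : Set Plane)) := by
    intro i
    fin_cases i
    · exact hu 0
    · exact hu 1
    · exact hp
  let Λ : Fin 2 → 𝓓(D, Plane) →L[ℝ] 𝓓(D, ℝ) := fun i =>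
    ((testDeriv 0).comp ((testDeriv 0).comp (testCoord i))
      + (testDeriv 1).comp ((testDeriv 1).comp (testCoord i)))
    + ((testDeriv 0).comp ((testDeriv i).comp (testCoord 0))
      + (testDeriv 1).comp ((testDeriv i).comp (testCoord 1)))
  obtain ⟨T, hT⟩ := exists_distribution (D := D) measurable_id ![Λ 0, Λ 1,
    (testDeriv 0).comp (testCoord 0) + (testDeriv 1).comp (testCoord 1)] hb
  refine ⟨T, fun φ => ?_⟩
  rw [hT]
  congr 1
  ext1 x
  have h2 := (contDiff_two_of_test φ).contDiffAt (x := x)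
  simp only [stokesDensity, inner_plane, PiLp.add_apply, laplacian_apply h2, matDiv_grad_transpose_apply h2,
    div_eq_pd (h2.differentiableAt (by simp)), comp_test, pd_test, Fin.sum_univ_three]
  simp [Λ]
  ring

lemma exists_isDistribDiv (D : TopologicalSpace.Opens Plane) {u : Plane → Plane}
    (hu : ∀ i, IntegrableOn (fun x => u x i) D) : ∃ T : 𝓓'(D, ℝ), IsDistribDiv u T := by
  obtain ⟨T, hT⟩ := exists_distribution (D := D) (F := ℝ) measurable_id (ν := volume.restrict D)
    (fun i => testDeriv i) (b := fun i x => -u x i) fun i => (hu i).neg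
  refine ⟨⟨T.toLinearMap, T.cont⟩, fun ψ => ?_⟩
  change T ψ = _
  rw [hT, ← integral_neg]
  congr 1
  ext1 x
  simp only [Fin.sum_univ_two, inner_plane, gradient_apply, pd_test, id]
  ring

section

/-! ### Green's formula in one domain -/

lemma continuous_act : Continuous fun q : Matrix (Fin 2) (Fin 2) ℝ × Plane => act q.1 q.2 :=
  continuous_plane fun i => by
    simp only [act_apply]
    fun_prop

lemma inner_act_comm {M : Matrix (Fin 2) (Fin 2) ℝ} (hM : M.IsSymm) (v w : Plane) :
    inner ℝ (act M v) w = inner ℝ v (act M w) := by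
  have : M 1 0 = M 0 1 := hM.apply 0 1
  simp only [inner_plane, act_apply, this]
  ring

lemma isSymm_symGrad (u : Plane → Plane) (x : Plane) : (symGrad u x).IsSymm := by
  rw [Matrix.IsSymm, symGrad, Matrix.transpose_add, Matrix.transpose_transpose, add_comm]

lemma continuous_pd {f : Plane → ℝ} (hf : ContDiff ℝ 2 f) (j : Fin 2) : Continuous (pd j f) :=
  continuous_iff_continuousAt.2 fun _ => (contDiffAt_pd hf.contDiffAt j).continuousAt

lemma contDiff_pd {f : Plane → ℝ} (hf : ContDiff ℝ 2 f) (j : Fin 2) : ContDiff ℝ 1 (pd j f) :=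
  contDiff_iff_contDiffAt.2 fun _ => contDiffAt_pd hf.contDiffAt j

lemma continuous_pd_one {f : Plane → ℝ} (hf : ContDiff ℝ 1 f) (j : Fin 2) :
    Continuous (pd j f) :=
  (hf.continuous_fderiv (by simp)).clm_apply continuous_const

lemma contDiff_comp {n : WithTop ℕ∞} {φ : Plane → Plane} (hφ : ContDiff ℝ n φ) (i : Fin 2) :
    ContDiff ℝ n (comp φ i) := (coord i).contDiff.comp hφ

lemma continuous_symGrad {φ : Plane → Plane} (hφ : ContDiff ℝ 2 φ) : Continuous (symGrad φ) := by
  refine continuous_matrix fun i j => ?_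
  simp only [symGrad_apply (hφ.differentiable (by simp) _)]
  exact (continuous_pd (contDiff_comp hφ i) j).add (continuous_pd (contDiff_comp hφ j) i)

lemma continuous_div {φ : Plane → Plane} (hφ : ContDiff ℝ 2 φ) : Continuous (div φ) := by
  have : div φ = fun x => pd 0 (comp φ 0) x + pd 1 (comp φ 1) x :=
    funext fun x => div_eq_pd (hφ.differentiable (by simp) x)
  rw [this]
  exact (continuous_pd (contDiff_comp hφ 0) 0).add (continuous_pd (contDiff_comp hφ 1) 1)

open Laplacian in
lemma continuous_laplacian_add_matDiv {φ : Plane → Plane} (hφ : ContDiff ℝ 2 φ) :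
    Continuous fun x => (Δ φ) x + matDiv (fun y => (grad φ y).transpose) x := by
  refine continuous_plane fun i => ?_
  simp only [PiLp.add_apply, laplacian_apply hφ.contDiffAt,
    matDiv_grad_transpose_apply hφ.contDiffAt]
  have h : ∀ i j k, Continuous (pd k (pd j (comp φ i))) := fun i j k =>
    continuous_pd_one (contDiff_pd (contDiff_comp hφ i) j) k
  exact ((h _ _ _).add (h _ _ _)).add ((h _ _ _).add (h _ _ _))

/-! ### Continuous extension to the closure and integrability in one domain -/

/-- The regularity of the velocity and the pressure in one of the domains. -/
structure IsFluidOn (O : Set Plane) (u : Plane → Plane) (p : Plane → ℝ) : Prop where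
  isOpen : IsOpen O
  isCompact_closure : IsCompact (closure O)
  continuousOn : ContinuousOn u (closure O)
  contDiffOn : ContDiffOn ℝ 2 u O
  contDiffOn_pressure : ContDiffOn ℝ 1 p O
  upToBoundary : IsCkUpToBoundary 1 O u
  upToBoundary_pressure : IsCkUpToBoundary 0 O p

namespace IsFluidOn

variable {O : Set Plane} {u : Plane → Plane} {p : Plane → ℝ}

lemma contDiffAt (H : IsFluidOn O u p) {x : Plane} (hx : x ∈ O) : ContDiffAt ℝ 2 u x :=
  H.contDiffOn.contDiffAt (H.isOpen.mem_nhds hx)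

lemma contDiffAt_pressure (H : IsFluidOn O u p) {x : Plane} (hx : x ∈ O) : ContDiffAt ℝ 1 p x :=
  H.contDiffOn_pressure.contDiffAt (H.isOpen.mem_nhds hx)

/-- The values of `p` on the boundary are unrelated to its limits from `O`, so boundary integrals
must use an extension from inside. The same applies to the gradient of `u` and to the stress. -/
lemma exists_pressure_extension (H : IsFluidOn O u p) :
    ∃ q : Plane → ℝ, ContinuousOn q (closure O) ∧ EqOn q p O := by
  obtain ⟨g, hg, hgp⟩ := H.upToBoundary_pressure.2 0 le_rfl
  refine ⟨fun x => g x 0, ?_, fun x hx => ?_⟩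
  · exact (ContinuousMultilinearMap.apply ℝ (fun _ : Fin 0 => Plane) ℝ
      0).continuous.comp_continuousOn hg
  · simp only
    rw [← hgp hx, iteratedFDeriv_zero_apply]

lemma exists_grad_extension (H : IsFluidOn O u p) :
    ∃ G : Plane → Matrix (Fin 2) (Fin 2) ℝ, ContinuousOn G (closure O) ∧ EqOn G (grad u) O := by
  obtain ⟨g, hg, hgu⟩ := H.upToBoundary.2 1 le_rfl
  refine ⟨fun x => Matrix.of fun i j => g x (fun _ => basisVec j) i, ?_, fun x hx => ?_⟩
  · refine continuousOn_pi.2 fun i => continuousOn_pi.2 fun j => ?_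
    exact ((coord i).continuous.comp (ContinuousMultilinearMap.apply ℝ (fun _ : Fin 1 => Plane) Plane
      (fun _ => basisVec j)).continuous).comp_continuousOn hg
  · ext i j
    simp only [Matrix.of_apply, grad]
    rw [← hgu hx, iteratedFDeriv_one_apply]

/-- The stress tensor extends continuously to the closure of the domain. -/
theorem exists_stress_extension (H : IsFluidOn O u p) (m : ℝ) :
    ∃ S : Plane → Matrix (Fin 2) (Fin 2) ℝ, ContinuousOn S (closure O) ∧
      EqOn S (stress m u p) O ∧ ∀ x, (S x).IsSymm := by
  obtain ⟨q, hq, hqp⟩ := H.exists_pressure_extension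
  obtain ⟨G, hG, hGu⟩ := H.exists_grad_extension
  -- This expression is symmetric whatever `G` is, hence also on the boundary, where
  -- `flux_greenField` uses the symmetry.
  refine ⟨fun x => -(q x) • (1 : Matrix (Fin 2) (Fin 2) ℝ) + m • (G x + (G x).transpose), ?_,
    fun x hx => ?_, fun x => ?_⟩
  · refine continuousOn_pi.2 fun i => continuousOn_pi.2 fun j => ?_
    have h1 := continuousOn_pi.1 (continuousOn_pi.1 hG i) j
    have h2 := continuousOn_pi.1 (continuousOn_pi.1 hG j) i
    exact (hq.neg.mul continuousOn_const).add (continuousOn_const.mul (h1.add h2))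
  · simp only [stress, symGrad, hqp hx, hGu hx]
  · simp only [Matrix.IsSymm, Matrix.transpose_add, Matrix.transpose_smul, Matrix.transpose_one,
      Matrix.transpose_transpose, add_comm]

lemma integrableOn_pressure (H : IsFluidOn O u p) : IntegrableOn p O := by
  obtain ⟨q, hq, hqp⟩ := H.exists_pressure_extension
  exact ((hq.integrableOn_compact H.isCompact_closure).mono_set subset_closure).congr_fun hqp
    H.isOpen.measurableSet

lemma integrableOn_velocity (H : IsFluidOn O u p) (i : Fin 2) : IntegrableOn (fun x => u x i) O :=
  (((coord i).continuous.comp_continuousOn H.continuousOn).integrableOn_compact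
    H.isCompact_closure).mono_set subset_closure

lemma integrableOn_stokesDensity (H : IsFluidOn O u p) (m : ℝ) {φ : Plane → Plane}
    (hφ : ContDiff ℝ 2 φ) : IntegrableOn (stokesDensity m u p φ) O := by
  obtain ⟨q, hq, hqp⟩ := H.exists_pressure_extension
  have hc : ContinuousOn (stokesDensity m u q φ) (closure O) :=
    (continuousOn_const.mul (H.continuousOn.inner
      (continuous_laplacian_add_matDiv hφ).continuousOn)).add (hq.mul (continuous_div hφ).continuousOn)
  refine ((hc.integrableOn_compact H.isCompact_closure).mono_set subset_closure).congr_fun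
    (fun x hx => ?_) H.isOpen.measurableSet
  simp only [stokesDensity, hqp hx]

end IsFluidOn

open Laplacian in
/-- The divergence `m (Δ u + ∇ · (∇ u)ᵀ) - ∇ p` of the stress tensor. -/
def stressDiv (m : ℝ) (u : Plane → Plane) (p : Plane → ℝ) (x : Plane) : Plane :=
  m • ((Δ u) x + matDiv (fun y => (grad u y).transpose) x) - gradient p x

lemma fderiv_eq_zero_of_notMem_tsupport {φ : Plane → Plane} {x : Plane} (hx : x ∉ tsupport φ) :
    fderiv ℝ φ x = 0 :=
  image_eq_zero_of_notMem_tsupport fun h => hx (tsupport_fderiv_subset ℝ h)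

lemma symGrad_eq_zero_of_notMem_tsupport {φ : Plane → Plane} {x : Plane} (hx : x ∉ tsupport φ) :
    symGrad φ x = 0 := by
  ext i j
  simp [symGrad, grad, fderiv_eq_zero_of_notMem_tsupport hx]

lemma act_zero_left (v : Plane) : act 0 v = 0 := by ext i; simp [act_apply]

lemma act_zero_right (M : Matrix (Fin 2) (Fin 2) ℝ) : act M 0 = 0 := by ext i; simp [act_apply]

/-- The field of Green's formula, with an extension `S` of the stress to the boundary. -/
def greenField (m : ℝ) (u : Plane → Plane) (S : Plane → Matrix (Fin 2) (Fin 2) ℝ)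
    (φ : Plane → Plane) (x : Plane) : Plane := m • act (symGrad φ x) (u x) - act (S x) (φ x)

variable {O : Set Plane} {u : Plane → Plane} {p : Plane → ℝ}

lemma greenField_eventuallyEq (hO : IsOpen O) {m : ℝ} {S : Plane → Matrix (Fin 2) (Fin 2) ℝ}
    (hS : EqOn S (stress m u p) O) (φ : Plane → Plane) {x : Plane} (hx : x ∈ O) :
    greenField m u S φ =ᶠ[𝓝 x] stokesField m u p φ := by
  filter_upwards [hO.mem_nhds hx] with y hy
  rw [greenField, stokesField, hS hy]

lemma IsFluidOn.div_greenField (H : IsFluidOn O u p) {m : ℝ}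
    {S : Plane → Matrix (Fin 2) (Fin 2) ℝ} (hS : EqOn S (stress m u p) O) {φ : Plane → Plane}
    (hφ : ContDiff ℝ 2 φ) {x : Plane} (hx : x ∈ O) :
    div (greenField m u S φ) x = stokesDensity m u p φ x - inner ℝ (stressDiv m u p x) (φ x) := by
  rw [show div (greenField m u S φ) x = div (stokesField m u p φ) x by
    rw [div_eq, div_eq, (greenField_eventuallyEq H.isOpen hS φ hx).fderiv_eq]]
  exact div_stokesField (H.contDiffAt hx) (H.contDiffAt_pressure hx) hφ.contDiffAt

/-- Only `hint` controls the second derivatives of `u` near the boundary; the other part of the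
divergence extends continuously to the compact closure. -/
lemma IsFluidOn.isFluxField_greenField (H : IsFluidOn O u p) {m : ℝ}
    {S : Plane → Matrix (Fin 2) (Fin 2) ℝ} (hSc : ContinuousOn S (closure O))
    (hS : EqOn S (stress m u p) O) {φ : Plane → Plane} (hφ : ContDiff ℝ 2 φ)
    (hint : IntegrableOn (fun x => inner ℝ (stressDiv m u p x) (φ x)) O) :
    IsFluxField O (tsupport φ) (greenField m u S φ) where
  continuousOn :=
    ((continuous_act.comp_continuousOn ((continuous_symGrad hφ).continuousOn.prodMk
      H.continuousOn)).const_smul m).sub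
      (continuous_act.comp_continuousOn (hSc.prodMk hφ.continuous.continuousOn))
  contDiffOn x hx := ((contDiffAt_stokesField (H.contDiffAt hx) (H.contDiffAt_pressure hx)
    hφ.contDiffAt).congr_of_eventuallyEq
      (greenField_eventuallyEq H.isOpen hS φ hx)).contDiffWithinAt
  integrableOn := ((H.integrableOn_stokesDensity m hφ).sub hint).congr_fun
    (fun _ hx => (H.div_greenField hS hφ hx).symm) H.isOpen.measurableSet
  eq_zero x hx := by
    rw [greenField, symGrad_eq_zero_of_notMem_tsupport hx, image_eq_zero_of_notMem_tsupport hx,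
      act_zero_left, act_zero_right, smul_zero, sub_zero]

lemma IsFluidOn.integral_stokesDensity (H : IsFluidOn O u p) {m : ℝ}
    {S : Plane → Matrix (Fin 2) (Fin 2) ℝ} (hS : EqOn S (stress m u p) O) {φ : Plane → Plane}
    (hφ : ContDiff ℝ 2 φ) (hint : IntegrableOn (fun x => inner ℝ (stressDiv m u p x) (φ x)) O) :
    ∫ x in O, stokesDensity m u p φ x =
      (∫ x in O, inner ℝ (stressDiv m u p x) (φ x)) + ∫ x in O, div (greenField m u S φ) x := by
  rw [setIntegral_congr_fun H.isOpen.measurableSet fun x hx => H.div_greenField hS hφ hx,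
    integral_sub (H.integrableOn_stokesDensity m hφ) hint]
  ring

lemma cross_deriv_eq {c : ℝ → Plane} {ξ : ℝ} (hc : deriv c ξ ≠ 0) (v : Plane) :
    cross (deriv c ξ) v = inner ℝ v (leftNormal c ξ) * ‖deriv c ξ‖ := by
  rw [← inner_rot_right, leftNormal, tangent, rot_smul, inner_smul_right]
  field_simp [norm_ne_zero_iff.2 hc]

lemma arcIntegral_sub {c : ℝ → Plane} {L : ℝ} (hc : IsC2JordanParam c L) {f g : ℝ → ℝ}
    (hf : Continuous f) (hg : Continuous g) :
    arcIntegral c L (fun ξ => f ξ - g ξ) = arcIntegral c L f - arcIntegral c L g := by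
  have h {f : ℝ → ℝ} (hf : Continuous f) :
      IntervalIntegrable (fun ξ => f ξ * ‖deriv c ξ‖) volume 0 L :=
    (hf.mul hc.continuous_deriv.norm).intervalIntegrable _ _
  simp only [arcIntegral, sub_mul]
  exact intervalIntegral.integral_sub (h hf) (h hg)

lemma arcIntegral_const_mul (c : ℝ → Plane) (L a : ℝ) (f : ℝ → ℝ) :
    arcIntegral c L (fun ξ => a * f ξ) = a * arcIntegral c L f := by
  rw [arcIntegral, arcIntegral, ← intervalIntegral.integral_const_mul]
  simp only [mul_assoc]

/-- The flux of the field of Green's formula through a curve. -/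
lemma flux_greenField {c : ℝ → Plane} {L : ℝ} (hc : IsC2JordanParam c L) {s : Set Plane}
    (hs : range c ⊆ s) (hu : ContinuousOn u s) (m : ℝ) {S : Plane → Matrix (Fin 2) (Fin 2) ℝ}
    (hSc : ContinuousOn S s) (hS : ∀ x, (S x).IsSymm) {φ : Plane → Plane} (hφ : ContDiff ℝ 2 φ) :
    flux c L (greenField m u S φ) =
      m * arcIntegral c L (fun ξ => inner ℝ (u (c ξ)) (act (symGrad φ (c ξ)) (leftNormal c ξ)))
        - arcIntegral c L (fun ξ => inner ℝ (act (S (c ξ)) (leftNormal c ξ)) (φ (c ξ))) := by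
  have h1 : Continuous fun ξ => u (c ξ) := continuous_comp_curve hc hs hu
  have h2 : Continuous fun ξ => S (c ξ) :=
    hSc.comp_continuous hc.continuous fun ξ => hs (mem_range_self ξ)
  have h3 : Continuous fun ξ => symGrad φ (c ξ) := (continuous_symGrad hφ).comp hc.continuous
  have hf : Continuous fun ξ =>
      m * inner ℝ (u (c ξ)) (act (symGrad φ (c ξ)) (leftNormal c ξ)) :=
    (h1.inner (continuous_act.comp (h3.prodMk hc.continuous_leftNormal))).const_mul m
  have hg : Continuous fun ξ => inner ℝ (act (S (c ξ)) (leftNormal c ξ)) (φ (c ξ)) :=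
    (continuous_act.comp (h2.prodMk hc.continuous_leftNormal)).inner
      (hφ.continuous.comp hc.continuous)
  rw [← arcIntegral_const_mul, ← arcIntegral_sub hc hf hg, flux, arcIntegral]
  congr 1
  ext1 ξ
  -- Strain and stress are symmetric, so both matrices can be moved onto the normal.
  rw [cross_deriv_eq (hc.regular ξ), greenField, inner_sub_left, real_inner_smul_left,
    inner_act_comm (isSymm_symGrad φ (c ξ)), inner_act_comm (hS (c ξ)),
    real_inner_comm (φ (c ξ)) (act (S (c ξ)) (leftNormal c ξ))]

end

/-! ### The weak form of the two-fluid problem -/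

/-- A velocity and a pressure of the regularity required in the two-fluid problem. -/
structure IsLayeredFluid (D Ω₁ Ω₂ Ω₃ : Set Plane) (Γ : ℝ → Plane) (h : ℝ → ℝ) (L ε : ℝ)
    (u : Plane → Plane) (p : Plane → ℝ) : Prop where
  layer : IsThinLayer D Ω₁ Ω₂ Ω₃ Γ h L ε
  continuousOn : ContinuousOn u (closure D)
  fluid₁ : IsFluidOn Ω₁ u p
  fluid₂ : IsFluidOn Ω₂ u p
  fluid₃ : IsFluidOn Ω₃ u p

theorem IsThinLayer.isLayeredFluid {D Ω₁ Ω₂ Ω₃ : Set Plane} {Γ : ℝ → Plane} {h : ℝ → ℝ} {L ε : ℝ}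
    {u : Plane → Plane} {p : Plane → ℝ} (G : IsThinLayer D Ω₁ Ω₂ Ω₃ Γ h L ε)
    (hu_C2 : ContDiffOn ℝ 2 u (Ω₁ ∪ Ω₂ ∪ Ω₃)) (hu_cont : ContinuousOn u (closure D))
    (hu_X : MemX 1 ![Ω₁, Ω₂, Ω₃] u) (hp_C1 : ContDiffOn ℝ 1 p (Ω₁ ∪ Ω₂ ∪ Ω₃))
    (hp_X : MemX 0 ![Ω₁, Ω₂, Ω₃] p) : IsLayeredFluid D Ω₁ Ω₂ Ω₃ Γ h L ε u p := by
  have key (j : Fin 3) (hO : IsOpen (![Ω₁, Ω₂, Ω₃] j)) (hD : ![Ω₁, Ω₂, Ω₃] j ⊆ D)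
      (hU : ![Ω₁, Ω₂, Ω₃] j ⊆ Ω₁ ∪ Ω₂ ∪ Ω₃) : IsFluidOn (![Ω₁, Ω₂, Ω₃] j) u p :=
    { isOpen := hO
      isCompact_closure :=
        G.isCompact_closure_D.of_isClosed_subset isClosed_closure (closure_mono hD)
      continuousOn := hu_cont.mono (closure_mono hD)
      contDiffOn := hu_C2.mono hU
      contDiffOn_pressure := hp_C1.mono hU
      upToBoundary := hu_X.2 j
      upToBoundary_pressure := hp_X.2 j }
  exact ⟨G, hu_cont, key 0 G.isOpen₁ G.subset₁ fun x hx => Or.inl (Or.inl hx),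
    key 1 G.isOpen₂ G.subset₂ fun x hx => Or.inl (Or.inr hx),
    key 2 G.isOpen₃ G.subset₃ fun x hx => Or.inr hx⟩

/-! ### The divergence of the velocity tested with scalar functions -/

lemma IsFluidOn.continuousOn_div {O : Set Plane} {u : Plane → Plane} {p : Plane → ℝ}
    (H : IsFluidOn O u p) : ContinuousOn (div u) O := by
  obtain ⟨G, hG, hGu⟩ := H.exists_grad_extension
  refine ContinuousOn.congr (f := fun x => (G x).trace)
    ((continuous_id.matrix_trace.comp_continuousOn hG).mono subset_closure) fun x hx => ?_
  simp only [div, hGu hx]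

lemma IsFluidOn.integrableOn_mul_div {O : Set Plane} {u : Plane → Plane} {p : Plane → ℝ}
    (H : IsFluidOn O u p) {ψ : Plane → ℝ} (hψ : Continuous ψ) :
    IntegrableOn (fun x => ψ x * div u x) O := by
  obtain ⟨G, hG, hGu⟩ := H.exists_grad_extension
  have hc : ContinuousOn (fun x => ψ x * (G x).trace) (closure O) :=
    hψ.continuousOn.mul (continuous_id.matrix_trace.comp_continuousOn hG)
  refine ((hc.integrableOn_compact H.isCompact_closure).mono_set subset_closure).congr_fun
    (fun x hx => ?_) H.isOpen.measurableSet
  simp only [div, hGu hx]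

lemma IsFluidOn.div_smul {O : Set Plane} {u : Plane → Plane} {p : Plane → ℝ}
    (H : IsFluidOn O u p) {ψ : Plane → ℝ} (hψ : ContDiff ℝ 1 ψ) {x : Plane} (hx : x ∈ O) :
    div (fun y => ψ y • u y) x = ψ x * div u x + inner ℝ (u x) (gradient ψ x) := by
  rw [ThinLayer.div_smul (hψ.differentiable (by simp) x)
    ((H.contDiffAt hx).differentiableAt (by simp)), inner_gradient]

lemma continuous_gradient {ψ : Plane → ℝ} (hψ : ContDiff ℝ 1 ψ) : Continuous (gradient ψ) :=
  (InnerProductSpace.toDual ℝ Plane).symm.continuous.comp (hψ.continuous_fderiv (by simp))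

lemma IsFluidOn.integrableOn_inner_gradient {O : Set Plane} {u : Plane → Plane} {p : Plane → ℝ}
    (H : IsFluidOn O u p) {ψ : Plane → ℝ} (hψ : ContDiff ℝ 1 ψ) :
    IntegrableOn (fun x => inner ℝ (u x) (gradient ψ x)) O :=
  ((H.continuousOn.inner (continuous_gradient hψ).continuousOn).integrableOn_compact
    H.isCompact_closure).mono_set subset_closure

lemma IsFluidOn.isFluxField_smul {O : Set Plane} {u : Plane → Plane} {p : Plane → ℝ}
    (H : IsFluidOn O u p) {ψ : Plane → ℝ} (hψ : ContDiff ℝ 1 ψ) :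
    IsFluxField O (tsupport ψ) fun x => ψ x • u x where
  continuousOn := hψ.continuous.continuousOn.smul H.continuousOn
  contDiffOn := hψ.contDiffOn.smul (H.contDiffOn.of_le (by norm_num))
  integrableOn := ((H.integrableOn_mul_div hψ.continuous).add
    (H.integrableOn_inner_gradient hψ)).congr_fun (fun _ hx => (H.div_smul hψ hx).symm)
      H.isOpen.measurableSet
  eq_zero x hx := by rw [image_eq_zero_of_notMem_tsupport hx, zero_smul]

lemma IsFluidOn.integral_inner_gradient {O : Set Plane} {u : Plane → Plane} {p : Plane → ℝ}
    (H : IsFluidOn O u p) {ψ : Plane → ℝ} (hψ : ContDiff ℝ 1 ψ) :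
    ∫ x in O, inner ℝ (u x) (gradient ψ x) =
      (∫ x in O, div (fun y => ψ y • u y) x) - ∫ x in O, ψ x * div u x := by
  rw [setIntegral_congr_fun H.isOpen.measurableSet fun x hx => H.div_smul hψ hx,
    integral_add (H.integrableOn_mul_div hψ.continuous) (H.integrableOn_inner_gradient hψ)]
  ring

namespace IsLayeredFluid

variable {D Ω₁ Ω₂ Ω₃ : Set Plane} {Γ : ℝ → Plane} {h : ℝ → ℝ} {L ε : ℝ}
  {u : Plane → Plane} {p : Plane → ℝ}

/-- The distributional divergence of the velocity has no singular part. -/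
theorem integral_inner_gradient (H : IsLayeredFluid D Ω₁ Ω₂ Ω₃ Γ h L ε u p) {ψ : Plane → ℝ}
    (hψ : ContDiff ℝ 1 ψ) (hψc : HasCompactSupport ψ) (hψD : tsupport ψ ⊆ D) :
    -∫ x in D, inner ℝ (u x) (gradient ψ x) =
      (∫ x in Ω₁, ψ x * div u x) + (∫ x in Ω₂, ψ x * div u x) + ∫ x in Ω₃, ψ x * div u x := by
  rw [H.layer.setIntegral_eq_add (H.fluid₁.integrableOn_inner_gradient hψ)
    (H.fluid₂.integrableOn_inner_gradient hψ) (H.fluid₃.integrableOn_inner_gradient hψ),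
    H.fluid₁.integral_inner_gradient hψ, H.fluid₂.integral_inner_gradient hψ,
    H.fluid₃.integral_inner_gradient hψ,
    H.layer.integral_div₁ hψc hψD (H.fluid₁.isFluxField_smul hψ),
    H.layer.integral_div₂ hψc (H.fluid₂.isFluxField_smul hψ),
    H.layer.integral_div₃ hψc hψD (H.fluid₃.isFluxField_smul hψ)]
  -- Each curve is counted from both sides with opposite signs and with the same continuous field `ψ
  -- u`, so all fluxes cancel.
  ring

/-- Green's formula for the Stokes functional. -/
theorem stokesFunctional_eq (H : IsLayeredFluid D Ω₁ Ω₂ Ω₃ Γ h L ε u p) {μ μ₂ : ℝ}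
    {S₁ S₂ S₃ : Plane → Matrix (Fin 2) (Fin 2) ℝ}
    (hc₁ : ContinuousOn S₁ (closure Ω₁)) (hs₁ : EqOn S₁ (stress μ u p) Ω₁)
    (hS₁ : ∀ x, (S₁ x).IsSymm)
    (hc₂ : ContinuousOn S₂ (closure Ω₂)) (hs₂ : EqOn S₂ (stress μ₂ u p) Ω₂)
    (hS₂ : ∀ x, (S₂ x).IsSymm)
    (hc₃ : ContinuousOn S₃ (closure Ω₃)) (hs₃ : EqOn S₃ (stress μ u p) Ω₃)
    (hS₃ : ∀ x, (S₃ x).IsSymm)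
    {φ : Plane → Plane} (hφ : ContDiff ℝ 2 φ) (hφc : HasCompactSupport φ) (hφD : tsupport φ ⊆ D)
    (hi₁ : IntegrableOn (fun x => inner ℝ (stressDiv μ u p x) (φ x)) Ω₁)
    (hi₂ : IntegrableOn (fun x => inner ℝ (stressDiv μ₂ u p x) (φ x)) Ω₂)
    (hi₃ : IntegrableOn (fun x => inner ℝ (stressDiv μ u p x) (φ x)) Ω₃) :
    stokesFunctional D Ω₂ Γ (innerCurve Γ h ε) L μ μ₂ u p φ =
      (∫ x in Ω₁, inner ℝ (stressDiv μ u p x) (φ x))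
      + (∫ x in Ω₂, inner ℝ (stressDiv μ₂ u p x) (φ x))
      + (∫ x in Ω₃, inner ℝ (stressDiv μ u p x) (φ x))
      + arcIntegral Γ L
        (fun ξ => inner ℝ (act (S₃ (Γ ξ) - S₂ (Γ ξ)) (leftNormal Γ ξ)) (φ (Γ ξ)))
      + arcIntegral (innerCurve Γ h ε) L
        (fun ξ => inner ℝ (act (S₂ (innerCurve Γ h ε ξ) - S₁ (innerCurve Γ h ε ξ))
          (leftNormal (innerCurve Γ h ε) ξ)) (φ (innerCurve Γ h ε ξ))) := by
  have G := H.layer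
  set γ := innerCurve Γ h ε with hγ
  have e₁ : EqOn (stokesDensity μ u p φ)
      (fun x => stokesDensity (viscosity Ω₂ μ μ₂ x) u p φ x) Ω₁ := fun x hx => by
    simp only [viscosity, if_neg fun h2 => disjoint_left.1 G.disjoint₁₂ hx h2]
  have e₂ : EqOn (stokesDensity μ₂ u p φ)
      (fun x => stokesDensity (viscosity Ω₂ μ μ₂ x) u p φ x) Ω₂ := fun x hx => by
    simp only [viscosity, if_pos hx]
  have e₃ : EqOn (stokesDensity μ u p φ)
      (fun x => stokesDensity (viscosity Ω₂ μ μ₂ x) u p φ x) Ω₃ := fun x hx => by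
    simp only [viscosity, if_neg fun h2 => disjoint_left.1 G.disjoint₂₃ h2 hx]
  have bulk : ∫ x in D, stokesDensity (viscosity Ω₂ μ μ₂ x) u p φ x =
      (∫ x in Ω₁, stokesDensity μ u p φ x) + (∫ x in Ω₂, stokesDensity μ₂ u p φ x)
        + ∫ x in Ω₃, stokesDensity μ u p φ x := by
    rw [G.setIntegral_eq_add
      ((H.fluid₁.integrableOn_stokesDensity μ hφ).congr_fun e₁ G.isOpen₁.measurableSet)
      ((H.fluid₂.integrableOn_stokesDensity μ₂ hφ).congr_fun e₂ G.isOpen₂.measurableSet)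
      ((H.fluid₃.integrableOn_stokesDensity μ hφ).congr_fun e₃ G.isOpen₃.measurableSet),
      setIntegral_congr_fun G.isOpen₁.measurableSet e₁,
      setIntegral_congr_fun G.isOpen₂.measurableSet e₂,
      setIntegral_congr_fun G.isOpen₃.measurableSet e₃]
  have cont {c : ℝ → Plane} (hc : IsC2JordanParam c L) {s : Set Plane} (hs : range c ⊆ s)
      {S : Plane → Matrix (Fin 2) (Fin 2) ℝ} (hS : ContinuousOn S s) :
      Continuous fun ξ => inner ℝ (act (S (c ξ)) (leftNormal c ξ)) (φ (c ξ)) :=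
    (continuous_act.comp ((hS.comp_continuous hc.continuous fun ξ =>
      hs (mem_range_self ξ)).prodMk hc.continuous_leftNormal)).inner
        (hφ.continuous.comp hc.continuous)
  have act_sub (A B : Matrix (Fin 2) (Fin 2) ℝ) (v w : Plane) :
      inner ℝ (act (A - B) v) w = inner ℝ (act A v) w - inner ℝ (act B v) w := by
    simp only [inner_plane, act_apply, Matrix.sub_apply]
    ring
  -- The functional uses the outer normal `-𝔸 τ_ε` of `Ω₂` on the inner curve, whereas the fluxes
  -- are expressed with `𝔸 τ_ε`.
  have neg_normal : arcIntegral γ L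
      (fun ξ => inner ℝ (u (γ ξ)) (act (symGrad φ (γ ξ)) (-leftNormal γ ξ))) =
      -arcIntegral γ L
        (fun ξ => inner ℝ (u (γ ξ)) (act (symGrad φ (γ ξ)) (leftNormal γ ξ))) := by
    rw [← neg_one_mul, ← arcIntegral_const_mul]
    congr 1
    ext1 ξ
    simp only [inner_plane, act_apply, PiLp.neg_apply]
    ring
  have r₁ := G.range_inner_subset_closure₁
  have r₂ := G.range_inner_subset_closure₂
  have q₂ := G.range_outer_subset_closure₂
  have q₃ := G.range_outer_subset_closure₃
  have jγ := G.inner_param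
  have jΓ := G.outer_param
  simp only [act_sub]
  rw [arcIntegral_sub jΓ (cont jΓ q₃ hc₃) (cont jΓ q₂ hc₂),
    arcIntegral_sub jγ (cont jγ r₂ hc₂) (cont jγ r₁ hc₁), stokesFunctional, neg_normal]
  change (∫ x in D, stokesDensity (viscosity Ω₂ μ μ₂ x) u p φ x) + _ + _ = _
  rw [bulk, H.fluid₁.integral_stokesDensity hs₁ hφ hi₁, H.fluid₂.integral_stokesDensity hs₂ hφ hi₂,
    H.fluid₃.integral_stokesDensity hs₃ hφ hi₃,
    G.integral_div₁ hφc hφD (H.fluid₁.isFluxField_greenField hc₁ hs₁ hφ hi₁),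
    G.integral_div₂ hφc (H.fluid₂.isFluxField_greenField hc₂ hs₂ hφ hi₂),
    G.integral_div₃ hφc hφD (H.fluid₃.isFluxField_greenField hc₃ hs₃ hφ hi₃),
    flux_greenField jγ r₁ H.fluid₁.continuousOn μ hc₁ hS₁ hφ,
    flux_greenField jΓ q₂ H.fluid₂.continuousOn μ₂ hc₂ hS₂ hφ,
    flux_greenField jγ r₂ H.fluid₂.continuousOn μ₂ hc₂ hS₂ hφ,
    flux_greenField jΓ q₃ H.fluid₃.continuousOn μ hc₃ hS₃ hφ]
  -- On `Γ` the strain integral has the coefficients `μ₂` from `Ω₂`, `-μ` from `Ω₃` and `μ - μ₂`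
  -- from the functional. On the inner curve they are `μ` from `Ω₁`, `-μ₂` from `Ω₂` and `-(μ -
  -- μ₂)`. Both sums are zero, and the stress jumps survive.
  ring

end IsLayeredFluid

/-! ### Localization by test functions -/

lemma tangent_periodic {c : ℝ → Plane} {L : ℝ} (hc : IsC2JordanParam c L) :
    Function.Periodic (tangent c) L := fun ξ => by simp only [tangent, hc.deriv_periodic ξ]

lemma leftNormal_periodic {c : ℝ → Plane} {L : ℝ} (hc : IsC2JordanParam c L) :
    Function.Periodic (leftNormal c) L := fun ξ => by
  simp only [leftNormal, tangent_periodic hc ξ]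

lemma curvature_periodic {c : ℝ → Plane} {L : ℝ} (hc : IsC2JordanParam c L) :
    Function.Periodic (curvature c) L := fun ξ => by
  have h : deriv (tangent c) (ξ + L) = deriv (tangent c) ξ := by
    rw [← deriv_comp_add_const, show (fun x => tangent c (x + L)) = tangent c from
      funext (tangent_periodic hc)]
  simp only [curvature, leftNormal_periodic hc ξ, hc.deriv_periodic ξ, h]

/-- A continuous density on a Jordan curve which does not vanish at some point is detected by
a test function supported near that point. -/
theorem exists_test_arcIntegral_pos {c : ℝ → Plane} {L : ℝ} (hc : IsC2JordanParam c L) (hL : 0 < L)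
    {w : ℝ → Plane} (hw : Continuous w) (hwp : Function.Periodic w L) {ξ₀ : ℝ} (h0 : w ξ₀ ≠ 0)
    {V : Set Plane} (hV : V ∈ 𝓝 (c ξ₀)) :
    ∃ φ : Plane → Plane, tsupport φ ⊆ V ∧ HasCompactSupport φ ∧ ContDiff ℝ (⊤ : ℕ∞) φ ∧
      0 < arcIntegral c L fun ξ => inner ℝ (w ξ) (φ (c ξ)) := by
  have hpos : 0 < inner ℝ (w ξ₀) (w ξ₀) := real_inner_self_pos.2 h0
  obtain ⟨δ, hδ, hδw⟩ := Metric.eventually_nhds_iff.1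
    ((hw.inner continuous_const).continuousAt.eventually (lt_mem_nhds hpos))
  -- On this part of a period the inner product of `w ξ` and `w ξ₀` may fail to be positive. Its
  -- image is compact and misses `c ξ₀`, so a bump at `c ξ₀` can vanish on it, which makes the
  -- integrand nonnegative.
  set K : Set ℝ := Icc (ξ₀ - L / 2) (ξ₀ - L / 2 + L) \ Metric.ball ξ₀ δ with hKdef
  have hK : IsCompact (c '' K) :=
    (isCompact_Icc.diff Metric.isOpen_ball).image hc.continuous
  have h0K : c ξ₀ ∉ c '' K := by
    rintro ⟨ξ, hξ, h⟩
    have hlt : |ξ - ξ₀| < L := by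
      rw [abs_lt]; constructor <;> linarith [hξ.1.1, hξ.1.2]
    exact hξ.2 (by rw [hc.eq_of_abs_sub_lt hL h hlt]; exact Metric.mem_ball_self hδ)
  obtain ⟨g, hgs, hgc, hg, hgr, hg1⟩ := exists_contDiff_tsupport_subset (n := ⊤)
    (inter_mem hV (hK.isClosed.isOpen_compl.mem_nhds h0K))
  have hg0 : ∀ x, 0 ≤ g x := fun x => (hgr (mem_range_self x)).1
  refine ⟨fun x => g x • w ξ₀, (tsupport_smul_subset_left g _).trans (hgs.trans inter_subset_left),
    hgc.smul_right, hg.smul contDiff_const, ?_⟩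
  set f : ℝ → ℝ := fun ξ => inner ℝ (w ξ) (g (c ξ) • w ξ₀) * ‖deriv c ξ‖ with hf
  have hfc : Continuous f := (hw.inner ((hg.continuous.comp hc.continuous).smul
    continuous_const)).mul hc.continuous_deriv.norm
  have hfp : Function.Periodic f L := fun ξ => by
    simp only [hf, hwp ξ, hc.periodic ξ, hc.deriv_periodic ξ]
  have hperiod := hfp.intervalIntegral_add_eq 0 (ξ₀ - L / 2)
  rw [zero_add] at hperiod
  rw [arcIntegral]
  change 0 < ∫ ξ in (0 : ℝ)..L, f ξ
  rw [hperiod]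
  refine intervalIntegral.integral_pos (by linarith) hfc.continuousOn (fun ξ hξ => ?_)
    ⟨ξ₀, ⟨by linarith, by linarith⟩, ?_⟩
  · simp only [hf, inner_smul_right]
    by_cases hb : ξ ∈ Metric.ball ξ₀ δ
    · have h1 := hδw hb
      have h2 := hg0 (c ξ)
      positivity
    · have : g (c ξ) = 0 := image_eq_zero_of_notMem_tsupport fun h =>
        (hgs h).2 (mem_image_of_mem c ⟨Ioc_subset_Icc_self hξ, hb⟩)
      rw [this, zero_mul, zero_mul]
  · simp only [hf, inner_smul_right, hg1, one_mul]
    exact mul_pos hpos (norm_pos_iff.2 (hc.regular ξ₀))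

/-- The fundamental lemma of the calculus of variations for continuous functions. -/
lemma eqOn_zero_of_integral_test {O : Set Plane} (hO : IsOpen O) {f : Plane → ℝ}
    (hf : ContinuousOn f O)
    (h : ∀ g : Plane → ℝ, ContDiff ℝ (⊤ : ℕ∞) g → HasCompactSupport g → tsupport g ⊆ O →
      ∫ x in O, g x * f x = 0) : ∀ x ∈ O, f x = 0 := by
  have hae := hO.ae_eq_zero_of_integral_contDiff_smul_eq_zero
    (hf.locallyIntegrableOn (μ := volume) hO.measurableSet) fun g hg hgc hgO => by
      rw [← h g hg hgc hgO, setIntegral_eq_integral_of_forall_compl_eq_zero]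
      · rfl
      · intro x hx
        rw [image_eq_zero_of_notMem_tsupport fun hx' => hx (hgO hx'), zero_mul]
  exact Measure.eqOn_open_of_ae_eq (g := fun _ => (0 : ℝ))
    ((ae_restrict_iff' hO.measurableSet).2 hae) hO hf continuousOn_const

/-- The product of a function which is continuous in an open set with a compactly supported
continuous function is integrable there. -/
lemma integrableOn_mul_of_tsupport_subset {O : Set Plane} (hO : IsOpen O) {f g : Plane → ℝ}
    (hf : ContinuousOn f O) (hg : Continuous g) (hgc : HasCompactSupport g) (hgO : tsupport g ⊆ O) :
    IntegrableOn (fun x => g x * f x) O := by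
  have h1 : IntegrableOn (fun x => g x * f x) (tsupport g) :=
    (hg.continuousOn.mul (hf.mono hgO)).integrableOn_compact hgc
  refine h1.of_forall_sdiff_eq_zero hO.measurableSet fun x hx => ?_
  rw [image_eq_zero_of_notMem_tsupport hx.2, zero_mul]

/-! ### Equivalence of the two formulations -/

lemma continuousAt_pd {f : Plane → ℝ} {x : Plane} (hf : ContDiffAt ℝ 1 f x) (j : Fin 2) :
    ContinuousAt (pd j f) x :=
  (hf.fderiv_right (m := 0) (by simp)).continuousAt.clm_apply continuousAt_const

lemma IsFluidOn.continuousOn_stressDiv {O : Set Plane} {u : Plane → Plane} {p : Plane → ℝ}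
    (H : IsFluidOn O u p) (m : ℝ) (i : Fin 2) : ContinuousOn (fun x => stressDiv m u p x i) O := by
  have h (i j k : Fin 2) : ContinuousOn (pd k (pd j (comp u i))) O := fun x hx =>
    (continuousAt_pd (contDiffAt_pd (contDiffAt_comp (H.contDiffAt hx) i) j) k).continuousWithinAt
  have hp : ContinuousOn (pd i p) O := fun x hx =>
    (continuousAt_pd (H.contDiffAt_pressure hx) i).continuousWithinAt
  refine ((continuousOn_const (c := m)).mul (((h i 0 0).add (h i 1 1)).add
    ((h 0 i 0).add (h 1 i 1)))).sub hp |>.congr fun x hx => ?_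
  simp [stressDiv, laplacian_apply (H.contDiffAt hx), matDiv_grad_transpose_apply (H.contDiffAt hx),
    gradient_apply, mul_add]

open Laplacian in
lemma IsFluidOn.stressDiv_eq_zero_iff {O : Set Plane} {u : Plane → Plane} {p : Plane → ℝ}
    (H : IsFluidOn O u p) (m : ℝ) (hdiv : ∀ x ∈ O, div u x = 0) {x : Plane} (hx : x ∈ O) :
    stressDiv m u p x = 0 ↔ m • (Δ u) x = gradient p x := by
  rw [stressDiv, matDiv_grad_transpose_eq_zero (H.contDiffAt hx)
    (by filter_upwards [H.isOpen.mem_nhds hx] with y hy using hdiv y hy), add_zero, sub_eq_zero]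

/-- Limits at a point of the closure are unique, so the traces in `StressJump` are the values of the
continuous extensions. -/
lemma stressJump_iff {A B : Set Plane} {mA mB : ℝ} {u : Plane → Plane} {p : Plane → ℝ}
    {SA SB : Plane → Matrix (Fin 2) (Fin 2) ℝ} (hcA : ContinuousOn SA (closure A))
    (hsA : EqOn SA (stress mA u p) A) (hcB : ContinuousOn SB (closure B))
    (hsB : EqOn SB (stress mB u p) B) {x : Plane} (hxA : x ∈ closure A) (hxB : x ∈ closure B)
    (n : Plane) (κ : ℝ) :
    StressJump A B mA mB u p x n κ ↔ act (SA x - SB x) n = -(κ • n) := by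
  have lim {O : Set Plane} {m : ℝ} {S : Plane → Matrix (Fin 2) (Fin 2) ℝ}
      (hc : ContinuousOn S (closure O)) (hs : EqOn S (stress m u p) O) (hx : x ∈ closure O) :
      Tendsto (stress m u p) (𝓝[O] x) (𝓝 (S x)) :=
    ((hc x hx).mono subset_closure).tendsto.congr' (hs.eventuallyEq_of_mem self_mem_nhdsWithin)
  have hA := lim hcA hsA hxA
  have hB := lim hcB hsB hxB
  have := mem_closure_iff_nhdsWithin_neBot.1 hxA
  have := mem_closure_iff_nhdsWithin_neBot.1 hxB
  refine ⟨fun ⟨S, T, hS, hT, h⟩ => ?_, fun h => ⟨SA x, SB x, hA, hB, h⟩⟩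
  rwa [tendsto_nhds_unique hA hS, tendsto_nhds_unique hB hT]

/-- Both traces equal `u x`, so in this regularity class the velocity conditions on the curves are
automatic. -/
lemma velocityMatch_of_continuousOn {A B s : Set Plane} {u : Plane → Plane}
    (hu : ContinuousOn u s) (hA : A ⊆ s) (hB : B ⊆ s) {x : Plane} (hx : x ∈ s) (n τ : Plane) :
    VelocityMatch A B u x n τ :=
  ⟨u x, u x, ((hu x hx).mono hA).tendsto, ((hu x hx).mono hB).tendsto, rfl, rfl⟩

/-- The normal stress jump across a curve, augmented by the surface tension. -/
def surfaceForce (c : ℝ → Plane) (A B : Plane → Matrix (Fin 2) (Fin 2) ℝ) (ξ : ℝ) : Plane :=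
  act (A (c ξ) - B (c ξ)) (leftNormal c ξ) + curvature c ξ • leftNormal c ξ

lemma continuous_surfaceForce {c : ℝ → Plane} {L : ℝ} (hc : IsC2JordanParam c L)
    {A B : Plane → Matrix (Fin 2) (Fin 2) ℝ} {s t : Set Plane} (hs : range c ⊆ s)
    (ht : range c ⊆ t) (hA : ContinuousOn A s) (hB : ContinuousOn B t) :
    Continuous (surfaceForce c A B) :=
  (continuous_act.comp (((hA.comp_continuous hc.continuous fun ξ => hs (mem_range_self ξ)).sub
    (hB.comp_continuous hc.continuous fun ξ => ht (mem_range_self ξ))).prodMk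
      hc.continuous_leftNormal)).add (hc.continuous_curvature.smul hc.continuous_leftNormal)

lemma surfaceForce_periodic {c : ℝ → Plane} {L : ℝ} (hc : IsC2JordanParam c L)
    (A B : Plane → Matrix (Fin 2) (Fin 2) ℝ) : Function.Periodic (surfaceForce c A B) L :=
  fun ξ => by
    simp only [surfaceForce, hc.periodic ξ, leftNormal_periodic hc ξ, curvature_periodic hc ξ]

lemma arcIntegral_eq_zero {c : ℝ → Plane} {L : ℝ} {f : ℝ → ℝ} (hf : ∀ ξ, f ξ = 0) :
    arcIntegral c L f = 0 := by
  simp only [arcIntegral, hf, zero_mul, intervalIntegral.integral_zero]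

/-- Splitting off the curvature term produces the curve delta of the right-hand side, so the balance
on a curve becomes the vanishing of a single density. -/
lemma arcIntegral_surfaceForce {c : ℝ → Plane} {L : ℝ} (hc : IsC2JordanParam c L)
    {A B : Plane → Matrix (Fin 2) (Fin 2) ℝ} {s t : Set Plane} (hs : range c ⊆ s)
    (ht : range c ⊆ t) (hA : ContinuousOn A s) (hB : ContinuousOn B t) {φ : Plane → Plane}
    (hφ : Continuous φ) :
    arcIntegral c L (fun ξ => inner ℝ (act (A (c ξ) - B (c ξ)) (leftNormal c ξ)) (φ (c ξ))) =
      arcIntegral c L (fun ξ => inner ℝ (surfaceForce c A B ξ) (φ (c ξ)))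
        - arcIntegral c L (fun ξ => curvature c ξ * inner ℝ (leftNormal c ξ) (φ (c ξ))) := by
  have h1 : Continuous fun ξ => inner ℝ (surfaceForce c A B ξ) (φ (c ξ)) :=
    (continuous_surfaceForce hc hs ht hA hB).inner (hφ.comp hc.continuous)
  have h2 : Continuous fun ξ => curvature c ξ * inner ℝ (leftNormal c ξ) (φ (c ξ)) :=
    hc.continuous_curvature.mul (hc.continuous_leftNormal.inner (hφ.comp hc.continuous))
  rw [← arcIntegral_sub hc h1 h2]
  simp only [surfaceForce, inner_add_left, real_inner_smul_left, add_sub_cancel_right]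

namespace IsLayeredFluid

variable {D : TopologicalSpace.Opens Plane} {Ω₁ Ω₂ Ω₃ : Set Plane} {Γ : ℝ → Plane} {h : ℝ → ℝ}
  {L ε : ℝ} {u : Plane → Plane} {p : Plane → ℝ}

/-- The velocity is solenoidal in the sense of distributions if and only if it is solenoidal in
each of the three domains. -/
theorem distribDiv_eq_zero_iff (H : IsLayeredFluid D Ω₁ Ω₂ Ω₃ Γ h L ε u p) {T : 𝓓'(D, ℝ)}
    (hT : IsDistribDiv u T) : T = 0 ↔ ∀ x ∈ Ω₁ ∪ Ω₂ ∪ Ω₃, div u x = 0 := by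
  have G := H.layer
  have formula (ψ : 𝓓(D, ℝ)) : T ψ = (∫ x in Ω₁, ψ x * div u x) + (∫ x in Ω₂, ψ x * div u x)
      + ∫ x in Ω₃, ψ x * div u x := by
    rw [hT, H.integral_inner_gradient ((contDiff_two_of_test ψ).of_le (by norm_num))
      ψ.hasCompactSupport ψ.tsupport_subset]
  constructor
  · intro h0
    have zero {O : Set Plane} (hO : IsOpen O) {g : Plane → ℝ} (hg : ∀ x ∈ O, g x = 0) :
        ∫ x in O, g x * div u x = 0 :=
      setIntegral_eq_zero_of_forall_eq_zero fun x hx => by rw [hg x hx, zero_mul]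
    have off {A B : Set Plane} (hAB : Disjoint A B) {g : Plane → ℝ} (hg : tsupport g ⊆ A) :
        ∀ x ∈ B, g x = 0 := fun x hx =>
      image_eq_zero_of_notMem_tsupport fun hx' => disjoint_left.1 hAB (hg hx') hx
    have test (g : Plane → ℝ) (hg : ContDiff ℝ (⊤ : ℕ∞) g) (hgc : HasCompactSupport g)
        (hgD : tsupport g ⊆ D) : (∫ x in Ω₁, g x * div u x) + (∫ x in Ω₂, g x * div u x)
          + ∫ x in Ω₃, g x * div u x = 0 := by
      have := formula ⟨g, hg, hgc, hgD⟩
      rw [h0] at this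
      exact this.symm
    -- Test functions supported in the domain of `x` remove the other two integrals.
    rintro x ((hx | hx) | hx)
    · refine eqOn_zero_of_integral_test G.isOpen₁ H.fluid₁.continuousOn_div
        (fun g hg hgc hgO => ?_) x hx
      have := test g hg hgc (hgO.trans G.subset₁)
      rwa [zero G.isOpen₂ (off G.disjoint₁₂ hgO), zero G.isOpen₃ (off G.disjoint₁₃ hgO), add_zero,
        add_zero] at this
    · refine eqOn_zero_of_integral_test G.isOpen₂ H.fluid₂.continuousOn_div
        (fun g hg hgc hgO => ?_) x hx
      have := test g hg hgc (hgO.trans G.subset₂)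
      rwa [zero G.isOpen₁ (off G.disjoint₁₂.symm hgO), zero G.isOpen₃ (off G.disjoint₂₃ hgO),
        add_zero, zero_add] at this
    · refine eqOn_zero_of_integral_test G.isOpen₃ H.fluid₃.continuousOn_div
        (fun g hg hgc hgO => ?_) x hx
      have := test g hg hgc (hgO.trans G.subset₃)
      rwa [zero G.isOpen₁ (off G.disjoint₁₃.symm hgO), zero G.isOpen₂ (off G.disjoint₂₃.symm hgO),
        add_zero, zero_add] at this
  · intro h0
    have zero {O : Set Plane} (hO : O ⊆ Ω₁ ∪ Ω₂ ∪ Ω₃) (ψ : Plane → ℝ) :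
        ∫ x in O, ψ x * div u x = 0 :=
      setIntegral_eq_zero_of_forall_eq_zero fun x hx => by rw [h0 x (hO hx), mul_zero]
    refine DFunLike.ext _ _ fun ψ => ?_
    rw [formula, zero (O := Ω₁) (fun x hx => Or.inl (Or.inl hx)),
      zero (O := Ω₂) (fun x hx => Or.inl (Or.inr hx)), zero (O := Ω₃) (fun x hx => Or.inr hx),
      add_zero, add_zero]
    rfl

/-- Existence of the distribution given by the Stokes functional. -/
theorem exists_stokesFunctional (H : IsLayeredFluid D Ω₁ Ω₂ Ω₃ Γ h L ε u p) (μ μ₂ : ℝ) :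
    ∃ S : VectorDistribution D, ∀ φ : 𝓓(D, Plane),
      S φ = stokesFunctional D Ω₂ Γ (innerCurve Γ h ε) L μ μ₂ u p φ := by
  have G := H.layer
  have join {f : Plane → ℝ} (h₁ : IntegrableOn f Ω₁) (h₂ : IntegrableOn f Ω₂)
      (h₃ : IntegrableOn f Ω₃) : IntegrableOn f D := by
    rw [integrableOn_congr_set_ae G.ae_eq_union]
    exact (h₁.union h₂).union h₃
  have hu (i : Fin 2) : IntegrableOn (fun x => viscosity Ω₂ μ μ₂ x * u x i) D :=
    join
      (IntegrableOn.congr_fun ((H.fluid₁.integrableOn_velocity i).const_mul μ) (fun x hx => by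
        simp only [viscosity, if_neg fun h2 => disjoint_left.1 G.disjoint₁₂ hx h2])
          G.isOpen₁.measurableSet)
      (IntegrableOn.congr_fun ((H.fluid₂.integrableOn_velocity i).const_mul μ₂) (fun x hx => by
        simp only [viscosity, if_pos hx]) G.isOpen₂.measurableSet)
      (IntegrableOn.congr_fun ((H.fluid₃.integrableOn_velocity i).const_mul μ) (fun x hx => by
        simp only [viscosity, if_neg fun h2 => disjoint_left.1 G.disjoint₂₃ h2 hx])
          G.isOpen₃.measurableSet)
  obtain ⟨T, hT⟩ := exists_bulk_distribution D hu (join H.fluid₁.integrableOn_pressure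
    H.fluid₂.integrableOn_pressure H.fluid₃.integrableOn_pressure)
  obtain ⟨TΓ, hTΓ⟩ := exists_curve_strain D G.L_pos G.outer_param
    (continuous_comp_curve G.outer_param G.range_outer_subset_closure₂ H.fluid₂.continuousOn)
    G.outer_param.continuous_leftNormal
  obtain ⟨Tγ, hTγ⟩ := exists_curve_strain D G.L_pos G.inner_param
    (continuous_comp_curve G.inner_param G.range_inner_subset_closure₂ H.fluid₂.continuousOn)
    G.inner_param.continuous_leftNormal.neg
  refine ⟨T + (μ - μ₂) • TΓ + (μ - μ₂) • Tγ, fun φ => ?_⟩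
  simp only [add_apply, smul_apply, hT, hTΓ, hTγ, smul_eq_mul]
  rfl

lemma exists_distribDiv (H : IsLayeredFluid D Ω₁ Ω₂ Ω₃ Γ h L ε u p) :
    ∃ T : 𝓓'(D, ℝ), IsDistribDiv u T :=
  exists_isDistribDiv D fun i =>
    (((coord i).continuous.comp_continuousOn H.continuousOn).integrableOn_compact
      H.layer.isCompact_closure_D).mono_set subset_closure

end IsLayeredFluid

/-- Test fields `g eᵢ` isolate one component. The integrability that Green's formula demands is
available for them, because the stress divergence is continuous in `O` and `g` has compact support
there. -/
lemma IsFluidOn.stressDiv_eq_zero_of_test {O : Set Plane} {u : Plane → Plane} {p : Plane → ℝ}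
    (H : IsFluidOn O u p) (m : ℝ)
    (h : ∀ φ : Plane → Plane, ContDiff ℝ (⊤ : ℕ∞) φ → HasCompactSupport φ → tsupport φ ⊆ O →
      IntegrableOn (fun x => inner ℝ (stressDiv m u p x) (φ x)) O →
      ∫ x in O, inner ℝ (stressDiv m u p x) (φ x) = 0) : ∀ x ∈ O, stressDiv m u p x = 0 := by
  intro x hx
  ext i
  refine eqOn_zero_of_integral_test H.isOpen (H.continuousOn_stressDiv m i)
    (fun g hg hgc hgO => ?_) x hx
  have e : (fun x => inner ℝ (stressDiv m u p x) (g x • basisVec i)) =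
      fun x => g x * stressDiv m u p x i := by
    ext1 x
    rw [inner_smul_right, basisVec, EuclideanSpace.inner_single_right]
    simp
  have := h (fun x => g x • basisVec i) (hg.smul contDiff_const) hgc.smul_right
    ((tsupport_smul_subset_left g _).trans hgO)
  rw [e] at this
  exact this (integrableOn_mul_of_tsupport_subset H.isOpen (H.continuousOn_stressDiv m i)
    hg.continuous hgc hgO)

namespace IsLayeredFluid

variable {D : TopologicalSpace.Opens Plane} {Ω₁ Ω₂ Ω₃ : Set Plane} {Γ : ℝ → Plane} {h : ℝ → ℝ}
  {L ε : ℝ} {u : Plane → Plane} {p : Plane → ℝ}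

/-- The distributional momentum balance holds if and only if the stress is divergence free in each
of the domains and the surface force vanishes on both curves. -/
theorem distribution_eq_iff (H : IsLayeredFluid D Ω₁ Ω₂ Ω₃ Γ h L ε u p) {μ μ₂ : ℝ}
    {S₁ S₂ S₃ : Plane → Matrix (Fin 2) (Fin 2) ℝ}
    (hc₁ : ContinuousOn S₁ (closure Ω₁)) (hs₁ : EqOn S₁ (stress μ u p) Ω₁)
    (hS₁ : ∀ x, (S₁ x).IsSymm)
    (hc₂ : ContinuousOn S₂ (closure Ω₂)) (hs₂ : EqOn S₂ (stress μ₂ u p) Ω₂)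
    (hS₂ : ∀ x, (S₂ x).IsSymm)
    (hc₃ : ContinuousOn S₃ (closure Ω₃)) (hs₃ : EqOn S₃ (stress μ u p) Ω₃)
    (hS₃ : ∀ x, (S₃ x).IsSymm) {S T_inner T_outer : VectorDistribution D}
    (hS : ∀ φ : 𝓓(D, Plane),
      S φ = stokesFunctional D Ω₂ Γ (innerCurve Γ h ε) L μ μ₂ u p φ)
    (hTi : IsCurveDelta (innerCurve Γ h ε) L (curvature (innerCurve Γ h ε))
      (fun ξ => -leftNormal (innerCurve Γ h ε) ξ) T_inner)
    (hTo : IsCurveDelta Γ L (curvature Γ) (leftNormal Γ) T_outer) :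
    S = T_inner - T_outer ↔
      ((∀ x ∈ Ω₁, stressDiv μ u p x = 0) ∧ (∀ x ∈ Ω₂, stressDiv μ₂ u p x = 0) ∧
        ∀ x ∈ Ω₃, stressDiv μ u p x = 0) ∧
      (∀ ξ, surfaceForce Γ S₃ S₂ ξ = 0) ∧ ∀ ξ, surfaceForce (innerCurve Γ h ε) S₂ S₁ ξ = 0 := by
  have G := H.layer
  set γ := innerCurve Γ h ε with hγ
  have jγ := G.inner_param
  have jΓ := G.outer_param
  -- Green's formula with the curve deltas absorbed into the surface forces. Integrability is
  -- assumed for each test field, since the stress divergence is not controlled at the boundary.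
  have formula (φ : 𝓓(D, Plane))
      (hi₁ : IntegrableOn (fun x => inner ℝ (stressDiv μ u p x) (φ x)) Ω₁)
      (hi₂ : IntegrableOn (fun x => inner ℝ (stressDiv μ₂ u p x) (φ x)) Ω₂)
      (hi₃ : IntegrableOn (fun x => inner ℝ (stressDiv μ u p x) (φ x)) Ω₃) :
      S φ - (T_inner - T_outer) φ =
        (∫ x in Ω₁, inner ℝ (stressDiv μ u p x) (φ x))
        + (∫ x in Ω₂, inner ℝ (stressDiv μ₂ u p x) (φ x))
        + (∫ x in Ω₃, inner ℝ (stressDiv μ u p x) (φ x))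
        + arcIntegral Γ L (fun ξ => inner ℝ (surfaceForce Γ S₃ S₂ ξ) (φ (Γ ξ)))
        + arcIntegral γ L (fun ξ => inner ℝ (surfaceForce γ S₂ S₁ ξ) (φ (γ ξ))) := by
    have neg_normal : arcIntegral γ L
        (fun ξ => curvature γ ξ * inner ℝ (-leftNormal γ ξ) (φ (γ ξ))) =
        -arcIntegral γ L (fun ξ => curvature γ ξ * inner ℝ (leftNormal γ ξ) (φ (γ ξ))) := by
      rw [← neg_one_mul, ← arcIntegral_const_mul]
      simp only [inner_neg_left, mul_neg, neg_mul, one_mul]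
    have hφ := contDiff_two_of_test φ
    rw [hS, sub_apply, hTi, hTo, neg_normal, H.stokesFunctional_eq hc₁ hs₁ hS₁ hc₂ hs₂ hS₂
      hc₃ hs₃ hS₃ hφ φ.hasCompactSupport φ.tsupport_subset hi₁ hi₂ hi₃,
      arcIntegral_surfaceForce jΓ G.range_outer_subset_closure₃ G.range_outer_subset_closure₂
        hc₃ hc₂ hφ.continuous,
      arcIntegral_surfaceForce jγ G.range_inner_subset_closure₂ G.range_inner_subset_closure₁
        hc₂ hc₁ hφ.continuous]
    ring
  have int_zero {O : Set Plane} {f : Plane → ℝ} (hO : IsOpen O) (hf : ∀ x ∈ O, f x = 0) :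
      IntegrableOn f O ∧ ∫ x in O, f x = 0 :=
    ⟨integrableOn_zero.congr_fun (fun x hx => (hf x hx).symm) hO.measurableSet,
      setIntegral_eq_zero_of_forall_eq_zero hf⟩
  have arc_zero {c : ℝ → Plane} {φ : Plane → Plane} {w : ℝ → Plane} (hφ : ∀ ξ, φ (c ξ) = 0) :
      arcIntegral c L (fun ξ => inner ℝ (w ξ) (φ (c ξ))) = 0 :=
    arcIntegral_eq_zero fun ξ => by rw [hφ, inner_zero_right]
  constructor
  · intro heq
    have test (φ : Plane → Plane) (hφ : ContDiff ℝ (⊤ : ℕ∞) φ) (hφc : HasCompactSupport φ)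
        (hφD : tsupport φ ⊆ D)
        (hi₁ : IntegrableOn (fun x => inner ℝ (stressDiv μ u p x) (φ x)) Ω₁)
        (hi₂ : IntegrableOn (fun x => inner ℝ (stressDiv μ₂ u p x) (φ x)) Ω₂)
        (hi₃ : IntegrableOn (fun x => inner ℝ (stressDiv μ u p x) (φ x)) Ω₃) :
        (∫ x in Ω₁, inner ℝ (stressDiv μ u p x) (φ x))
        + (∫ x in Ω₂, inner ℝ (stressDiv μ₂ u p x) (φ x))
        + (∫ x in Ω₃, inner ℝ (stressDiv μ u p x) (φ x))
        + arcIntegral Γ L (fun ξ => inner ℝ (surfaceForce Γ S₃ S₂ ξ) (φ (Γ ξ)))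
        + arcIntegral γ L (fun ξ => inner ℝ (surfaceForce γ S₂ S₁ ξ) (φ (γ ξ))) = 0 := by
      have := formula ⟨φ, hφ, hφc, hφD⟩ hi₁ hi₂ hi₃
      rw [heq, sub_self] at this
      exact this.symm
    have off {A B : Set Plane} (hB : IsOpen B) (hAB : Disjoint A B) (m : ℝ) {φ : Plane → Plane}
        (hφ : tsupport φ ⊆ A) : IntegrableOn (fun x => inner ℝ (stressDiv m u p x) (φ x)) B ∧
          ∫ x in B, inner ℝ (stressDiv m u p x) (φ x) = 0 :=
      int_zero hB fun x hx => by
        rw [image_eq_zero_of_notMem_tsupport fun hx' => disjoint_left.1 hAB (hφ hx') hx,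
          inner_zero_right]
    have off_curve {c : ℝ → Plane} {A : Set Plane} (hcA : ∀ ξ, c ξ ∉ A) {φ : Plane → Plane}
        (hφ : tsupport φ ⊆ A) (ξ : ℝ) : φ (c ξ) = 0 :=
      image_eq_zero_of_notMem_tsupport fun hx => hcA ξ (hφ hx)
    -- Fields supported in one domain come first: they vanish on both curves, and for them the
    -- integrability conditions hold.
    have m₁ : ∀ x ∈ Ω₁, stressDiv μ u p x = 0 :=
      H.fluid₁.stressDiv_eq_zero_of_test μ fun φ hφ hφc hφO hi => by
        have o₂ := off G.isOpen₂ G.disjoint₁₂ μ₂ hφO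
        have o₃ := off G.isOpen₃ G.disjoint₁₃ μ hφO
        have := test φ hφ hφc (hφO.trans G.subset₁) hi o₂.1 o₃.1
        rwa [o₂.2, o₃.2, arc_zero (off_curve (fun ξ hx =>
          G.outer_notMem_closure₁ ξ (subset_closure hx)) hφO),
          arc_zero (off_curve G.inner_notMem₁ hφO), add_zero, add_zero, add_zero, add_zero] at this
    have m₂ : ∀ x ∈ Ω₂, stressDiv μ₂ u p x = 0 :=
      H.fluid₂.stressDiv_eq_zero_of_test μ₂ fun φ hφ hφc hφO hi => by
        have o₁ := off G.isOpen₁ G.disjoint₁₂.symm μ hφO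
        have o₃ := off G.isOpen₃ G.disjoint₂₃ μ hφO
        have := test φ hφ hφc (hφO.trans G.subset₂) o₁.1 hi o₃.1
        rwa [o₁.2, o₃.2, arc_zero (off_curve G.outer_notMem₂ hφO),
          arc_zero (off_curve G.inner_notMem₂ hφO), add_zero, add_zero, add_zero, zero_add] at this
    have m₃ : ∀ x ∈ Ω₃, stressDiv μ u p x = 0 :=
      H.fluid₃.stressDiv_eq_zero_of_test μ fun φ hφ hφc hφO hi => by
        have o₁ := off G.isOpen₁ G.disjoint₁₃.symm μ hφO
        have o₂ := off G.isOpen₂ G.disjoint₂₃.symm μ₂ hφO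
        have := test φ hφ hφc (hφO.trans G.subset₃) o₁.1 o₂.1 hi
        rwa [o₁.2, o₂.2, arc_zero (off_curve G.outer_notMem₃ hφO),
          arc_zero (off_curve (fun ξ hx => G.inner_notMem_closure₃ ξ (subset_closure hx)) hφO),
          add_zero, add_zero, zero_add, zero_add] at this
    -- Now that the stress is divergence free in each domain, the formula applies to all test
    -- fields, including those that cross the curves.
    have test_curve (φ : Plane → Plane) (hφ : ContDiff ℝ (⊤ : ℕ∞) φ) (hφc : HasCompactSupport φ)
        (hφD : tsupport φ ⊆ D) :
        arcIntegral Γ L (fun ξ => inner ℝ (surfaceForce Γ S₃ S₂ ξ) (φ (Γ ξ)))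
        + arcIntegral γ L (fun ξ => inner ℝ (surfaceForce γ S₂ S₁ ξ) (φ (γ ξ))) = 0 := by
      have o₁ := int_zero G.isOpen₁ (f := fun x => inner ℝ (stressDiv μ u p x) (φ x))
        fun x hx => by rw [m₁ x hx, inner_zero_left]
      have o₂ := int_zero G.isOpen₂ (f := fun x => inner ℝ (stressDiv μ₂ u p x) (φ x))
        fun x hx => by rw [m₂ x hx, inner_zero_left]
      have o₃ := int_zero G.isOpen₃ (f := fun x => inner ℝ (stressDiv μ u p x) (φ x))
        fun x hx => by rw [m₃ x hx, inner_zero_left]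
      have := test φ hφ hφc hφD o₁.1 o₂.1 o₃.1
      rwa [o₁.2, o₂.2, o₃.2, add_zero, add_zero, zero_add] at this
    refine ⟨⟨m₁, m₂, m₃⟩, fun ξ => ?_, fun ξ => ?_⟩
    -- The test field is supported in a region that avoids the other curve, so one curve integral
    -- remains, and it is positive.
    · by_contra hne
      obtain ⟨φ, hφV, hφc, hφ, hpos⟩ := exists_test_arcIntegral_pos jΓ G.L_pos
        (continuous_surfaceForce jΓ G.range_outer_subset_closure₃ G.range_outer_subset_closure₂
          hc₃ hc₂) (surfaceForce_periodic jΓ _ _) hne (G.outer_region_mem_nhds ξ)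
      have := test_curve φ hφ hφc (hφV.trans inter_subset_left)
      rw [arc_zero (c := γ) (off_curve (fun ξ' hx => hx.2.1 (mem_range_self ξ')) hφV),
        add_zero] at this
      exact hpos.ne' this
    · by_contra hne
      obtain ⟨φ, hφV, hφc, hφ, hpos⟩ := exists_test_arcIntegral_pos jγ G.L_pos
        (continuous_surfaceForce jγ G.range_inner_subset_closure₂ G.range_inner_subset_closure₁
          hc₂ hc₁) (surfaceForce_periodic jγ _ _) hne (G.inner_region_mem_nhds ξ)
      have := test_curve φ hφ hφc (hφV.trans inter_subset_left)
      rw [arc_zero (c := Γ) (off_curve (fun ξ' hx => hx.2.1 (mem_range_self ξ')) hφV),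
        zero_add] at this
      exact hpos.ne' this
  · rintro ⟨⟨m₁, m₂, m₃⟩, hΓ, hγ0⟩
    ext φ
    have o₁ := int_zero G.isOpen₁ (f := fun x => inner ℝ (stressDiv μ u p x) (φ x))
      fun x hx => by rw [m₁ x hx, inner_zero_left]
    have o₂ := int_zero G.isOpen₂ (f := fun x => inner ℝ (stressDiv μ₂ u p x) (φ x))
      fun x hx => by rw [m₂ x hx, inner_zero_left]
    have o₃ := int_zero G.isOpen₃ (f := fun x => inner ℝ (stressDiv μ u p x) (φ x))
      fun x hx => by rw [m₃ x hx, inner_zero_left]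
    have := formula φ o₁.1 o₂.1 o₃.1
    rw [o₁.2, o₂.2, o₃.2, arcIntegral_eq_zero fun ξ => by rw [hΓ, inner_zero_left],
      arcIntegral_eq_zero fun ξ => by rw [hγ0, inner_zero_left]] at this
    linarith

/-- The boundary value problem in terms of the divergence of the stress and the surface forces. -/
theorem solvesStokes_iff (H : IsLayeredFluid D Ω₁ Ω₂ Ω₃ Γ h L ε u p) {μ μ₂ : ℝ}
    {U : Plane → Plane} (hU : ∀ x ∈ frontier (D : Set Plane), u x = U x)
    {S₁ S₂ S₃ : Plane → Matrix (Fin 2) (Fin 2) ℝ}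
    (hc₁ : ContinuousOn S₁ (closure Ω₁)) (hs₁ : EqOn S₁ (stress μ u p) Ω₁)
    (hc₂ : ContinuousOn S₂ (closure Ω₂)) (hs₂ : EqOn S₂ (stress μ₂ u p) Ω₂)
    (hc₃ : ContinuousOn S₃ (closure Ω₃)) (hs₃ : EqOn S₃ (stress μ u p) Ω₃) :
    SolvesStokes D Ω₁ Ω₂ Ω₃ Γ (innerCurve Γ h ε) μ μ₂ U u p ↔
      (((∀ x ∈ Ω₁, stressDiv μ u p x = 0) ∧ (∀ x ∈ Ω₂, stressDiv μ₂ u p x = 0) ∧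
        ∀ x ∈ Ω₃, stressDiv μ u p x = 0) ∧
      (∀ ξ, surfaceForce Γ S₃ S₂ ξ = 0) ∧ ∀ ξ, surfaceForce (innerCurve Γ h ε) S₂ S₁ ξ = 0) ∧
      ∀ x ∈ Ω₁ ∪ Ω₂ ∪ Ω₃, div u x = 0 := by
  have G := H.layer
  have v₁ : ∀ x ∈ Ω₁, viscosity Ω₂ μ μ₂ x = μ := fun x hx =>
    if_neg fun h2 => disjoint_left.1 G.disjoint₁₂ hx h2
  have v₂ : ∀ x ∈ Ω₂, viscosity Ω₂ μ μ₂ x = μ₂ := fun x hx => if_pos hx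
  have v₃ : ∀ x ∈ Ω₃, viscosity Ω₂ μ μ₂ x = μ := fun x hx =>
    if_neg fun h2 => disjoint_left.1 G.disjoint₂₃ h2 hx
  have jump_outer (ξ : ℝ) : StressJump Ω₃ Ω₂ μ μ₂ u p (Γ ξ) (leftNormal Γ ξ) (curvature Γ ξ) ↔
      surfaceForce Γ S₃ S₂ ξ = 0 := by
    rw [stressJump_iff hc₃ hs₃ hc₂ hs₂ (G.range_outer_subset_closure₃ (mem_range_self ξ))
      (G.range_outer_subset_closure₂ (mem_range_self ξ)), surfaceForce, eq_neg_iff_add_eq_zero]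
  -- The jump condition is odd in the normal, so replacing `-𝔸 τ_ε` by the normal `𝔸 τ_ε` of
  -- `surfaceForce` does not change it.
  have act_neg (M : Matrix (Fin 2) (Fin 2) ℝ) (v : Plane) : act M (-v) = -act M v := by
    ext i
    simp only [act_apply, PiLp.neg_apply]
    ring
  have jump_inner (ξ : ℝ) : StressJump Ω₂ Ω₁ μ₂ μ u p (innerCurve Γ h ε ξ)
      (-leftNormal (innerCurve Γ h ε) ξ) (curvature (innerCurve Γ h ε) ξ) ↔
      surfaceForce (innerCurve Γ h ε) S₂ S₁ ξ = 0 := by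
    rw [stressJump_iff hc₂ hs₂ hc₁ hs₁ (G.range_inner_subset_closure₂ (mem_range_self ξ))
      (G.range_inner_subset_closure₁ (mem_range_self ξ)), surfaceForce, act_neg, smul_neg, neg_inj,
      eq_neg_iff_add_eq_zero]
  have sub₁ : Ω₁ ⊆ Ω₁ ∪ Ω₂ ∪ Ω₃ := fun x hx => Or.inl (Or.inl hx)
  have sub₂ : Ω₂ ⊆ Ω₁ ∪ Ω₂ ∪ Ω₃ := fun x hx => Or.inl (Or.inr hx)
  have sub₃ : Ω₃ ⊆ Ω₁ ∪ Ω₂ ∪ Ω₃ := fun x hx => Or.inr hx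
  constructor
  · intro P
    have hdiv := P.incompressible
    refine ⟨⟨⟨fun x hx => ?_, fun x hx => ?_, fun x hx => ?_⟩,
      fun ξ => (jump_outer ξ).1 (P.stress_outer ξ),
      fun ξ => (jump_inner ξ).1 (P.stress_inner ξ)⟩, hdiv⟩
    · rw [H.fluid₁.stressDiv_eq_zero_iff μ (fun y hy => hdiv y (sub₁ hy)) hx, ← v₁ x hx]
      exact P.momentum x (sub₁ hx)
    · rw [H.fluid₂.stressDiv_eq_zero_iff μ₂ (fun y hy => hdiv y (sub₂ hy)) hx, ← v₂ x hx]
      exact P.momentum x (sub₂ hx)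
    · rw [H.fluid₃.stressDiv_eq_zero_iff μ (fun y hy => hdiv y (sub₃ hy)) hx, ← v₃ x hx]
      exact P.momentum x (sub₃ hx)
  · rintro ⟨⟨⟨m₁, m₂, m₃⟩, hΓ, hγ⟩, hdiv⟩
    exact
      { momentum := by
          rintro x ((hx | hx) | hx)
          · rw [v₁ x hx]
            exact (H.fluid₁.stressDiv_eq_zero_iff μ (fun y hy => hdiv y (sub₁ hy)) hx).1 (m₁ x hx)
          · rw [v₂ x hx]
            exact (H.fluid₂.stressDiv_eq_zero_iff μ₂ (fun y hy => hdiv y (sub₂ hy)) hx).1 (m₂ x hx)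
          · rw [v₃ x hx]
            exact (H.fluid₃.stressDiv_eq_zero_iff μ (fun y hy => hdiv y (sub₃ hy)) hx).1 (m₃ x hx)
        incompressible := hdiv
        boundary := hU
        velocity_outer := fun ξ => velocityMatch_of_continuousOn H.continuousOn
          (G.subset₃.trans subset_closure) (G.subset₂.trans subset_closure)
          (subset_closure (G.outer_mem ξ)) _ _
        velocity_inner := fun ξ => velocityMatch_of_continuousOn H.continuousOn
          (G.subset₁.trans subset_closure) (G.subset₂.trans subset_closure)
          (subset_closure (G.inner_mem ξ)) _ _
        stress_outer := fun ξ => (jump_outer ξ).2 (hΓ ξ)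
        stress_inner := fun ξ => (jump_inner ξ).2 (hγ ξ) }

end IsLayeredFluid

end ThinLayer

end

/-! ### The equivalence theorem -/

theorem mainTheorem5
    (D : TopologicalSpace.Opens ThinLayer.Plane) (Ω₁ Ω₂ Ω₃ : Set ThinLayer.Plane)
    (Γ : ℝ → ThinLayer.Plane) (h : ℝ → ℝ) (L ε : ℝ)
    (hgeom : ThinLayer.IsThinLayer D Ω₁ Ω₂ Ω₃ Γ h L ε)
    (μ μ₂ : ℝ) (hμ : 0 < μ) (hμ₂ : 0 < μ₂)
    (U u : ThinLayer.Plane → ThinLayer.Plane) (p : ThinLayer.Plane → ℝ)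
    (hu_C2 : ContDiffOn ℝ 2 u (Ω₁ ∪ Ω₂ ∪ Ω₃))
    (hu_cont : ContinuousOn u (closure (D : Set ThinLayer.Plane)))
    (hu_X : ThinLayer.MemX 1 ![Ω₁, Ω₂, Ω₃] u)
    (hu_U : ∀ x ∈ frontier (D : Set ThinLayer.Plane), u x = U x)
    (hp_C1 : ContDiffOn ℝ 1 p (Ω₁ ∪ Ω₂ ∪ Ω₃))
    (hp_X : ThinLayer.MemX 0 ![Ω₁, Ω₂, Ω₃] p) :
    ∃ (S T_inner T_outer : ThinLayer.VectorDistribution D) (divU : 𝓓'(D, ℝ)),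
      (∀ φ : 𝓓(D, ThinLayer.Plane), S φ =
        ThinLayer.stokesFunctional D Ω₂ Γ (ThinLayer.innerCurve Γ h ε) L μ μ₂ u p φ) ∧
      ThinLayer.IsCurveDelta (ThinLayer.innerCurve Γ h ε) L
        (ThinLayer.curvature (ThinLayer.innerCurve Γ h ε))
        (fun ξ => -ThinLayer.leftNormal (ThinLayer.innerCurve Γ h ε) ξ) T_inner ∧
      ThinLayer.IsCurveDelta Γ L (ThinLayer.curvature Γ) (ThinLayer.leftNormal Γ) T_outer ∧
      ThinLayer.IsDistribDiv u divU ∧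
      (ThinLayer.SolvesStokes D Ω₁ Ω₂ Ω₃ Γ (ThinLayer.innerCurve Γ h ε) μ μ₂ U u p ↔
        S = T_inner - T_outer ∧ divU = 0) := by
  have H := hgeom.isLayeredFluid hu_C2 hu_cont hu_X hp_C1 hp_X
  obtain ⟨S, hS⟩ := H.exists_stokesFunctional μ μ₂
  obtain ⟨T_inner, hTi⟩ := ThinLayer.exists_isCurveDelta D hgeom.L_pos hgeom.inner_param
    hgeom.inner_param.continuous_curvature hgeom.inner_param.continuous_leftNormal.neg
  obtain ⟨T_outer, hTo⟩ := ThinLayer.exists_isCurveDelta D hgeom.L_pos hgeom.outer_param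
    hgeom.outer_param.continuous_curvature hgeom.outer_param.continuous_leftNormal
  obtain ⟨divU, hdivU⟩ := H.exists_distribDiv
  obtain ⟨S₁, hc₁, hs₁, hS₁⟩ := H.fluid₁.exists_stress_extension μ
  obtain ⟨S₂, hc₂, hs₂, hS₂⟩ := H.fluid₂.exists_stress_extension μ₂
  obtain ⟨S₃, hc₃, hs₃, hS₃⟩ := H.fluid₃.exists_stress_extension μ
  refine ⟨S, T_inner, T_outer, divU, hS, hTi, hTo, hdivU, ?_⟩
  rw [H.solvesStokes_iff hu_U hc₁ hs₁ hc₂ hs₂ hc₃ hs₃, H.distribDiv_eq_zero_iff hdivU,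
    H.distribution_eq_iff hc₁ hs₁ hS₁ hc₂ hs₂ hS₂ hc₃ hs₃ hS₃ hS hTi hTo]
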